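/- Let $k$ be a field of characteristic zero. All Hopf algebras are over $k$ and have bijective antipode $S$. Coefficients over a Hopf algebra $H$ are left-left stable anti-Yetter-Drinfeld (SAYD) modules $M$: a left module and left comodule, $m\mapsto m_{(-1)}\otimes m_{(0)}$, with $(hm)_{(-1)}\otimes(hm)_{(0)}=h_{(1)}m_{(-1)}S^{-1}(h_{(3)})\otimes h_{(2)}m_{(0)}$ and $m_{(-1)}m_{(0)}=m$. If $S^2=\mathrm{id}$ (for example if $H$ is commutative), $M=k$ with trivial action and coaction is such a module. The tensor product $M\otimes N$ of SAYD modules over $H$ and $K$ is a SAYD module over $H\otimes K$. Let $\widetilde C_n(H,M)=H^{\otimes n+1}\,\square_H\,M\subseteq H^{\otimes n+1}\otimes M$ be the cyclic module with $$\delta_i(h_0\otimes\dots\otimes h_n\otimes m)=h_0\otimes\dots\otimes h_ih_{i+1}\otimes\dots\otimes h_n\otimes m\ (0\le i<n),\qquad \delta_n(h_0\otimes\dots\otimes h_n\otimes m)=h_{n(1)}h_0\otimes h_1\otimes\dots\otimes h_{n-1}\otimes h_{n(2)}m,$$ $$\sigma_i(h_0\otimes\dots\otimes h_n\otimes m)=h_0\otimes\dots\otimes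 h_i\otimes1\otimes\dots\otimes h_n\otimes m\ (0\le i\le n),\qquad \tau_n(h_0\otimes\dots\otimes h_n\otimes m)=h_{n(1)}\otimes h_0\otimes\dots\otimes h_{n-1}\otimes h_{n(2)}m.$$ Let $(\widetilde C(H,M),b,B)$ be its normalized mixed complex, $b=\sum(-1)^i\delta_i$, $B$ Connes' operator, and let $\widetilde{HC}_*(H,M)$ be the homology of the total complex $\mathrm{Tot}_n=\widetilde C_n\oplus\widetilde C_{n-2}\oplus\cdots$ with differential $b+B$. Let $$x\times y=\sum_\sigma \mathrm{sign}(\sigma)\;\sigma_{\sigma(p+q)-1}\cdots\sigma_{\sigma(p+1)-1}x\,\otimes\,\sigma_{\sigma(p)-1}\cdots\sigma_{\sigma(1)-1}y\in\widetilde C_{p+q}(H\otimes K,M\otimes N)$$ (sum over the $(p,q)$-shuffles $\sigma$ of $\{1,\dots,p+q\}$, i.e. permutations with $\sigma(1)<\dots<\sigma(p)$ and $\sigma(p+1)<\dots<\sigma(p+q)$) be the shuffle product of $x\in\widetilde C_p(H,M)$ and $y\in\widetilde C_q(K,N)$, where the tensor factors of $H$ and $K$ are paired up in the obvious way. Put $$(x_p,x_{p-2},\dots)\star(y_q,y_{q-2},\dots)=(Bx_p\times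 y_q,\;Bx_p\times y_{q-2},\dots).$$ 1. The map $\star$ sends pairs of cycles to cycles and induces bilinear maps $\star:\widetilde{HC}_p(H,M)\otimes\widetilde{HC}_q(K,N)\to\widetilde{HC}_{p+q+1}(H\otimes K,M\otimes N)$. Place $\widetilde{HC}_n$ in degree $n+1$ and let $x\bullet y=(-1)^{p+1}\,x\star y$ for $x\in\widetilde{HC}_p(H,M)$ (the Koszul sign of the degree-one operation $\star$). 2. The product $\bullet$ is associative: $(x\bullet y)\bullet z=x\bullet(y\bullet z)$ for $x\in\widetilde{HC}_p(H,M)$, $y\in\widetilde{HC}_q(K,N)$, $z\in\widetilde{HC}_r(L,P)$, under the identification $(H\otimes K)\otimes L\cong H\otimes(K\otimes L)$, $(M\otimes N)\otimes P\cong M\otimes(N\otimes P)$. 3. The product $\bullet$ is graded commutative: $x\bullet y=(-1)^{(p+1)(q+1)}\,y\bullet x$ for $x\in\widetilde{HC}_p(H,M)$, $y\in\widetilde{HC}_q(K,N)$, under the identification $K\otimes H\cong H\otimes K$, $N\otimes M\cong M\otimes N$ by the flips. 4. If $A$ is a commutative Hopf algebra, composing $\bullet$ (for $H=K=A$ and trivial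 coefficients) with the map induced by the multiplication $A\otimes A\to A$ makes $\widetilde{HC}_*(A)=\widetilde{HC}_*(A,k)$ an associative graded commutative (not necessarily unital) algebra, $\widetilde{HC}_p(A)\otimes\widetilde{HC}_q(A)\to\widetilde{HC}_{p+q+1}(A)$, with $\widetilde{HC}_n(A)$ in degree $n+1$. -/

import Mathlib

universe u v w

noncomputable section
/-! ## Cyclic modules, mixed complexes and cyclic homology -/


open TensorProduct

/-- A cyclic `k`-module: `k`-modules `X n` (`n ≥ 0`) with faces `d n i : X (n+1) → X n`
(`0 ≤ i ≤ n+1`), degeneracies `s n i : X n → X (n+1)` (`0 ≤ i ≤ n`) and cyclic operators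
`t n : X n → X n`, subject to the usual identities. Operators whose index `i` is outside the
indicated range carry no information and are never used. -/
structure CyclicModule (k : Type u) [CommRing k] where
  X : ℕ → Type w
  [acg : ∀ n, AddCommGroup (X n)]
  [mod : ∀ n, Module k (X n)]
  d : ∀ n, ℕ → X (n + 1) →ₗ[k] X n
  s : ∀ n, ℕ → X n →ₗ[k] X (n + 1)
  t : ∀ n, X n →ₗ[k] X n
  d_d : ∀ n i j, i ≤ j → j ≤ n + 1 → ∀ x, d n i (d (n + 1) (j + 1) x) = d n j (d (n + 1) i x)
  s_s : ∀ n i j, i ≤ j → j ≤ n → ∀ x, s (n + 1) i (s n j x) = s (n + 1) (j + 1) (s n i x)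
  d_s_lt : ∀ n i j, i ≤ j → j ≤ n → ∀ x, d (n + 1) i (s (n + 1) (j + 1) x) = s n j (d n i x)
  d_s_self : ∀ n j, j ≤ n → ∀ x, d n j (s n j x) = x
  d_s_succ : ∀ n j, j ≤ n → ∀ x, d n (j + 1) (s n j x) = x
  d_s_gt : ∀ n i j, j < i → i ≤ n + 1 → ∀ x,
    d (n + 1) (i + 1) (s (n + 1) j x) = s n j (d n i x)
  d_t_succ : ∀ n i, i ≤ n → ∀ x, d n (i + 1) (t (n + 1) x) = t n (d n i x)
  d_t_zero : ∀ n x, d n 0 (t (n + 1) x) = d n (n + 1) x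
  s_t_succ : ∀ n i, i < n → ∀ x, s n (i + 1) (t n x) = t (n + 1) (s n i x)
  s_t_zero : ∀ n x, s n 0 (t n x) = t (n + 1) (t (n + 1) (s n n x))
  t_pow : ∀ n x, (t n ^ (n + 1)) x = x

namespace CyclicModule

attribute [instance] CyclicModule.acg CyclicModule.mod

variable {k : Type u} [CommRing k]

/-- A morphism of cyclic modules. -/
structure Hom (C : CyclicModule.{u, v} k) (D : CyclicModule.{u, w} k) where
  f : ∀ n, C.X n →ₗ[k] D.X n
  f_d : ∀ n i, i ≤ n + 1 → ∀ x, f n (C.d n i x) = D.d n i (f (n + 1) x)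
  f_s : ∀ n i, i ≤ n → ∀ x, f (n + 1) (C.s n i x) = D.s n i (f n x)
  f_t : ∀ n x, f n (C.t n x) = D.t n (f n x)

/-- A morphism of cyclic modules `C × C' → D` from the diagonal cyclic module
`(C × C')_n = C_n ⊗ C'_n`, given as a family of bilinear maps `C_n × C'_n → D_n`. -/
structure Pairing (C : CyclicModule.{u, v} k) (C' : CyclicModule.{u, v} k)
    (D : CyclicModule.{u, w} k) where
  f : ∀ n, C.X n →ₗ[k] C'.X n →ₗ[k] D.X n
  f_d : ∀ n i, i ≤ n + 1 → ∀ x y, f n (C.d n i x) (C'.d n i y) = D.d n i (f (n + 1) x y)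
  f_s : ∀ n i, i ≤ n → ∀ x y, f (n + 1) (C.s n i x) (C'.s n i y) = D.s n i (f n x y)
  f_t : ∀ n x y, f n (C.t n x) (C'.t n y) = D.t n (f n x y)

section Single

variable (C : CyclicModule.{u, v} k)

/-- The submodule of degenerate elements. -/
def degen : ∀ n, Submodule k (C.X n)
  | 0 => ⊥
  | n + 1 => ⨆ i : Fin (n + 1), LinearMap.range (C.s n i)

/-- The terms of the normalized complex. -/
abbrev NX (n : ℕ) : Type v := C.X n ⧸ C.degen n

/-- The Hochschild differential `b = ∑ (-1)^i d_i`. -/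
def b (n : ℕ) : C.X (n + 1) →ₗ[k] C.X n :=
  ∑ i ∈ Finset.range (n + 2), (-1 : k) ^ i • C.d n i

/-- The cyclic operator with its sign, `λ = (-1)^n t`. -/
def lam (n : ℕ) : C.X n →ₗ[k] C.X n := (-1 : k) ^ n • C.t n

/-- The norm operator `N = 1 + λ + ⋯ + λ^n`. -/
def norm (n : ℕ) : C.X n →ₗ[k] C.X n := ∑ i ∈ Finset.range (n + 1), C.lam n ^ i

/-- The extra degeneracy `t s_n`. -/
def extra (n : ℕ) : C.X n →ₗ[k] C.X (n + 1) := C.t (n + 1) ∘ₗ C.s n n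

/-- Connes' operator `B = (1 - λ) s_{-1} N`. -/
def connes (n : ℕ) : C.X n →ₗ[k] C.X (n + 1) :=
  (LinearMap.id - C.lam (n + 1)) ∘ₗ C.extra n ∘ₗ C.norm n

variable {C}

theorem s_mem_degen {n i : ℕ} (h : i ≤ n) (x : C.X n) : C.s n i x ∈ C.degen (n + 1) :=
  Submodule.mem_iSup_of_mem (p := fun i : Fin (n + 1) => LinearMap.range (C.s n i))
    ⟨i, Nat.lt_succ_of_le h⟩ ⟨x, rfl⟩

theorem degen_succ_le {n : ℕ} {W : Submodule k (C.X (n + 1))}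
    (h : ∀ i ≤ n, ∀ x, C.s n i x ∈ W) : C.degen (n + 1) ≤ W := by
  refine iSup_le fun i => ?_
  rintro _ ⟨x, rfl⟩
  exact h i (Nat.le_of_lt_succ i.2) x

variable (C)

theorem b_degen (n : ℕ) : C.degen (n + 1) ≤ (C.degen n).comap (C.b n) := by
  refine degen_succ_le fun j hj x => ?_
  rw [Submodule.mem_comap, b, LinearMap.sum_apply]
  have hsplit : Finset.range (n + 2) =
      insert j (insert (j + 1) (((Finset.range (n + 2)).erase j).erase (j + 1))) := by
    ext a; simp only [Finset.mem_range, Finset.mem_insert, Finset.mem_erase]; omega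
  rw [hsplit, Finset.sum_insert (by simp), Finset.sum_insert (by simp)]
  simp only [LinearMap.smul_apply]
  rw [C.d_s_self n j hj, C.d_s_succ n j hj, ← add_assoc, pow_succ]
  have h0 : (-1 : k) ^ j • x + ((-1 : k) ^ j * -1) • x = 0 := by
    rw [← add_smul]; simp
  rw [h0, zero_add]
  refine Submodule.sum_mem _ fun i hi => Submodule.smul_mem _ _ ?_
  simp only [Finset.mem_range, Finset.mem_erase] at hi
  cases n with
  | zero => omega
  | succ n =>
    rcases lt_or_ge i j with h | h
    · obtain ⟨j, rfl⟩ : ∃ j', j = j' + 1 := ⟨j - 1, by omega⟩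
      rw [C.d_s_lt n i j (by omega) (by omega)]
      exact s_mem_degen (by omega) _
    · obtain ⟨i, rfl⟩ : ∃ i', i = i' + 1 := ⟨i - 1, by omega⟩
      rw [C.d_s_gt n i j (by omega) (by omega)]
      exact s_mem_degen (by omega) _

/-- Degenerate elements together with the image of the extra degeneracy. -/
def degenPlus (n : ℕ) : Submodule k (C.X (n + 1)) :=
  C.degen (n + 1) ⊔ LinearMap.range (C.extra n)

theorem t_degenPlus (n : ℕ) : C.degenPlus n ≤ (C.degenPlus n).comap (C.t (n + 1)) := by
  refine sup_le (degen_succ_le fun j hj x => ?_) ?_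
  · rw [Submodule.mem_comap]
    rcases eq_or_lt_of_le hj with rfl | h
    · exact Submodule.mem_sup_right ⟨x, rfl⟩
    · rw [← C.s_t_succ n j h]
      exact Submodule.mem_sup_left (s_mem_degen h _)
  · rintro _ ⟨x, rfl⟩
    rw [Submodule.mem_comap, extra, LinearMap.comp_apply, ← C.s_t_zero]
    exact Submodule.mem_sup_left (s_mem_degen (Nat.zero_le _) _)

theorem extra_degenPlus (n : ℕ) :
    C.degenPlus n ≤ (C.degen (n + 2)).comap (C.extra (n + 1)) := by
  refine sup_le (degen_succ_le fun j hj x => ?_) ?_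
  · rw [Submodule.mem_comap, extra, LinearMap.comp_apply, ← C.s_s n j n hj le_rfl,
      ← C.s_t_succ (n + 1) j (by omega)]
    exact s_mem_degen (by omega) _
  · rintro _ ⟨x, rfl⟩
    rw [Submodule.mem_comap, extra, extra, LinearMap.comp_apply, LinearMap.comp_apply]
    rw [C.s_t_succ (n + 1) n (by omega), C.s_s n n n le_rfl le_rfl, ← C.s_t_zero]
    exact s_mem_degen (by omega) _

theorem connes_degen (n : ℕ) : C.degen n ≤ (C.degen (n + 1)).comap (C.connes n) := by
  intro x hx
  have key : C.extra n (C.norm n x) ∈ C.degen (n + 1) := by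
    cases n with
    | zero =>
      have hx0 : x = 0 := hx
      simp [hx0]
    | succ n =>
      have hx' : x ∈ C.degenPlus n := Submodule.mem_sup_left hx
      refine extra_degenPlus C n ?_
      rw [norm, LinearMap.sum_apply]
      refine Submodule.sum_mem _ fun i hi => ?_
      clear hi
      induction i with
      | zero => simpa using hx'
      | succ i ih =>
        rw [pow_succ', Module.End.mul_apply]
        exact Submodule.smul_mem _ _ (t_degenPlus C n ih)
  rw [Submodule.mem_comap, connes, LinearMap.comp_apply, LinearMap.comp_apply,
    LinearMap.sub_apply, LinearMap.id_apply]
  refine Submodule.sub_mem _ key ?_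
  rw [lam, LinearMap.smul_apply, extra, LinearMap.comp_apply, ← C.s_t_zero]
  exact Submodule.smul_mem _ _ (s_mem_degen (Nat.zero_le _) _)

/-- The Hochschild differential of the normalized complex. -/
def bN (n : ℕ) : C.NX (n + 1) →ₗ[k] C.NX n :=
  (C.degen (n + 1)).mapQ (C.degen n) (C.b n) (C.b_degen n)

/-- Connes' operator of the normalized complex. -/
def BN (n : ℕ) : C.NX n →ₗ[k] C.NX (n + 1) :=
  (C.degen n).mapQ (C.degen (n + 1)) (C.connes n) (C.connes_degen n)

/-- The total complex of the `(b, B)`-bicomplex in degree `n`: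
`NX n ⊕ NX (n-2) ⊕ NX (n-4) ⊕ ⋯`, realized inside `∏ m, NX m` as the families supported in
the degrees `m ≤ n` with `m ≡ n` modulo `2`. -/
def Tot (n : ℕ) : Submodule k (∀ m, C.NX m) where
  carrier := {x | ∀ m, ¬ (m ≤ n ∧ Even (n - m)) → x m = 0}
  add_mem' := fun {x y} hx hy m hm => by rw [Pi.add_apply, hx m hm, hy m hm, add_zero]
  zero_mem' := fun _ _ => rfl
  smul_mem' := fun c x hx m hm => by rw [Pi.smul_apply, hx m hm, smul_zero]

/-- The sum `b + B`, in each degree. -/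
def bB : ∀ m, (∀ j, C.NX j) →ₗ[k] C.NX m
  | 0 => C.bN 0 ∘ₗ LinearMap.proj 1
  | m + 1 => C.bN (m + 1) ∘ₗ LinearMap.proj (m + 2) + C.BN m ∘ₗ LinearMap.proj m

/-- The differential `Tot n → Tot (n-1)`, `(x_n, x_{n-2}, …) ↦ (b x_n + B x_{n-2}, …)`;
it vanishes for `n = 0`. -/
def dTot (n : ℕ) : (∀ m, C.NX m) →ₗ[k] (∀ m, C.NX m) :=
  LinearMap.pi fun m => if m < n then C.bB m else 0

/-- Cycles of degree `n` in the total complex. -/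
def cycles (n : ℕ) : Submodule k (∀ m, C.NX m) := C.Tot n ⊓ LinearMap.ker (C.dTot n)

/-- Boundaries of degree `n` in the total complex. -/
def boundaries (n : ℕ) : Submodule k (∀ m, C.NX m) := (C.Tot (n + 1)).map (C.dTot (n + 1))

/-- Cyclic homology of a cyclic module: the homology of the total complex. -/
abbrev HC (n : ℕ) : Type v := C.cycles n ⧸ (C.boundaries n).submoduleOf (C.cycles n)

variable {C}

/-- The class of a cycle in cyclic homology. -/
def HC.cls {n : ℕ} (x : C.cycles n) : C.HC n := Submodule.Quotient.mk x

end Single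

section Functoriality

variable {C : CyclicModule.{u, v} k} {D : CyclicModule.{u, w} k} (φ : Hom C D)

theorem Hom.f_degen (n : ℕ) : C.degen n ≤ (D.degen n).comap (φ.f n) := by
  cases n with
  | zero => exact bot_le
  | succ n =>
    refine degen_succ_le fun i hi x => ?_
    rw [Submodule.mem_comap, φ.f_s n i hi]
    exact s_mem_degen hi _

/-- The map induced on normalized complexes. -/
def Hom.fN (n : ℕ) : C.NX n →ₗ[k] D.NX n :=
  (C.degen n).mapQ (D.degen n) (φ.f n) (φ.f_degen n)

theorem Hom.f_b (n : ℕ) (x : C.X (n + 1)) : φ.f n (C.b n x) = D.b n (φ.f (n + 1) x) := by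
  simp only [b, LinearMap.sum_apply, LinearMap.smul_apply, map_sum, map_smul]
  refine Finset.sum_congr rfl fun i hi => ?_
  rw [φ.f_d n i (by have := Finset.mem_range.1 hi; omega)]

theorem Hom.f_lam (n : ℕ) (x : C.X n) : φ.f n (C.lam n x) = D.lam n (φ.f n x) := by
  simp only [lam, LinearMap.smul_apply, map_smul, φ.f_t]

theorem Hom.f_connes (n : ℕ) (x : C.X n) :
    φ.f (n + 1) (C.connes n x) = D.connes n (φ.f n x) := by
  have h : ∀ i, φ.f n ((C.lam n ^ i) x) = (D.lam n ^ i) (φ.f n x) := by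
    intro i
    induction i with
    | zero => rfl
    | succ i ih => rw [pow_succ', pow_succ', Module.End.mul_apply, Module.End.mul_apply,
        φ.f_lam, ih]
  simp only [connes, extra, norm, LinearMap.comp_apply, LinearMap.sub_apply, LinearMap.id_apply,
    map_sub, φ.f_lam, φ.f_t, φ.f_s n n le_rfl, LinearMap.sum_apply, map_sum, h]

/-- The map induced on (the product containing) the total complexes. -/
def Hom.fTot : (∀ m, C.NX m) →ₗ[k] (∀ m, D.NX m) :=
  LinearMap.pi fun m => φ.fN m ∘ₗ LinearMap.proj m

theorem Hom.fTot_mem {n : ℕ} {x : ∀ m, C.NX m} (hx : x ∈ C.Tot n) : φ.fTot x ∈ D.Tot n := by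
  intro m hm
  change φ.fN m (x m) = 0
  rw [hx m hm, map_zero]

theorem Hom.fTot_dTot (n : ℕ) (x : ∀ m, C.NX m) :
    φ.fTot (C.dTot n x) = D.dTot n (φ.fTot x) := by
  have hb : ∀ m (y : C.NX (m + 1)), φ.fN m (C.bN m y) = D.bN m (φ.fN (m + 1) y) := by
    intro m y
    induction y using Submodule.Quotient.induction_on with
    | H y => exact congrArg Submodule.Quotient.mk (φ.f_b m y)
  have hB : ∀ m (y : C.NX m), φ.fN (m + 1) (C.BN m y) = D.BN m (φ.fN m y) := by
    intro m y
    induction y using Submodule.Quotient.induction_on with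
    | H y => exact congrArg Submodule.Quotient.mk (φ.f_connes m y)
  funext m
  simp only [Hom.fTot, dTot, LinearMap.pi_apply, LinearMap.comp_apply, LinearMap.proj_apply]
  split_ifs
  · cases m with
    | zero => simp [bB, hb]
    | succ m => simp [bB, hb, hB]
  · simp

theorem Hom.fTot_cycles (n : ℕ) : C.cycles n ≤ (D.cycles n).comap φ.fTot := by
  rintro x ⟨hx, hx'⟩
  refine ⟨φ.fTot_mem hx, ?_⟩
  rw [SetLike.mem_coe, LinearMap.mem_ker] at *
  rw [← φ.fTot_dTot, hx', map_zero]

/-- The map induced in cyclic homology by a morphism of cyclic modules. -/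
def Hom.mapHC (n : ℕ) : C.HC n →ₗ[k] D.HC n :=
  Submodule.mapQ _ _ (φ.fTot.restrict (φ.fTot_cycles n)) <| by
    rintro ⟨x, hx⟩ ⟨y, hy, rfl⟩
    exact ⟨φ.fTot y, φ.fTot_mem hy, (φ.fTot_dTot _ y).symm⟩

end Functoriality

section Shuffle

variable (C : CyclicModule.{u, v} k)

/-- The degeneracy `s_i` as an operator on `∏ n, X n`, raising degrees by one; it is zero on
`X n` for `i > n`. -/
def sOp (i : ℕ) : (∀ n, C.X n) →ₗ[k] (∀ n, C.X n) :=
  LinearMap.pi fun m => match m with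
    | 0 => 0
    | n + 1 => if i ≤ n then C.s n i ∘ₗ LinearMap.proj n else 0

/-- `sList [i₁, …, i_r] = s_{i_r} ∘ ⋯ ∘ s_{i₁}`. -/
def sList : List ℕ → (∀ n, C.X n) →ₗ[k] (∀ n, C.X n)
  | [] => LinearMap.id
  | i :: l => sList l ∘ₗ C.sOp i

/-- The iterated degeneracy `s_{i_r} ⋯ s_{i₁} : X p → X n`; it is zero unless `n = p + r`. -/
def degs (l : List ℕ) (p n : ℕ) : C.X p →ₗ[k] C.X n :=
  LinearMap.proj n ∘ₗ C.sList l ∘ₗ LinearMap.single k C.X p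

theorem sOp_sOp {i j : ℕ} (h : i ≤ j) (x : ∀ n, C.X n) :
    C.sOp i (C.sOp j x) = C.sOp (j + 1) (C.sOp i x) := by
  funext m
  rcases m with _ | _ | n
  · rfl
  · by_cases hi : i ≤ 0 <;> simp [sOp, hi]
  · by_cases hj : j ≤ n
    · simp [sOp, hj, h.trans hj, (h.trans hj).trans (Nat.le_succ n), C.s_s n i j h hj]
    · by_cases hi : i ≤ n + 1 <;> simp [sOp, hj, hi]

theorem sList_sOp_of_lt (l : List ℕ) (m : ℕ) (h : ∀ a ∈ l, m < a) (x : ∀ n, C.X n) :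
    ∃ y, C.sList l (C.sOp m x) = C.sOp m y := by
  induction l generalizing x with
  | nil => exact ⟨x, rfl⟩
  | cons a l ih =>
    obtain ⟨a, rfl⟩ : ∃ a', a = a' + 1 := ⟨a - 1, by have := h a (by simp); omega⟩
    have ha : m ≤ a := by have := h (a + 1) (by simp); omega
    rw [sList, LinearMap.comp_apply, ← C.sOp_sOp ha]
    exact ih (fun b hb => h b (by simp [hb])) _

theorem sList_of_mem (l : List ℕ) (hl : l.Pairwise (· < ·)) (m : ℕ) (hm : m ∈ l)
    (x : ∀ n, C.X n) : ∃ y, C.sList l x = C.sOp m y := by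
  induction l generalizing x with
  | nil => simp at hm
  | cons a l ih =>
    rw [List.pairwise_cons] at hl
    rcases List.mem_cons.1 hm with rfl | hm
    · exact C.sList_sOp_of_lt l m hl.1 x
    · exact ih hl.2 hm _

theorem countP_lt_bound (l : List ℕ) (hl : l.Pairwise (· < ·)) (a m : ℕ) (h : ∀ b ∈ l, a < b) :
    a + l.countP (· < m) < m ∨ l.countP (· < m) = 0 := by
  induction l generalizing a with
  | nil => right; rfl
  | cons b l ih =>
    rw [List.pairwise_cons] at hl
    have hab := h b (by simp)
    rw [List.countP_cons]
    have := ih hl.2 b hl.1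
    have := ih hl.2 a (fun c hc => h c (by simp [hc]))
    by_cases hb : b < m
    · simp only [hb, decide_true, if_true]; omega
    · simp only [hb, decide_false, Bool.false_eq_true, if_false]; omega

theorem sList_sOp_of_notMem (l : List ℕ) (hl : l.Pairwise (· < ·)) (m : ℕ) (hm : m ∉ l)
    (x : ∀ n, C.X n) : ∃ y, C.sList l (C.sOp (m - l.countP (· < m)) x) = C.sOp m y := by
  induction l generalizing x with
  | nil => exact ⟨x, rfl⟩
  | cons a l ih =>
    rw [List.pairwise_cons] at hl
    rcases lt_or_ge a m with h | h
    · have hb := countP_lt_bound l hl.2 a m hl.1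
      have e : m - (a :: l).countP (· < m) = m - l.countP (· < m) - 1 := by
        rw [List.countP_cons]; simp only [h, decide_true, if_true]; omega
      have e' : m - l.countP (· < m) - 1 + 1 = m - l.countP (· < m) := by omega
      rw [sList, LinearMap.comp_apply, e, C.sOp_sOp (by omega), e']
      exact ih hl.2 (fun h' => hm (by simp [h'])) _
    · have hne : a ≠ m := fun h' => hm (by simp [h'])
      have hall : ∀ b ∈ a :: l, m < b := by
        intro b hb
        rcases List.mem_cons.1 hb with rfl | hb
        · omega
        · have := hl.1 b hb; omega
      have e : (a :: l).countP (· < m) = 0 := by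
        rw [List.countP_eq_zero]
        intro b hb
        have := hall b hb
        simp; omega
      rw [e]
      exact C.sList_sOp_of_lt _ m hall x

theorem sOp_single (j p : ℕ) (hj : j ≤ p) (x : C.X p) :
    LinearMap.single k C.X (p + 1) (C.s p j x) = C.sOp j (LinearMap.single k C.X p x) := by
  funext m
  rcases m with _ | n
  · simp [sOp]
  · by_cases h : n = p
    · subst h; simp [sOp, hj]
    · have h' : n + 1 ≠ p + 1 := by omega
      by_cases hn : j ≤ n <;> simp [sOp, hn, Pi.single_eq_of_ne h, Pi.single_eq_of_ne h']

end Shuffle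

/-- `(p, q)`-shuffles: permutations `σ` of `{0, …, p + q - 1}` with
`σ 0 < ⋯ < σ (p-1)` and `σ p < ⋯ < σ (p+q-1)`. -/
def IsShuffle (p q : ℕ) (σ : Equiv.Perm (Fin (p + q))) : Prop :=
  StrictMono (fun i : Fin p => σ (Fin.castAdd q i)) ∧
    StrictMono (fun j : Fin q => σ (Fin.natAdd p j))

/-- `[σ 0, …, σ (p-1)]`. -/
def shufL (p q : ℕ) (σ : Equiv.Perm (Fin (p + q))) : List ℕ :=
  List.ofFn fun i : Fin p => (σ (Fin.castAdd q i) : ℕ)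

/-- `[σ p, …, σ (p+q-1)]`. -/
def shufR (p q : ℕ) (σ : Equiv.Perm (Fin (p + q))) : List ℕ :=
  List.ofFn fun j : Fin q => (σ (Fin.natAdd p j) : ℕ)

theorem countP_ofFn (p m : ℕ) (f : Fin p → ℕ) :
    (List.ofFn f).countP (· < m) = ∑ i, if f i < m then 1 else 0 := by
  induction p with
  | zero => rfl
  | succ p ih =>
    rw [List.ofFn_succ, List.countP_cons, ih, Fin.sum_univ_succ, add_comm]
    simp

theorem sum_lt_fin (n m : ℕ) (h : m ≤ n) :
    (∑ i : Fin n, if (i : ℕ) < m then 1 else 0) = m := by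
  rw [Fin.sum_univ_eq_sum_range (fun i => if i < m then 1 else 0) n, Finset.sum_ite]
  simp only [Finset.sum_const, smul_eq_mul, mul_one, mul_zero, add_zero]
  have : (Finset.range n).filter (· < m) = Finset.range m := by
    ext a; simp only [Finset.mem_filter, Finset.mem_range]; omega
  rw [this, Finset.card_range]

theorem countP_shuf (p q : ℕ) (σ : Equiv.Perm (Fin (p + q))) (m : Fin (p + q)) :
    (shufL p q σ).countP (· < (m : ℕ)) + (shufR p q σ).countP (· < (m : ℕ)) = m := by
  rw [shufL, shufR, countP_ofFn, countP_ofFn,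
    ← Fin.sum_univ_add (fun i : Fin (p + q) => if (σ i : ℕ) < (m : ℕ) then 1 else 0),
    Equiv.sum_comp σ (fun i : Fin (p + q) => if (i : ℕ) < (m : ℕ) then 1 else 0)]
  exact sum_lt_fin _ _ m.2.le

theorem countP_ofFn_strictMono {p : ℕ} {n : ℕ} (f : Fin p → Fin n) (hf : StrictMono f)
    (j : Fin p) : (List.ofFn fun i => (f i : ℕ)).countP (· < (f j : ℕ)) = j := by
  rw [countP_ofFn]
  simp only [Fin.val_fin_lt, hf.lt_iff_lt]
  exact sum_lt_fin p j j.2.le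

theorem pairwise_ofFn {p n : ℕ} (f : Fin p → Fin n) (hf : StrictMono f) :
    (List.ofFn fun i => (f i : ℕ)).Pairwise (· < ·) := by
  rw [List.pairwise_ofFn]
  exact fun i j h => hf h

namespace Pairing

variable {C C' : CyclicModule.{u, v} k} {D : CyclicModule.{u, w} k} (ω : Pairing C C' D)

instance (p q : ℕ) : DecidablePred (IsShuffle p q) := Classical.decPred _

/-- The shuffle product `x × y = ∑_σ sign(σ) ω(s_{σ(p+q-1)} ⋯ s_{σ(p)} x, s_{σ(p-1)} ⋯ s_{σ(0)} y)`
of `x ∈ X p` and `y ∈ X' q`, the sum being over the `(p, q)`-shuffles. It lives in degree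
`n = p + q` (for other `n` the expression below is zero). -/
def sh (p q n : ℕ) : C.X p →ₗ[k] C'.X q →ₗ[k] D.X n :=
  ∑ σ ∈ Finset.univ.filter (IsShuffle p q),
    ((Equiv.Perm.sign σ : ℤ) : k) •
      (ω.f n).compl₁₂ (C.degs (shufR p q σ) p n) (C'.degs (shufL p q σ) q n)

theorem f_sOp_mem (m n : ℕ) (x : ∀ n, C.X n) (y : ∀ n, C'.X n) :
    ω.f n (C.sOp m x n) (C'.sOp m y n) ∈ D.degen n := by
  rcases n with _ | n
  · have : C.sOp m x 0 = 0 := rfl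
    rw [this, map_zero, LinearMap.zero_apply]
    exact Submodule.zero_mem _
  · by_cases h : m ≤ n
    · simp only [sOp, LinearMap.pi_apply, h, if_true, LinearMap.comp_apply]
      rw [ω.f_s n m h]
      exact s_mem_degen h _
    · simp [sOp, h]

theorem sh_degen_left (p q n : ℕ) (x : C.X p) (hx : x ∈ C.degen p) (y : C'.X q) :
    ω.sh p q n x y ∈ D.degen n := by
  suffices h : C.degen p ≤ (D.degen n).comap ((ω.sh p q n).flip y) from h hx
  clear hx x
  cases p with
  | zero => exact bot_le
  | succ p =>
    refine degen_succ_le fun j hj x => ?_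
    rw [Submodule.mem_comap, LinearMap.flip_apply, sh, LinearMap.sum_apply, LinearMap.sum_apply]
    refine Submodule.sum_mem _ fun σ hσ => ?_
    obtain ⟨hσ₁, hσ₂⟩ := (Finset.mem_filter.1 hσ).2
    rw [LinearMap.smul_apply, LinearMap.smul_apply]
    refine Submodule.smul_mem _ _ ?_
    rw [LinearMap.compl₁₂_apply]
    simp only [degs, LinearMap.comp_apply, LinearMap.proj_apply]
    rw [C.sOp_single j p hj]
    let j' : Fin (p + 1) := ⟨j, Nat.lt_succ_of_le hj⟩
    have hc := countP_shuf (p + 1) q σ (σ (Fin.castAdd q j'))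
    have hL : (shufL (p + 1) q σ).countP (· < (σ (Fin.castAdd q j') : ℕ)) = j :=
      countP_ofFn_strictMono _ hσ₁ j'
    have hj' : j = (σ (Fin.castAdd q j') : ℕ) -
        (shufR (p + 1) q σ).countP (· < (σ (Fin.castAdd q j') : ℕ)) := by omega
    obtain ⟨u, hu⟩ := C.sList_sOp_of_notMem (shufR (p + 1) q σ) (pairwise_ofFn _ hσ₂)
      (σ (Fin.castAdd q j')) (by
        rw [shufR, List.mem_ofFn]
        rintro ⟨i, hi⟩
        have := σ.injective (Fin.ext hi)
        have := congrArg Fin.val this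
        simp at this
        omega) (LinearMap.single k C.X p x)
    rw [← hj'] at hu
    obtain ⟨w, hw⟩ := C'.sList_of_mem (shufL (p + 1) q σ) (pairwise_ofFn _ hσ₁)
      (σ (Fin.castAdd q j')) (by rw [shufL, List.mem_ofFn]; exact ⟨j', rfl⟩)
      (LinearMap.single k C'.X q y)
    rw [hu, hw]
    exact ω.f_sOp_mem _ _ _ _

theorem sh_degen_right (p q n : ℕ) (x : C.X p) (y : C'.X q) (hy : y ∈ C'.degen q) :
    ω.sh p q n x y ∈ D.degen n := by
  suffices h : C'.degen q ≤ (D.degen n).comap (ω.sh p q n x) from h hy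
  clear hy y
  cases q with
  | zero => exact bot_le
  | succ q =>
    refine degen_succ_le fun j hj y => ?_
    rw [Submodule.mem_comap, sh, LinearMap.sum_apply, LinearMap.sum_apply]
    refine Submodule.sum_mem _ fun σ hσ => ?_
    obtain ⟨hσ₁, hσ₂⟩ := (Finset.mem_filter.1 hσ).2
    rw [LinearMap.smul_apply, LinearMap.smul_apply]
    refine Submodule.smul_mem _ _ ?_
    rw [LinearMap.compl₁₂_apply]
    simp only [degs, LinearMap.comp_apply, LinearMap.proj_apply]
    rw [C'.sOp_single j q hj]
    let j' : Fin (q + 1) := ⟨j, Nat.lt_succ_of_le hj⟩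
    have hc := countP_shuf p (q + 1) σ (σ (Fin.natAdd p j'))
    have hR : (shufR p (q + 1) σ).countP (· < (σ (Fin.natAdd p j') : ℕ)) = j :=
      countP_ofFn_strictMono _ hσ₂ j'
    have hj' : j = (σ (Fin.natAdd p j') : ℕ) -
        (shufL p (q + 1) σ).countP (· < (σ (Fin.natAdd p j') : ℕ)) := by omega
    obtain ⟨u, hu⟩ := C'.sList_sOp_of_notMem (shufL p (q + 1) σ) (pairwise_ofFn _ hσ₁)
      (σ (Fin.natAdd p j')) (by
        rw [shufL, List.mem_ofFn]
        rintro ⟨i, hi⟩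
        have := σ.injective (Fin.ext hi)
        have := congrArg Fin.val this
        simp at this
        omega) (LinearMap.single k C'.X q y)
    rw [← hj'] at hu
    obtain ⟨w, hw⟩ := C.sList_of_mem (shufR p (q + 1) σ) (pairwise_ofFn _ hσ₂)
      (σ (Fin.natAdd p j')) (by rw [shufR, List.mem_ofFn]; exact ⟨j', rfl⟩)
      (LinearMap.single k C.X p x)
    rw [hu, hw]
    exact ω.f_sOp_mem _ _ _ _

/-- The shuffle product on normalized complexes. -/
def cross (p q n : ℕ) : C.NX p →ₗ[k] C'.NX q →ₗ[k] D.NX n :=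
  (C.degen p).liftQ
    (LinearMap.flip <| (C'.degen q).liftQ
      (((ω.sh p q n).compr₂ (D.degen n).mkQ).flip) fun y hy => by
        ext x
        exact (Submodule.Quotient.mk_eq_zero _).2 (ω.sh_degen_right p q n x y hy))
    fun x hx => by
      ext y
      exact (Submodule.Quotient.mk_eq_zero _).2 (ω.sh_degen_left p q n x hx y)

theorem cross_mk (p q n : ℕ) (x : C.X p) (y : C'.X q) :
    ω.cross p q n (Submodule.Quotient.mk x) (Submodule.Quotient.mk y) =
      Submodule.Quotient.mk (ω.sh p q n x y) := rfl

/-- The map `⋆` on total complexes,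
`(x_p, x_{p-2}, …) ⋆ (y_q, y_{q-2}, …) = (B x_p × y_q, B x_p × y_{q-2}, …)`.
(In degree `m` at most one summand is non-zero, namely the one with `p + 1 + j = m`.) -/
def starTot (p q : ℕ) : (∀ m, C.NX m) →ₗ[k] (∀ m, C'.NX m) →ₗ[k] (∀ m, D.NX m) :=
  LinearMap.mk₂ k
    (fun x y m => ∑ j ∈ Finset.range (q + 1), ω.cross (p + 1) j m (C.BN p (x p)) (y j))
    (fun x x' y => by funext m; simp [Finset.sum_add_distrib])
    (fun c x y => by funext m; simp [Finset.smul_sum])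
    (fun x y y' => by funext m; simp [Finset.sum_add_distrib])
    (fun c x y => by funext m; simp [Finset.smul_sum])

/-- A bilinear map on cyclic homology is induced by `⋆` if, for all cycles `x` and `y`, the chain
`x ⋆ y` is a cycle and its class is the value on the classes of `x` and `y`. -/
def IsInducedByStar {p q n : ℕ} (F : C.HC p →ₗ[k] C'.HC q →ₗ[k] D.HC n) : Prop :=
  ∀ (x : C.cycles p) (y : C'.cycles q),
    ∃ h : ω.starTot p q x y ∈ D.cycles n, F (HC.cls x) (HC.cls y) = HC.cls ⟨_, h⟩

open Classical in
/-- The bilinear map on cyclic homology induced by `⋆` (zero if there is none; it is unique since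
every homology class is the class of a cycle). -/
def star (p q n : ℕ) : C.HC p →ₗ[k] C'.HC q →ₗ[k] D.HC n :=
  if h : ∃ F : C.HC p →ₗ[k] C'.HC q →ₗ[k] D.HC n, ω.IsInducedByStar F then h.choose else 0

end Pairing

end CyclicModule

/-! ## Hopf algebras with bijective antipode and stable anti-Yetter-Drinfeld modules -/

open Coalgebra HopfAlgebra

/-- The antipode of the Hopf algebra `H` is bijective. -/
class HasBijectiveAntipode (k H : Type u) [Field k] [Ring H] [HopfAlgebra k H] : Prop where
  bij : Function.Bijective (antipode k : H →ₗ[k] H)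

/-- The inverse `S⁻¹` of a bijective antipode. -/
def antipodeInv (k H : Type u) [Field k] [Ring H] [HopfAlgebra k H] [HasBijectiveAntipode k H] :
    H →ₗ[k] H :=
  (LinearEquiv.ofBijective (antipode k : H →ₗ[k] H) HasBijectiveAntipode.bij).symm.toLinearMap

section Antipode

variable (k H : Type u) [Field k] [Ring H] [HopfAlgebra k H]

theorem antipodeInv_antipode [HasBijectiveAntipode k H] (h : H) :
    antipodeInv k H (antipode k h) = h :=
  (LinearEquiv.ofBijective (antipode k : H →ₗ[k] H) HasBijectiveAntipode.bij).symm_apply_apply h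

theorem antipode_antipodeInv [HasBijectiveAntipode k H] (h : H) :
    antipode k (antipodeInv k H h) = h :=
  (LinearEquiv.ofBijective (antipode k : H →ₗ[k] H) HasBijectiveAntipode.bij).apply_symm_apply h

/-- `∑ h₂ S⁻¹(h₁) = ε(h)`. -/
theorem sum_right_mul_antipodeInv_left [HasBijectiveAntipode k H] (h : H) :
    TensorProduct.lift ((LinearMap.mul k H).flip ∘ₗ antipodeInv k H) (comul h) =
      counit (R := k) h • (1 : H) := by
  have key : antipode k (TensorProduct.lift ((LinearMap.mul k H).flip ∘ₗ antipodeInv k H)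
      (comul (R := k) h)) = antipode k (counit (R := k) h • (1 : H)) := by
    rw [map_smul, antipode_one]
    have := sum_mul_antipode_eq_smul (ℛ k h)
    rw [← this, ← (ℛ k h).eq]
    simp only [map_sum, TensorProduct.lift.tmul, LinearMap.comp_apply, LinearMap.flip_apply,
      LinearMap.mul_apply', antipode_mul_antidistrib, antipode_antipodeInv]
  exact HasBijectiveAntipode.bij.injective key

theorem hasBijectiveAntipode_of_involutive
    (hS : ∀ h : H, antipode k (antipode k h) = h) : HasBijectiveAntipode k H :=
  ⟨Function.Involutive.bijective hS⟩

end Antipode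

theorem antipode_antipode_of_comm (k A : Type u) [Field k] [CommRing A] [HopfAlgebra k A] (a : A) :
    antipode k (antipode k a) = a := by
  have h := inv_inv (WithConv.toConv (AlgHom.id k A))
  have h' := congrArg (fun f => f.ofConv a) h
  exact h'

instance (priority := low) hasBijectiveAntipode_of_comm (k A : Type u) [Field k] [CommRing A]
    [HopfAlgebra k A] : HasBijectiveAntipode k A :=
  hasBijectiveAntipode_of_involutive k A (antipode_antipode_of_comm k A)

section TensorAntipode

variable (k H K : Type u) [Field k] [Ring H] [HopfAlgebra k H] [Ring K] [HopfAlgebra k K]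
  [HasBijectiveAntipode k H] [HasBijectiveAntipode k K]

instance hasBijectiveAntipode_tensor : HasBijectiveAntipode k (H ⊗[k] K) := by
  refine ⟨Function.bijective_iff_has_inverse.2
    ⟨TensorProduct.map (antipodeInv k H) (antipodeInv k K), fun x => ?_, fun x => ?_⟩⟩
  · induction x with
    | zero => simp only [map_zero]
    | add x y hx hy => simp only [map_add, hx, hy]
    | tmul h g => simp [antipodeInv_antipode]
  · induction x with
    | zero => simp only [map_zero]
    | add x y hx hy => simp only [map_add, hx, hy]
    | tmul h g => simp [antipode_antipodeInv]

theorem antipodeInv_tmul (h : H) (g : K) :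
    antipodeInv k (H ⊗[k] K) (h ⊗ₜ g) = antipodeInv k H h ⊗ₜ antipodeInv k K g := by
  apply (HasBijectiveAntipode.bij (k := k) (H := H ⊗[k] K)).injective
  rw [antipode_antipodeInv]
  simp [antipode_antipodeInv]

end TensorAntipode

/-- For an `H`-module `M`, the trilinear operation
`a, b, c ↦ (g ⊗ m ↦ a g S⁻¹(c) ⊗ b m)` on `H ⊗ M`, as a map on `(a ⊗ b) ⊗ c`. -/
def aydTri (k H M : Type u) [Field k] [Ring H] [HopfAlgebra k H] [HasBijectiveAntipode k H]
    [AddCommGroup M] [Module k M] (act : H →ₐ[k] Module.End k M) :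
    (H ⊗[k] H) ⊗[k] H →ₗ[k] Module.End k (H ⊗[k] M) :=
  TensorProduct.lift <|
    (LinearMap.mul k (Module.End k (H ⊗[k] M))).compl₁₂
      (TensorProduct.homTensorHomMap (RingHom.id k) H M H M ∘ₗ
        TensorProduct.map (LinearMap.mul k H) act.toLinearMap)
      (LinearMap.rTensorHom M ∘ₗ (LinearMap.mul k H).flip ∘ₗ antipodeInv k H)

theorem aydTri_tmul (k H M : Type u) [Field k] [Ring H] [HopfAlgebra k H]
    [HasBijectiveAntipode k H]
    [AddCommGroup M] [Module k M] (act : H →ₐ[k] Module.End k M) (a b c g : H) (m : M) :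
    aydTri k H M act ((a ⊗ₜ b) ⊗ₜ c) (g ⊗ₜ m) = (a * (g * antipodeInv k H c)) ⊗ₜ act b m := rfl

/-- The operation of `h ∈ H` on `H ⊗ M` occurring in the anti-Yetter-Drinfeld condition,
`g ⊗ m ↦ h₁ g S⁻¹(h₃) ⊗ h₂ m`. -/
def aydAct (k H M : Type u) [Field k] [Ring H] [HopfAlgebra k H] [HasBijectiveAntipode k H]
    [AddCommGroup M] [Module k M] (act : H →ₐ[k] Module.End k M) :
    H →ₗ[k] Module.End k (H ⊗[k] M) :=
  aydTri k H M act ∘ₗ LinearMap.rTensor H comul ∘ₗ comul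

/-- A left-left stable anti-Yetter-Drinfeld module structure on `M` over the Hopf algebra `H`:
a left action and a left coaction `m ↦ m₋₁ ⊗ m₀` with
`(h m)₋₁ ⊗ (h m)₀ = h₁ m₋₁ S⁻¹(h₃) ⊗ h₂ m₀` and `m₋₁ m₀ = m`. -/
structure SAYD (k H M : Type u) [Field k] [Ring H] [HopfAlgebra k H] [HasBijectiveAntipode k H]
    [AddCommGroup M] [Module k M] where
  act : H →ₐ[k] Module.End k M
  coact : M →ₗ[k] H ⊗[k] M
  coassoc : ∀ m, TensorProduct.assoc k H H M (LinearMap.rTensor M comul (coact m)) =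
    LinearMap.lTensor H coact (coact m)
  counit_coact : ∀ m, LinearMap.rTensor M (counit : H →ₗ[k] k) (coact m) = 1 ⊗ₜ m
  ayd : ∀ h m, coact (act h m) = aydAct k H M act h (coact m)
  stable : ∀ m, TensorProduct.lift act.toLinearMap (coact m) = m

namespace SAYD

section Basic

variable {k H M : Type u} [Field k] [Ring H] [HopfAlgebra k H] [HasBijectiveAntipode k H]
  [AddCommGroup M] [Module k M]

theorem aydAct_aux (act : H →ₐ[k] Module.End k M) (w : H) (m : M) (c : H) :
    TensorProduct.lift ((aydAct k H M act).compl₂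
      ((TensorProduct.mk k H M).flip m ∘ₗ LinearMap.mulLeft k w)) (comul c) =
    TensorProduct.map (LinearMap.mulRight k w) (act.toLinearMap.flip m) (comul c) := by
  let B : H →ₗ[k] H →ₗ[k] H ⊗[k] M := LinearMap.mk₂ k
    (fun p z => TensorProduct.map (LinearMap.mulRight k (w * z)) (act.toLinearMap.flip m)
      (comul p))
    (fun p p' z => by simp only [map_add])
    (fun r p z => by simp only [map_smul])
    (fun p z z' => by
      rw [mul_add, ← LinearMap.add_apply, ← TensorProduct.map_add_left]
      congr 2
      ext a
      simp [mul_add, mul_assoc])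
    (fun r p z => by
      rw [← LinearMap.smul_apply, ← TensorProduct.map_smul_left]
      congr 2
      ext a
      simp [mul_assoc])
  let Ψ : H ⊗[k] (H ⊗[k] H) →ₗ[k] H ⊗[k] M := TensorProduct.lift B ∘ₗ
    LinearMap.lTensor H (TensorProduct.lift ((LinearMap.mul k H).flip ∘ₗ antipodeInv k H))
  have h1 : ∀ t : H ⊗[k] H, TensorProduct.lift ((aydAct k H M act).compl₂
      ((TensorProduct.mk k H M).flip m ∘ₗ LinearMap.mulLeft k w)) t =
      Ψ (TensorProduct.assoc k H H H (LinearMap.rTensor H comul t)) := by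
    intro t
    induction t with
    | zero => simp only [map_zero]
    | add x y hx hy => simp only [map_add, hx, hy]
    | tmul a b =>
      have h2 : ∀ u : H ⊗[k] H, aydTri k H M act (LinearMap.rTensor H comul u)
          ((w * b) ⊗ₜ[k] m) = Ψ (TensorProduct.assoc k H H H (u ⊗ₜ[k] b)) := by
        intro u
        induction u with
        | zero => simp only [map_zero, LinearMap.zero_apply, TensorProduct.zero_tmul]
        | add x y hx hy => simp only [map_add, LinearMap.add_apply, TensorProduct.add_tmul, hx, hy]
        | tmul p q =>
          have h3 : ∀ v : H ⊗[k] H, aydTri k H M act (v ⊗ₜ[k] q) ((w * b) ⊗ₜ[k] m) =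
              TensorProduct.map (LinearMap.mulRight k (w * (b * antipodeInv k H q)))
                (act.toLinearMap.flip m) v := by
            intro v
            induction v with
            | zero => simp only [map_zero, LinearMap.zero_apply, TensorProduct.zero_tmul]
            | add x y hx hy =>
              simp only [map_add, LinearMap.add_apply, TensorProduct.add_tmul, hx, hy]
            | tmul c d => rw [aydTri_tmul]; simp [mul_assoc]
          exact h3 _
      exact h2 _
  have h4 : ∀ t : H ⊗[k] H, Ψ (LinearMap.lTensor H comul t) =
      TensorProduct.lift B (LinearMap.lTensor H ((LinearMap.toSpanSingleton k H 1) ∘ₗ counit) t)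
      := by
    intro t
    induction t with
    | zero => simp only [map_zero]
    | add x y hx hy => simp only [map_add, hx, hy]
    | tmul a b =>
      simp only [Ψ, LinearMap.comp_apply, LinearMap.lTensor_tmul,
        sum_right_mul_antipodeInv_left, LinearMap.toSpanSingleton_apply]
  rw [h1, coassoc_apply, h4, LinearMap.lTensor_comp, LinearMap.comp_apply, lTensor_counit_comul]
  simp [B]

end Basic

/-- Trivial coefficients: the ground field `k`, with `h • c = ε(h) c` and coaction `c ↦ 1 ⊗ c`.
It is an anti-Yetter-Drinfeld module if the antipode is involutive. -/
def trivial (k H : Type u) [Field k] [Ring H] [HopfAlgebra k H] [HasBijectiveAntipode k H]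
    (hS : ∀ h : H, antipode k (antipode k h) = h) : SAYD k H k where
  act := (Algebra.ofId k (Module.End k k)).comp (Bialgebra.counitAlgHom k H)
  coact := TensorProduct.mk k H k 1
  coassoc m := by
    simp [Algebra.TensorProduct.one_def]
  counit_coact m := by simp
  ayd h m := by
    have hinv : ∀ x : H, antipodeInv k H x = antipode k x := fun x => by
      apply (HasBijectiveAntipode.bij (k := k) (H := H)).injective
      rw [antipode_antipodeInv, hS]
    have h1 : ∀ t : H ⊗[k] H, aydTri k H k
        ((Algebra.ofId k (Module.End k k)).comp (Bialgebra.counitAlgHom k H))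
        (LinearMap.rTensor H comul t) ((1 : H) ⊗ₜ[k] m) =
        (LinearMap.mul' k H (LinearMap.lTensor H (antipode k) t)) ⊗ₜ[k] m := by
      intro t
      induction t with
      | zero => simp only [map_zero, LinearMap.zero_apply, TensorProduct.zero_tmul]
      | add x y hx hy => simp only [map_add, LinearMap.add_apply, TensorProduct.add_tmul, hx, hy]
      | tmul a b =>
        have h2 : ∀ v : H ⊗[k] H, aydTri k H k
            ((Algebra.ofId k (Module.End k k)).comp (Bialgebra.counitAlgHom k H))
            (v ⊗ₜ[k] b) ((1 : H) ⊗ₜ[k] m) =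
            (LinearMap.mulRight k (antipode k b) (TensorProduct.rid k H
              (LinearMap.lTensor H counit v))) ⊗ₜ[k] m := by
          intro v
          induction v with
          | zero => simp only [map_zero, LinearMap.zero_apply, TensorProduct.zero_tmul]
          | add x y hx hy =>
            simp only [map_add, LinearMap.add_apply, TensorProduct.add_tmul, hx, hy]
          | tmul c d =>
            rw [aydTri_tmul]
            simp [hinv, Algebra.ofId_apply, TensorProduct.smul_tmul]
        rw [LinearMap.rTensor_tmul, h2, lTensor_counit_comul]
        simp
    have h3 := h1 (comul h)
    rw [mul_antipode_lTensor_comul_apply] at h3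
    refine Eq.trans ?_ h3.symm
    simp [Algebra.ofId_apply, Algebra.algebraMap_eq_smul_one, TensorProduct.smul_tmul]
  stable m := by simp [Algebra.ofId_apply]

section Tensor

variable {k H K M N : Type u} [Field k] [Ring H] [HopfAlgebra k H] [Ring K] [HopfAlgebra k K]
  [AddCommGroup M] [Module k M] [AddCommGroup N] [Module k N]

/-- The action of `H ⊗ K` on `M ⊗ N`. -/
def tensorAct (a : H →ₐ[k] Module.End k M) (b : K →ₐ[k] Module.End k N) :
    H ⊗[k] K →ₐ[k] Module.End k (M ⊗[k] N) :=
  Module.endTensorEndAlgHom.comp (Algebra.TensorProduct.map a b)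

@[simp]
theorem tensorAct_tmul (a : H →ₐ[k] Module.End k M) (b : K →ₐ[k] Module.End k N)
    (h : H) (g : K) (m : M) (n : N) :
    tensorAct a b (h ⊗ₜ g) (m ⊗ₜ n) = a h m ⊗ₜ b g n := rfl

/-- The coaction of `H ⊗ K` on `M ⊗ N`. -/
def tensorCoact (a : M →ₗ[k] H ⊗[k] M) (b : N →ₗ[k] K ⊗[k] N) :
    M ⊗[k] N →ₗ[k] (H ⊗[k] K) ⊗[k] (M ⊗[k] N) :=
  (TensorProduct.tensorTensorTensorComm k H M K N).toLinearMap ∘ₗ TensorProduct.map a b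

theorem tensorCoact_tmul (a : M →ₗ[k] H ⊗[k] M) (b : N →ₗ[k] K ⊗[k] N) (m : M) (n : N) :
    tensorCoact a b (m ⊗ₜ n) =
      TensorProduct.tensorTensorTensorComm k H M K N (a m ⊗ₜ b n) := rfl

variable [HasBijectiveAntipode k H] [HasBijectiveAntipode k K]

theorem aydAct_tensor (a : H →ₐ[k] Module.End k M) (b : K →ₐ[k] Module.End k N)
    (h : H) (g : K) (x : H ⊗[k] M) (y : K ⊗[k] N) :
    aydAct k (H ⊗[k] K) (M ⊗[k] N) (tensorAct a b) (h ⊗ₜ g)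
        (TensorProduct.tensorTensorTensorComm k H M K N (x ⊗ₜ y)) =
      TensorProduct.tensorTensorTensorComm k H M K N
        (aydAct k H M a h x ⊗ₜ aydAct k K N b g y) := by
  have h1 : ∀ (u : H ⊗[k] H) (v : K ⊗[k] K),
      aydTri k (H ⊗[k] K) (M ⊗[k] N) (tensorAct a b) (LinearMap.rTensor _ comul
        (TensorProduct.tensorTensorTensorComm k H H K K (u ⊗ₜ v)))
        (TensorProduct.tensorTensorTensorComm k H M K N (x ⊗ₜ y)) =
      TensorProduct.tensorTensorTensorComm k H M K N
        (aydTri k H M a (LinearMap.rTensor _ comul u) x ⊗ₜ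
          aydTri k K N b (LinearMap.rTensor _ comul v) y) := by
    intro u v
    induction u with
    | zero => simp only [map_zero, LinearMap.zero_apply, TensorProduct.zero_tmul]
    | add x y hx hy => simp only [map_add, LinearMap.add_apply, TensorProduct.add_tmul, hx, hy]
    | tmul p p' =>
    induction v with
    | zero => simp only [map_zero, LinearMap.zero_apply, TensorProduct.tmul_zero]
    | add x y hx hy => simp only [map_add, LinearMap.add_apply, TensorProduct.tmul_add, hx, hy]
    | tmul q q' =>
    rw [TensorProduct.tensorTensorTensorComm_tmul, LinearMap.rTensor_tmul, LinearMap.rTensor_tmul,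
      LinearMap.rTensor_tmul, TensorProduct.comul_tmul]
    generalize comul (R := k) p = u
    generalize comul (R := k) q = v
    induction u with
    | zero => simp only [map_zero, LinearMap.zero_apply, TensorProduct.zero_tmul]
    | add x y hx hy => simp only [map_add, LinearMap.add_apply, TensorProduct.add_tmul, hx, hy]
    | tmul p₁ p₂ =>
    induction v with
    | zero => simp only [map_zero, LinearMap.zero_apply, TensorProduct.tmul_zero,
        TensorProduct.zero_tmul]
    | add x y hx hy => simp only [map_add, LinearMap.add_apply, TensorProduct.tmul_add,
        TensorProduct.add_tmul, hx, hy]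
    | tmul q₁ q₂ =>
    induction x with
    | zero => simp only [map_zero, TensorProduct.zero_tmul]
    | add x y hx hy => simp only [map_add, TensorProduct.add_tmul, hx, hy]
    | tmul c m =>
    induction y with
    | zero => simp only [map_zero, TensorProduct.tmul_zero]
    | add x y hx hy => simp only [map_add, TensorProduct.tmul_add, hx, hy]
    | tmul d n =>
    rw [TensorProduct.AlgebraTensorModule.tensorTensorTensorComm_tmul,
      TensorProduct.tensorTensorTensorComm_tmul, aydTri_tmul, aydTri_tmul, aydTri_tmul,
      antipodeInv_tmul, TensorProduct.tensorTensorTensorComm_tmul,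
      Algebra.TensorProduct.tmul_mul_tmul, Algebra.TensorProduct.tmul_mul_tmul, tensorAct_tmul]
  exact h1 _ _

/-- The tensor product of stable anti-Yetter-Drinfeld modules `M` over `H` and `N` over `K` is one
over `H ⊗ K`. -/
def tensor (𝓜 : SAYD k H M) (𝓝 : SAYD k K N) : SAYD k (H ⊗[k] K) (M ⊗[k] N) where
  act := tensorAct 𝓜.act 𝓝.act
  coact := tensorCoact 𝓜.coact 𝓝.coact
  coassoc x := by
    induction x with
    | zero => simp only [map_zero]
    | add x y hx hy => simp only [map_add, hx, hy]
    | tmul m n =>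
    let Q := (TensorProduct.congr (LinearEquiv.refl k (H ⊗[k] K))
        (TensorProduct.tensorTensorTensorComm k H M K N)).toLinearMap ∘ₗ
      (TensorProduct.tensorTensorTensorComm k H (H ⊗[k] M) K (K ⊗[k] N)).toLinearMap
    have h1 : ∀ (u : H ⊗[k] M) (v : K ⊗[k] N),
        TensorProduct.assoc k (H ⊗[k] K) (H ⊗[k] K) (M ⊗[k] N) (LinearMap.rTensor _ comul
          (TensorProduct.tensorTensorTensorComm k H M K N (u ⊗ₜ v))) =
        Q (TensorProduct.assoc k H H M (LinearMap.rTensor M comul u) ⊗ₜ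
          TensorProduct.assoc k K K N (LinearMap.rTensor N comul v)) := by
      intro u v
      induction u with
      | zero => simp only [map_zero, TensorProduct.zero_tmul]
      | add x y hx hy => simp only [map_add, TensorProduct.add_tmul, hx, hy]
      | tmul p m =>
      induction v with
      | zero => simp only [map_zero, TensorProduct.tmul_zero]
      | add x y hx hy => simp only [map_add, TensorProduct.tmul_add, hx, hy]
      | tmul q n =>
      rw [TensorProduct.tensorTensorTensorComm_tmul, LinearMap.rTensor_tmul,
        LinearMap.rTensor_tmul, LinearMap.rTensor_tmul, TensorProduct.comul_tmul]
      generalize comul (R := k) p = u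
      generalize comul (R := k) q = v
      induction u with
      | zero => simp only [map_zero, TensorProduct.zero_tmul]
      | add x y hx hy => simp only [map_add, TensorProduct.add_tmul, hx, hy]
      | tmul p₁ p₂ =>
      induction v with
      | zero => simp only [map_zero, TensorProduct.tmul_zero, TensorProduct.zero_tmul]
      | add x y hx hy => simp only [map_add, TensorProduct.tmul_add, TensorProduct.add_tmul, hx, hy]
      | tmul q₁ q₂ => rfl
    have h2 : ∀ (u : H ⊗[k] M) (v : K ⊗[k] N),
        LinearMap.lTensor (H ⊗[k] K) (tensorCoact 𝓜.coact 𝓝.coact)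
          (TensorProduct.tensorTensorTensorComm k H M K N (u ⊗ₜ v)) =
        Q (LinearMap.lTensor H 𝓜.coact u ⊗ₜ LinearMap.lTensor K 𝓝.coact v) := by
      intro u v
      induction u with
      | zero => simp only [map_zero, TensorProduct.zero_tmul]
      | add x y hx hy => simp only [map_add, TensorProduct.add_tmul, hx, hy]
      | tmul p m =>
      induction v with
      | zero => simp only [map_zero, TensorProduct.tmul_zero]
      | add x y hx hy => simp only [map_add, TensorProduct.tmul_add, hx, hy]
      | tmul q n => rfl
    rw [tensorCoact_tmul, h1, h2, 𝓜.coassoc, 𝓝.coassoc]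
  counit_coact x := by
    induction x with
    | zero => simp only [map_zero, TensorProduct.tmul_zero]
    | add x y hx hy => simp only [map_add, TensorProduct.tmul_add, hx, hy]
    | tmul m n =>
    have h1 : ∀ (u : H ⊗[k] M) (v : K ⊗[k] N),
        LinearMap.rTensor (M ⊗[k] N) (counit : H ⊗[k] K →ₗ[k] k)
          (TensorProduct.tensorTensorTensorComm k H M K N (u ⊗ₜ v)) =
        (LinearMap.rTensor (M ⊗[k] N) (LinearMap.mul' k k))
          (TensorProduct.tensorTensorTensorComm k k M k N
            (LinearMap.rTensor M (counit : H →ₗ[k] k) u ⊗ₜ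
              LinearMap.rTensor N (counit : K →ₗ[k] k) v)) := by
      intro u v
      induction u with
      | zero => simp only [map_zero, TensorProduct.zero_tmul]
      | add x y hx hy => simp only [map_add, TensorProduct.add_tmul, hx, hy]
      | tmul p m =>
      induction v with
      | zero => simp only [map_zero, TensorProduct.tmul_zero]
      | add x y hx hy => simp only [map_add, TensorProduct.tmul_add, hx, hy]
      | tmul q n => simp [mul_comm]
    rw [tensorCoact_tmul, h1, 𝓜.counit_coact, 𝓝.counit_coact]
    simp
  ayd x y := by
    induction x with
    | zero => simp only [map_zero, LinearMap.zero_apply]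
    | add x x' hx hx' => simp only [map_add, LinearMap.add_apply, hx, hx']
    | tmul h g =>
      induction y with
      | zero => simp only [map_zero]
      | add y y' hy hy' => simp only [map_add, hy, hy']
      | tmul m n =>
        rw [tensorAct_tmul, tensorCoact_tmul, tensorCoact_tmul, aydAct_tensor, 𝓜.ayd, 𝓝.ayd]
  stable x := by
    induction x with
    | zero => simp only [map_zero]
    | add x y hx hy => simp only [map_add, hx, hy]
    | tmul m n =>
    have h1 : ∀ (u : H ⊗[k] M) (v : K ⊗[k] N),
        TensorProduct.lift (tensorAct 𝓜.act 𝓝.act).toLinearMap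
          (TensorProduct.tensorTensorTensorComm k H M K N (u ⊗ₜ v)) =
        TensorProduct.lift 𝓜.act.toLinearMap u ⊗ₜ[k] TensorProduct.lift 𝓝.act.toLinearMap v := by
      intro u v
      induction u with
      | zero => simp only [map_zero, TensorProduct.zero_tmul]
      | add x y hx hy => simp only [map_add, TensorProduct.add_tmul, hx, hy]
      | tmul p m =>
      induction v with
      | zero => simp only [map_zero, TensorProduct.tmul_zero]
      | add x y hx hy => simp only [map_add, TensorProduct.tmul_add, hx, hy]
      | tmul q n => rfl
    rw [tensorCoact_tmul, h1, 𝓜.stable, 𝓝.stable]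

end Tensor

/-- A morphism `(f, g) : (H, M) → (K, N)` of Hopf algebras with coefficients: a morphism `f` of
Hopf algebras and a linear map `g` which is compatible, along `f`, with actions and coactions. -/
structure Hom {k H K M N : Type u} [Field k] [Ring H] [HopfAlgebra k H] [HasBijectiveAntipode k H]
    [Ring K] [HopfAlgebra k K] [HasBijectiveAntipode k K]
    [AddCommGroup M] [Module k M] [AddCommGroup N] [Module k N]
    (𝓜 : SAYD k H M) (𝓝 : SAYD k K N) where
  f : H →ₐc[k] K
  g : M →ₗ[k] N
  g_act : ∀ h m, g (𝓜.act h m) = 𝓝.act (f h) (g m)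
  g_coact : ∀ m, 𝓝.coact (g m) = TensorProduct.map (f : H →ₗ[k] K) g (𝓜.coact m)

/-- The canonical isomorphism `((H ⊗ K) ⊗ L, (M ⊗ N) ⊗ P) → (H ⊗ (K ⊗ L), M ⊗ (N ⊗ P))`. -/
def assocHom {k H K L M N P : Type u} [Field k]
    [Ring H] [HopfAlgebra k H] [HasBijectiveAntipode k H]
    [Ring K] [HopfAlgebra k K] [HasBijectiveAntipode k K]
    [Ring L] [HopfAlgebra k L] [HasBijectiveAntipode k L]
    [AddCommGroup M] [Module k M] [AddCommGroup N] [Module k N] [AddCommGroup P] [Module k P]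
    (𝓜 : SAYD k H M) (𝓝 : SAYD k K N) (𝓟 : SAYD k L P) :
    Hom ((𝓜.tensor 𝓝).tensor 𝓟) (𝓜.tensor (𝓝.tensor 𝓟)) where
  f := (Bialgebra.TensorProduct.assoc k k H K L :
    (H ⊗[k] K) ⊗[k] L →ₐc[k] H ⊗[k] (K ⊗[k] L))
  g := (TensorProduct.assoc k M N P).toLinearMap
  g_act h m := by
    induction m with
    | zero => simp only [map_zero]
    | add x y hx hy => simp only [map_add, hx, hy]
    | tmul m p =>
    induction m with
    | zero => simp only [map_zero, TensorProduct.zero_tmul]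
    | add x y hx hy => simp only [map_add, TensorProduct.add_tmul, hx, hy]
    | tmul m n =>
    induction h with
    | zero => simp only [map_zero, LinearMap.zero_apply]
    | add x y hx hy => simp only [map_add, LinearMap.add_apply, hx, hy]
    | tmul h c =>
    induction h with
    | zero => simp only [map_zero, LinearMap.zero_apply, TensorProduct.zero_tmul]
    | add x y hx hy => simp only [map_add, LinearMap.add_apply, TensorProduct.add_tmul, hx, hy]
    | tmul a b => rfl
  g_coact m := by
    induction m with
    | zero => simp only [map_zero]
    | add x y hx hy => simp only [map_add, hx, hy]
    | tmul m p =>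
    induction m with
    | zero => simp only [map_zero, TensorProduct.zero_tmul]
    | add x y hx hy => simp only [map_add, TensorProduct.add_tmul, hx, hy]
    | tmul m n =>
    have h1 : ∀ (u : H ⊗[k] M) (v : K ⊗[k] N) (w : L ⊗[k] P),
        TensorProduct.tensorTensorTensorComm k H M (K ⊗[k] L) (N ⊗[k] P)
          (u ⊗ₜ TensorProduct.tensorTensorTensorComm k K N L P (v ⊗ₜ w)) =
        TensorProduct.map
          ((Bialgebra.TensorProduct.assoc k k H K L : (H ⊗[k] K) ⊗[k] L →ₐc[k] H ⊗[k] (K ⊗[k] L)) :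
            (H ⊗[k] K) ⊗[k] L →ₗ[k] H ⊗[k] (K ⊗[k] L))
          (TensorProduct.assoc k M N P).toLinearMap
          (TensorProduct.tensorTensorTensorComm k (H ⊗[k] K) (M ⊗[k] N) L P
            (TensorProduct.tensorTensorTensorComm k H M K N (u ⊗ₜ v) ⊗ₜ w)) := by
      intro u v w
      induction u with
      | zero => simp only [map_zero, TensorProduct.zero_tmul]
      | add x y hx hy => simp only [map_add, TensorProduct.add_tmul, hx, hy]
      | tmul h m =>
      induction v with
      | zero => simp only [map_zero, TensorProduct.zero_tmul, TensorProduct.tmul_zero]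
      | add x y hx hy => simp only [map_add, TensorProduct.add_tmul, TensorProduct.tmul_add, hx, hy]
      | tmul h m =>
      induction w with
      | zero => simp only [map_zero, TensorProduct.tmul_zero]
      | add x y hx hy => simp only [map_add, TensorProduct.tmul_add, hx, hy]
      | tmul h m => rfl
    exact h1 _ _ _

/-- The flip `(H ⊗ K, M ⊗ N) → (K ⊗ H, N ⊗ M)`. -/
def commHom {k H K M N : Type u} [Field k]
    [Ring H] [HopfAlgebra k H] [HasBijectiveAntipode k H]
    [Ring K] [HopfAlgebra k K] [HasBijectiveAntipode k K]
    [AddCommGroup M] [Module k M] [AddCommGroup N] [Module k N]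
    (𝓜 : SAYD k H M) (𝓝 : SAYD k K N) :
    Hom (𝓜.tensor 𝓝) (𝓝.tensor 𝓜) where
  f := (Bialgebra.TensorProduct.comm k H K : H ⊗[k] K →ₐc[k] K ⊗[k] H)
  g := (TensorProduct.comm k M N).toLinearMap
  g_act h m := by
    induction m with
    | zero => simp only [map_zero]
    | add x y hx hy => simp only [map_add, hx, hy]
    | tmul m n =>
    induction h with
    | zero => simp only [map_zero, LinearMap.zero_apply]
    | add x y hx hy => simp only [map_add, LinearMap.add_apply, hx, hy]
    | tmul a b => rfl
  g_coact m := by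
    induction m with
    | zero => simp only [map_zero]
    | add x y hx hy => simp only [map_add, hx, hy]
    | tmul m n =>
    have h1 : ∀ (u : H ⊗[k] M) (v : K ⊗[k] N),
        TensorProduct.tensorTensorTensorComm k K N H M (v ⊗ₜ u) =
        TensorProduct.map
          ((Bialgebra.TensorProduct.comm k H K : H ⊗[k] K →ₐc[k] K ⊗[k] H) :
            H ⊗[k] K →ₗ[k] K ⊗[k] H)
          (TensorProduct.comm k M N).toLinearMap
          (TensorProduct.tensorTensorTensorComm k H M K N (u ⊗ₜ v)) := by
      intro u v
      induction u with
      | zero => simp only [map_zero, TensorProduct.zero_tmul, TensorProduct.tmul_zero]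
      | add x y hx hy => simp only [map_add, TensorProduct.add_tmul, TensorProduct.tmul_add, hx, hy]
      | tmul h m =>
      induction v with
      | zero => simp only [map_zero, TensorProduct.zero_tmul, TensorProduct.tmul_zero]
      | add x y hx hy => simp only [map_add, TensorProduct.add_tmul, TensorProduct.tmul_add, hx, hy]
      | tmul h m => rfl
    exact h1 _ _

/-- Trivial coefficients over a commutative Hopf algebra. -/
abbrev trivialComm (k A : Type u) [Field k] [CommRing A] [HopfAlgebra k A] : SAYD k A k :=
  trivial k A (antipode_antipode_of_comm k A)

/-- The multiplication map `(A ⊗ A, k ⊗ k) → (A, k)` of a commutative Hopf algebra `A`. -/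
def mulHom (k A : Type u) [Field k] [CommRing A] [HopfAlgebra k A] :
    Hom ((trivialComm k A).tensor (trivialComm k A)) (trivialComm k A) where
  f := Bialgebra.mulBialgHom k A
  g := (TensorProduct.lid k k).toLinearMap
  g_act h m := by
    induction m with
    | zero => simp only [map_zero]
    | add x y hx hy => simp only [map_add, hx, hy]
    | tmul m n =>
    induction h with
    | zero => simp only [map_zero, LinearMap.zero_apply]
    | add x y hx hy => simp only [map_add, LinearMap.add_apply, hx, hy]
    | tmul a b =>
      change (counit (R := k) a * m) • (counit (R := k) b * n) = counit (R := k) (a * b) * (m • n)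
      rw [Bialgebra.counit_mul, smul_eq_mul, smul_eq_mul]
      ring
  g_coact m := by
    induction m with
    | zero => simp only [map_zero]
    | add x y hx hy => simp only [map_add, hx, hy]
    | tmul m n =>
      change (1 : A) ⊗ₜ[k] (m • n) = ((1 : A) * 1) ⊗ₜ[k] (m • n)
      rw [one_mul]

end SAYD

/-! ## Iterated tensor products `H ⊗ (H ⊗ ⋯ (H ⊗ V))` and their structure maps -/

section Ten

variable (k H V : Type u) [Field k] [Ring H] [AddCommGroup V] [Module k V]

/-- `H^{⊗ n} ⊗ V = H ⊗ (H ⊗ ⋯ (H ⊗ V))` (as an object of the category of `k`-modules, only in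
order to carry the module structure along the recursion). -/
def TenObj [Algebra k H] : ℕ → ModuleCat.{u} k
  | 0 => ModuleCat.of k V
  | n + 1 => ModuleCat.of k (H ⊗[k] (TenObj n))

/-- The module `H^{⊗ n} ⊗ V`. -/
abbrev Ten [Algebra k H] (n : ℕ) : Type u := TenObj k H V n

variable {k H V}
variable [Algebra k H]

/-- `h, x ↦ h ⊗ x`. -/
def tcons {n : ℕ} : H →ₗ[k] Ten k H V n →ₗ[k] Ten k H V (n + 1) :=
  TensorProduct.mk k H (TenObj k H V n)

theorem ten_induction {n : ℕ} {P : Ten k H V (n + 1) → Prop} (zero : P 0)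
    (add : ∀ x y, P x → P y → P (x + y)) (cons : ∀ h x, P (tcons h x)) (x : Ten k H V (n + 1)) :
    P x :=
  TensorProduct.induction_on (motive := P) x zero cons add

/-- The identification of `V` with `H^{⊗ 0} ⊗ V`. -/
def tnil : V →ₗ[k] Ten k H V 0 := LinearMap.id

theorem ten_zero_cases {P : Ten k H V 0 → Prop} (nil : ∀ v : V, P (tnil v)) (x : Ten k H V 0) :
    P x := nil x

/-- The functoriality of `H^{⊗ n} ⊗ V` in `H` and `V`. -/
def tmap {K W : Type u} [Ring K] [Algebra k K] [AddCommGroup W] [Module k W] (f : H →ₗ[k] K) :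
    ∀ n : ℕ, (V →ₗ[k] W) →ₗ[k] Ten k H V n →ₗ[k] Ten k K W n
  | 0 => LinearMap.id
  | n + 1 => TensorProduct.mapBilinear (RingHom.id k) H (TenObj k H V n) K (TenObj k K W n) f ∘ₗ
      tmap f n

@[simp]
theorem tmap_tcons {K W : Type u} [Ring K] [Algebra k K] [AddCommGroup W] [Module k W]
    (f : H →ₗ[k] K) (n : ℕ) (g : V →ₗ[k] W) (h : H) (x : Ten k H V n) :
    tmap f (n + 1) g (tcons h x) = tcons (f h) (tmap f n g x) := rfl

@[simp]
theorem tmap_tnil {K W : Type u} [Ring K] [Algebra k K] [AddCommGroup W] [Module k W]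
    (f : H →ₗ[k] K) (g : V →ₗ[k] W) (v : V) :
    tmap f 0 g (tnil v : Ten k H V 0) = tnil (g v) := rfl

variable (k H V) in
/-- `h₀ ⊗ ⋯ ⊗ h_{n+1} ⊗ v ↦ h₀ ⊗ ⋯ ⊗ h_i h_{i+1} ⊗ ⋯ ⊗ h_{n+1} ⊗ v`, for `i ≤ n`. -/
def mulFace : ∀ n _i : ℕ, Ten k H V (n + 2) →ₗ[k] Ten k H V (n + 1)
  | n, 0 => LinearMap.rTensor (TenObj k H V n) (LinearMap.mul' k H) ∘ₗ
      (TensorProduct.assoc k H H (TenObj k H V n)).symm.toLinearMap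
  | 0, _ + 1 => 0
  | n + 1, i + 1 => LinearMap.lTensor H (mulFace n i)

@[simp]
theorem mulFace_zero (n : ℕ) (h g : H) (x : Ten k H V n) :
    mulFace k H V n 0 (tcons h (tcons g x)) = tcons (h * g) x := by
  cases n <;> rfl

@[simp]
theorem mulFace_succ (n i : ℕ) (h : H) (x : Ten k H V (n + 2)) :
    mulFace k H V (n + 1) (i + 1) (tcons h x) = tcons h (mulFace k H V n i x) := rfl

variable (k H V) in
/-- `h₀ ⊗ ⋯ ⊗ h_n ⊗ v ↦ h₀ ⊗ ⋯ ⊗ h_i ⊗ 1 ⊗ h_{i+1} ⊗ ⋯ ⊗ h_n ⊗ v`, for `i ≤ n`. -/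
def oneDeg : ∀ n _i : ℕ, Ten k H V (n + 1) →ₗ[k] Ten k H V (n + 2)
  | n, 0 => LinearMap.lTensor H (TensorProduct.mk k H (TenObj k H V n) 1)
  | 0, _ + 1 => 0
  | n + 1, i + 1 => LinearMap.lTensor H (oneDeg n i)

@[simp]
theorem oneDeg_zero (n : ℕ) (h : H) (x : Ten k H V n) :
    oneDeg k H V n 0 (tcons h x) = tcons h (tcons 1 x) := by
  cases n <;> rfl

@[simp]
theorem oneDeg_succ (n i : ℕ) (h : H) (x : Ten k H V (n + 1)) :
    oneDeg k H V (n + 1) (i + 1) (tcons h x) = tcons h (oneDeg k H V n i x) := rfl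

theorem mulFace_out (i : ℕ) (x : Ten k H V 2) : mulFace k H V 0 (i + 1) x = 0 := rfl

/-! ### Simplicial identities -/

theorem mulFace_mulFace (n i j : ℕ) (hij : i ≤ j) (x : Ten k H V (n + 3)) :
    mulFace k H V n i (mulFace k H V (n + 1) (j + 1) x) =
      mulFace k H V n j (mulFace k H V (n + 1) i x) := by
  induction i generalizing n j with
  | zero =>
    induction x using ten_induction with
    | zero => simp only [map_zero]
    | add x y hx hy => simp only [map_add, hx, hy]
    | cons h x =>
    induction x using ten_induction with
    | zero => simp only [map_zero]
    | add x y hx hy => simp only [map_add, hx, hy]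
    | cons g x =>
    cases j with
    | zero =>
      induction x using ten_induction with
      | zero => simp only [map_zero]
      | add x y hx hy => simp only [map_add, hx, hy]
      | cons l x => simp [mul_assoc]
    | succ j =>
      cases n with
      | zero => rw [mulFace_succ, mulFace_out, mulFace_zero, mulFace_out, map_zero, map_zero]
      | succ n => simp
  | succ i ih =>
    obtain ⟨j, rfl⟩ : ∃ j', j = j' + 1 := ⟨j - 1, by omega⟩
    cases n with
    | zero => simp [mulFace]
    | succ n =>
      induction x using ten_induction with
      | zero => simp only [map_zero]
      | add x y hx hy => simp only [map_add, hx, hy]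
      | cons h x => simp [ih n j (by omega) x]

theorem oneDeg_oneDeg (n i j : ℕ) (hij : i ≤ j) (hj : j ≤ n) (x : Ten k H V (n + 1)) :
    oneDeg k H V (n + 1) i (oneDeg k H V n j x) =
      oneDeg k H V (n + 1) (j + 1) (oneDeg k H V n i x) := by
  induction i generalizing n j with
  | zero =>
    induction x using ten_induction with
    | zero => simp only [map_zero]
    | add x y hx hy => simp only [map_add, hx, hy]
    | cons h x =>
    cases j with
    | zero => simp
    | succ j =>
      obtain ⟨n, rfl⟩ : ∃ n', n = n' + 1 := ⟨n - 1, by omega⟩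
      simp
  | succ i ih =>
    obtain ⟨j, rfl⟩ : ∃ j', j = j' + 1 := ⟨j - 1, by omega⟩
    obtain ⟨n, rfl⟩ : ∃ n', n = n' + 1 := ⟨n - 1, by omega⟩
    induction x using ten_induction with
    | zero => simp only [map_zero]
    | add x y hx hy => simp only [map_add, hx, hy]
    | cons h x => simp [ih n j (by omega) (by omega) x]

theorem mulFace_oneDeg_lt (n i j : ℕ) (hij : i ≤ j) (hj : j ≤ n) (x : Ten k H V (n + 2)) :
    mulFace k H V (n + 1) i (oneDeg k H V (n + 1) (j + 1) x) =
      oneDeg k H V n j (mulFace k H V n i x) := by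
  induction i generalizing n j with
  | zero =>
    induction x using ten_induction with
    | zero => simp only [map_zero]
    | add x y hx hy => simp only [map_add, hx, hy]
    | cons h x =>
    induction x using ten_induction with
    | zero => simp only [map_zero]
    | add x y hx hy => simp only [map_add, hx, hy]
    | cons g x =>
    cases j with
    | zero => simp
    | succ j =>
      obtain ⟨n, rfl⟩ : ∃ n', n = n' + 1 := ⟨n - 1, by omega⟩
      simp
  | succ i ih =>
    obtain ⟨j, rfl⟩ : ∃ j', j = j' + 1 := ⟨j - 1, by omega⟩
    obtain ⟨n, rfl⟩ : ∃ n', n = n' + 1 := ⟨n - 1, by omega⟩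
    induction x using ten_induction with
    | zero => simp only [map_zero]
    | add x y hx hy => simp only [map_add, hx, hy]
    | cons h x => simp [ih n j (by omega) (by omega) x]

theorem mulFace_oneDeg_self (n j : ℕ) (hj : j ≤ n) (x : Ten k H V (n + 1)) :
    mulFace k H V n j (oneDeg k H V n j x) = x := by
  induction j generalizing n with
  | zero =>
    induction x using ten_induction with
    | zero => simp only [map_zero]
    | add x y hx hy => simp only [map_add, hx, hy]
    | cons h x => simp
  | succ j ih =>
    obtain ⟨n, rfl⟩ : ∃ n', n = n' + 1 := ⟨n - 1, by omega⟩
    induction x using ten_induction with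
    | zero => simp only [map_zero]
    | add x y hx hy => simp only [map_add, hx, hy]
    | cons h x => simp [ih n (by omega) x]

theorem mulFace_oneDeg_succ (n j : ℕ) (hj : j < n) (x : Ten k H V (n + 1)) :
    mulFace k H V n (j + 1) (oneDeg k H V n j x) = x := by
  induction j generalizing n with
  | zero =>
    obtain ⟨n, rfl⟩ : ∃ n', n = n' + 1 := ⟨n - 1, by omega⟩
    induction x using ten_induction with
    | zero => simp only [map_zero]
    | add x y hx hy => simp only [map_add, hx, hy]
    | cons h x =>
    induction x using ten_induction with
    | zero => simp only [map_zero]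
    | add x y hx hy => simp only [map_add, hx, hy]
    | cons g x => simp
  | succ j ih =>
    obtain ⟨n, rfl⟩ : ∃ n', n = n' + 1 := ⟨n - 1, by omega⟩
    induction x using ten_induction with
    | zero => simp only [map_zero]
    | add x y hx hy => simp only [map_add, hx, hy]
    | cons h x => simp [ih n (by omega) x]

theorem mulFace_oneDeg_gt (n i j : ℕ) (hij : j < i) (hi : i ≤ n) (x : Ten k H V (n + 2)) :
    mulFace k H V (n + 1) (i + 1) (oneDeg k H V (n + 1) j x) =
      oneDeg k H V n j (mulFace k H V n i x) := by
  induction j generalizing n i with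
  | zero =>
    obtain ⟨i, rfl⟩ : ∃ i', i = i' + 1 := ⟨i - 1, by omega⟩
    obtain ⟨n, rfl⟩ : ∃ n', n = n' + 1 := ⟨n - 1, by omega⟩
    induction x using ten_induction with
    | zero => simp only [map_zero]
    | add x y hx hy => simp only [map_add, hx, hy]
    | cons h x => simp
  | succ j ih =>
    obtain ⟨i, rfl⟩ : ∃ i', i = i' + 1 := ⟨i - 1, by omega⟩
    obtain ⟨n, rfl⟩ : ∃ n', n = n' + 1 := ⟨n - 1, by omega⟩
    induction x using ten_induction with
    | zero => simp only [map_zero]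
    | add x y hx hy => simp only [map_add, hx, hy]
    | cons h x => simp [ih n i (by omega) (by omega) x]

theorem tmap_mulFace {K W : Type u} [Ring K] [Algebra k K] [AddCommGroup W] [Module k W]
    (f : H →ₗ[k] K) (hf : ∀ a b, f (a * b) = f a * f b) (g : V →ₗ[k] W) (n i : ℕ)
    (x : Ten k H V (n + 2)) :
    tmap f (n + 1) g (mulFace k H V n i x) = mulFace k K W n i (tmap f (n + 2) g x) := by
  induction i generalizing n with
  | zero =>
    induction x using ten_induction with
    | zero => simp only [map_zero]
    | add x y hx hy => simp only [map_add, hx, hy]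
    | cons h x =>
    induction x using ten_induction with
    | zero => simp only [map_zero]
    | add x y hx hy => simp only [map_add, hx, hy]
    | cons a x => simp [hf]
  | succ i ih =>
    cases n with
    | zero => simp [mulFace]
    | succ n =>
      induction x using ten_induction with
      | zero => simp only [map_zero]
      | add x y hx hy => simp only [map_add, hx, hy]
      | cons h x => rw [mulFace_succ, tmap_tcons, tmap_tcons, mulFace_succ, ih]

theorem tmap_oneDeg {K W : Type u} [Ring K] [Algebra k K] [AddCommGroup W] [Module k W]
    (f : H →ₗ[k] K) (hf : f 1 = 1) (g : V →ₗ[k] W) (n i : ℕ)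
    (x : Ten k H V (n + 1)) :
    tmap f (n + 2) g (oneDeg k H V n i x) = oneDeg k K W n i (tmap f (n + 1) g x) := by
  induction i generalizing n with
  | zero =>
    induction x using ten_induction with
    | zero => simp only [map_zero]
    | add x y hx hy => simp only [map_add, hx, hy]
    | cons h x => simp [hf]
  | succ i ih =>
    cases n with
    | zero => simp [oneDeg]
    | succ n =>
      induction x using ten_induction with
      | zero => simp only [map_zero]
      | add x y hx hy => simp only [map_add, hx, hy]
      | cons h x => rw [oneDeg_succ, tmap_tcons, tmap_tcons, oneDeg_succ, ih]

theorem tmap_tmap {K W L U : Type u} [Ring K] [Algebra k K] [AddCommGroup W] [Module k W]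
    [Ring L] [Algebra k L] [AddCommGroup U] [Module k U]
    (f : H →ₗ[k] K) (g : V →ₗ[k] W) (f' : K →ₗ[k] L) (g' : W →ₗ[k] U) (n : ℕ) (x : Ten k H V n) :
    tmap f' n g' (tmap f n g x) = tmap (f' ∘ₗ f) n (g' ∘ₗ g) x := by
  induction n with
  | zero => rfl
  | succ n ih =>
    induction x using ten_induction with
    | zero => simp only [map_zero]
    | add x y hx hy => simp only [map_add, hx, hy]
    | cons h x => simp [ih]

theorem tmap_id (n : ℕ) (x : Ten k H V n) :
    tmap (LinearMap.id : H →ₗ[k] H) n (LinearMap.id : V →ₗ[k] V) x = x := by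
  induction n with
  | zero => rfl
  | succ n ih =>
    induction x using ten_induction with
    | zero => simp only [map_zero]
    | add x y hx hy => simp only [map_add, hx, hy]
    | cons h x => simp [ih]

end Ten

section Rot

variable {k H V : Type u} [Field k] [Ring H] [AddCommGroup V] [Module k V]

section

variable [Algebra k H]

/-- `t, x ↦ ∑ t₁ ⊗ φ(t₂, x)` for `t = ∑ t₁ ⊗ t₂ ∈ H ⊗ H`. -/
def tsmash {n : ℕ} (φ : H →ₗ[k] Ten k H V n →ₗ[k] Ten k H V n) :
    H ⊗[k] H →ₗ[k] Ten k H V n →ₗ[k] Ten k H V (n + 1) :=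
  TensorProduct.lift <| LinearMap.mk₂ k (fun a b => tcons a ∘ₗ φ b)
    (fun a a' b => by ext x; simp) (fun c a b => by ext x; simp)
    (fun a b b' => by ext x; simp) (fun c a b => by ext x; simp)

@[simp]
theorem tsmash_tmul {n : ℕ} (φ : H →ₗ[k] Ten k H V n →ₗ[k] Ten k H V n) (a b : H)
    (x : Ten k H V n) :
    tsmash φ (a ⊗ₜ b) x = tcons a (φ b x) := rfl

variable (k H V) in
/-- The left action of `g ∈ H` on the factor `H` of `H ⊗ V` inside `H^{⊗ n} ⊗ (H ⊗ V)`. -/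
def lmulT (n : ℕ) : H →ₗ[k] Ten k H (H ⊗[k] V) n →ₗ[k] Ten k H (H ⊗[k] V) n :=
  tmap LinearMap.id n ∘ₗ LinearMap.rTensorHom V ∘ₗ LinearMap.mul k H

@[simp]
theorem lmulT_tcons (n : ℕ) (g h : H) (x : Ten k H (H ⊗[k] V) n) :
    lmulT k H V (n + 1) g (tcons h x) = tcons h (lmulT k H V n g x) := rfl

theorem lmulT_mul (n : ℕ) (g h : H) (x : Ten k H (H ⊗[k] V) n) :
    lmulT k H V n (g * h) x = lmulT k H V n g (lmulT k H V n h x) := by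
  simp only [lmulT, LinearMap.comp_apply, tmap_tmap]
  congr 2
  ext a v
  simp [mul_assoc]

theorem lmulT_one (n : ℕ) (x : Ten k H (H ⊗[k] V) n) : lmulT k H V n 1 x = x := by
  have : (LinearMap.rTensorHom V ∘ₗ LinearMap.mul k H) (1 : H) = (LinearMap.id : H ⊗[k] V →ₗ[k] _)
      := by ext a v; simp
  rw [lmulT, LinearMap.comp_apply, this, tmap_id]

@[simp]
theorem lmulT_tnil (g h : H) (v : V) :
    lmulT k H V 0 g (tnil (h ⊗ₜ v)) = tnil ((g * h) ⊗ₜ v) := rfl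

variable (k H V) in
/-- `h₀ ⊗ h₁ ⊗ x ↦ h₁ ⊗ h₀ ⊗ x`. -/
def swapT (n : ℕ) : Ten k H V (n + 2) →ₗ[k] Ten k H V (n + 2) :=
  (TensorProduct.leftComm k H H (TenObj k H V n)).toLinearMap

@[simp]
theorem swapT_tcons (n : ℕ) (h g : H) (x : Ten k H V n) :
    swapT k H V n (tcons h (tcons g x)) = tcons g (tcons h x) := rfl

end

variable [HopfAlgebra k H]

/-- `h ⊗ x ↦ ∑ h₁ ⊗ φ(h₂, x)`. -/
def tcosmash {n : ℕ} (φ : H →ₗ[k] Ten k H V n →ₗ[k] Ten k H V n) :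
    Ten k H V (n + 1) →ₗ[k] Ten k H V (n + 1) :=
  TensorProduct.lift (R := k) (N := TenObj k H V n) (tsmash φ ∘ₗ comul)

@[simp]
theorem tcosmash_tcons {n : ℕ} (φ : H →ₗ[k] Ten k H V n →ₗ[k] Ten k H V n) (h : H)
    (x : Ten k H V n) : tcosmash φ (tcons h x) = tsmash φ (comul h) x := rfl

/-- A bilinear map `a : H × V → V`, operating on `H^{⊗ 0} ⊗ V`. -/
def actZero (a : H →ₗ[k] V →ₗ[k] V) : H →ₗ[k] Ten k H V 0 →ₗ[k] Ten k H V 0 := a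

@[simp]
theorem actZero_tnil (a : H →ₗ[k] V →ₗ[k] V) (h : H) (v : V) :
    actZero a h (tnil v) = tnil (a h v) := rfl

/-- The cyclic rotation `h₀ ⊗ ⋯ ⊗ h_n ⊗ v ↦ (h_n)₁ ⊗ h₀ ⊗ ⋯ ⊗ h_{n-1} ⊗ (h_n)₂ v`
on `H^{⊗ n+1} ⊗ V`, where `H` operates on `V` by the bilinear map `a`. -/
def rot (a : H →ₗ[k] V →ₗ[k] V) : ∀ n : ℕ, Ten k H V (n + 1) →ₗ[k] Ten k H V (n + 1)
  | 0 => tcosmash (actZero a)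
  | n + 1 => swapT k H V n ∘ₗ LinearMap.lTensor H (rot a n)

theorem rot_zero (a : H →ₗ[k] V →ₗ[k] V) (h : H) (v : Ten k H V 0) :
    rot a 0 (tcons h v) = tsmash (actZero a) (comul h) v := rfl

theorem rot_succ (a : H →ₗ[k] V →ₗ[k] V) (n : ℕ) (h : H) (x : Ten k H V (n + 1)) :
    rot a (n + 1) (tcons h x) = swapT k H V n (tcons h (rot a n x)) := rfl

variable (k H V) in
/-- The right coaction of `H` on `H^{⊗ n}`,
`h₁ ⊗ ⋯ ⊗ h_n ⊗ v ↦ (h₁)₁ ⊗ ⋯ ⊗ (h_n)₁ ⊗ ((h₁)₂ ⋯ (h_n)₂ ⊗ v)`. -/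
def coactT : ∀ n : ℕ, Ten k H V n →ₗ[k] Ten k H (H ⊗[k] V) n
  | 0 => TensorProduct.mk k H V 1
  | n + 1 => tcosmash (lmulT k H V n) ∘ₗ LinearMap.lTensor H (coactT n)

@[simp]
theorem coactT_tnil (v : V) : coactT k H V 0 (tnil v) = tnil (1 ⊗ₜ v) := rfl

theorem coactT_succ (n : ℕ) (h : H) (x : Ten k H V n) :
    coactT k H V (n + 1) (tcons h x) = tsmash (lmulT k H V n) (comul h) (coactT k H V n x) := rfl

/-! ### Compatibility of the coaction with faces and degeneracies -/

theorem coactT_mulFace (n i : ℕ) (x : Ten k H V (n + 2)) :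
    coactT k H V (n + 1) (mulFace k H V n i x) =
      mulFace k H (H ⊗[k] V) n i (coactT k H V (n + 2) x) := by
  induction i generalizing n with
  | zero =>
    induction x using ten_induction with
    | zero => simp only [map_zero]
    | add x y hx hy => simp only [map_add, hx, hy]
    | cons h x =>
    induction x using ten_induction with
    | zero => simp only [map_zero]
    | add x y hx hy => simp only [map_add, hx, hy]
    | cons g x =>
    rw [mulFace_zero, coactT_succ, coactT_succ, coactT_succ, Bialgebra.comul_mul]
    generalize comul (R := k) h = s
    generalize comul (R := k) g = t
    induction s with
    | zero => simp only [zero_mul, map_zero, LinearMap.zero_apply]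
    | add x y hx hy => simp only [add_mul, map_add, LinearMap.add_apply, hx, hy]
    | tmul a b =>
    induction t with
    | zero => simp only [mul_zero, map_zero, LinearMap.zero_apply]
    | add x y hx hy => simp only [mul_add, map_add, LinearMap.add_apply, hx, hy]
    | tmul c d => simp [lmulT_mul]
  | succ i ih =>
    cases n with
    | zero => simp [mulFace]
    | succ n =>
      induction x using ten_induction with
      | zero => simp only [map_zero]
      | add x y hx hy => simp only [map_add, hx, hy]
      | cons h x =>
      rw [mulFace_succ, coactT_succ, coactT_succ, ih]
      generalize comul (R := k) h = s
      induction s with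
      | zero => simp only [map_zero, LinearMap.zero_apply]
      | add x y hx hy => simp only [map_add, LinearMap.add_apply, hx, hy]
      | tmul a b =>
      rw [tsmash_tmul, tsmash_tmul, mulFace_succ]
      congr 1
      exact tmap_mulFace _ (fun _ _ => rfl) _ _ _ _

theorem coactT_oneDeg (n i : ℕ) (x : Ten k H V (n + 1)) :
    coactT k H V (n + 2) (oneDeg k H V n i x) =
      oneDeg k H (H ⊗[k] V) n i (coactT k H V (n + 1) x) := by
  induction i generalizing n with
  | zero =>
    induction x using ten_induction with
    | zero => simp only [map_zero]
    | add x y hx hy => simp only [map_add, hx, hy]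
    | cons h x =>
    rw [oneDeg_zero, coactT_succ, coactT_succ, coactT_succ, Bialgebra.comul_one,
      Algebra.TensorProduct.one_def]
    generalize comul (R := k) h = s
    induction s with
    | zero => simp only [map_zero, LinearMap.zero_apply]
    | add x y hx hy => simp only [map_add, LinearMap.add_apply, hx, hy]
    | tmul a b => simp [lmulT_one]
  | succ i ih =>
    cases n with
    | zero => simp [oneDeg]
    | succ n =>
      induction x using ten_induction with
      | zero => simp only [map_zero]
      | add x y hx hy => simp only [map_add, hx, hy]
      | cons h x =>
      rw [oneDeg_succ, coactT_succ, coactT_succ, ih]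
      generalize comul (R := k) h = s
      induction s with
      | zero => simp only [map_zero, LinearMap.zero_apply]
      | add x y hx hy => simp only [map_add, LinearMap.add_apply, hx, hy]
      | tmul a b =>
      rw [tsmash_tmul, tsmash_tmul, oneDeg_succ]
      congr 1
      exact tmap_oneDeg _ rfl _ _ _ _

/-! ### The rotation -/

theorem tmap_swapT {K W : Type u} [Ring K] [Algebra k K] [AddCommGroup W] [Module k W]
    (f : H →ₗ[k] K) (g : V →ₗ[k] W) (n : ℕ) (x : Ten k H V (n + 2)) :
    tmap f (n + 2) g (swapT k H V n x) = swapT k K W n (tmap f (n + 2) g x) := by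
  induction x using ten_induction with
  | zero => simp only [map_zero]
  | add x y hx hy => simp only [map_add, hx, hy]
  | cons h x =>
  induction x using ten_induction with
  | zero => simp only [map_zero]
  | add x y hx hy => simp only [map_add, hx, hy]
  | cons g x => simp

theorem tmap_rot {K W : Type u} [Ring K] [HopfAlgebra k K] [AddCommGroup W] [Module k W]
    (f : H →ₗ[k] K) (hf : ∀ h, comul (R := k) (f h) = TensorProduct.map f f (comul h))
    (a : H →ₗ[k] V →ₗ[k] V) (a' : K →ₗ[k] W →ₗ[k] W) (g : V →ₗ[k] W)
    (hg : ∀ h v, g (a h v) = a' (f h) (g v)) (n : ℕ) (x : Ten k H V (n + 1)) :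
    tmap f (n + 1) g (rot a n x) = rot a' n (tmap f (n + 1) g x) := by
  induction n with
  | zero =>
    induction x using ten_induction with
    | zero => simp only [map_zero]
    | add x y hx hy => simp only [map_add, hx, hy]
    | cons h x =>
    rw [rot_zero, tmap_tcons, rot_zero, hf]
    generalize comul (R := k) h = s
    induction s with
    | zero => simp only [map_zero, LinearMap.zero_apply]
    | add x y hx hy => simp only [map_add, LinearMap.add_apply, hx, hy]
    | tmul b c =>
      rw [tsmash_tmul, tmap_tcons, TensorProduct.map_tmul, tsmash_tmul]
      congr 1
      induction x using ten_zero_cases with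
      | nil v => simp [hg]
  | succ n ih =>
    induction x using ten_induction with
    | zero => simp only [map_zero]
    | add x y hx hy => simp only [map_add, hx, hy]
    | cons h x => rw [rot_succ, tmap_swapT, tmap_tcons, ih, tmap_tcons, rot_succ]

theorem mulFace_rot (a : H →ₗ[k] V →ₗ[k] V) (n i : ℕ) (hi : i < n) (x : Ten k H V (n + 2)) :
    mulFace k H V n (i + 1) (rot a (n + 1) x) = rot a n (mulFace k H V n i x) := by
  induction i generalizing n with
  | zero =>
    obtain ⟨n, rfl⟩ : ∃ n', n = n' + 1 := ⟨n - 1, by omega⟩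
    induction x using ten_induction with
    | zero => simp only [map_zero]
    | add x y hx hy => simp only [map_add, hx, hy]
    | cons h x =>
    induction x using ten_induction with
    | zero => simp only [map_zero]
    | add x y hx hy => simp only [map_add, hx, hy]
    | cons g x =>
    rw [mulFace_zero, rot_succ, rot_succ, rot_succ]
    generalize rot a n x = z
    induction z using ten_induction with
    | zero => simp only [map_zero]
    | add x y hx hy => simp only [map_add, hx, hy]
    | cons l z => simp
  | succ i ih =>
    obtain ⟨n, rfl⟩ : ∃ n', n = n' + 1 := ⟨n - 1, by omega⟩
    obtain ⟨n, rfl⟩ : ∃ n', n = n' + 1 := ⟨n - 1, by omega⟩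
    induction x using ten_induction with
    | zero => simp only [map_zero]
    | add x y hx hy => simp only [map_add, hx, hy]
    | cons h x =>
    rw [mulFace_succ, rot_succ, rot_succ, ← ih (n + 1) (by omega)]
    generalize rot a (n + 1 + 1) x = z
    induction z using ten_induction with
    | zero => simp only [map_zero]
    | add x y hx hy => simp only [map_add, hx, hy]
    | cons l z => simp

theorem oneDeg_rot (a : H →ₗ[k] V →ₗ[k] V) (n i : ℕ) (hi : i < n) (x : Ten k H V (n + 1)) :
    oneDeg k H V n (i + 1) (rot a n x) = rot a (n + 1) (oneDeg k H V n i x) := by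
  induction i generalizing n with
  | zero =>
    obtain ⟨n, rfl⟩ : ∃ n', n = n' + 1 := ⟨n - 1, by omega⟩
    induction x using ten_induction with
    | zero => simp only [map_zero]
    | add x y hx hy => simp only [map_add, hx, hy]
    | cons h x =>
    rw [oneDeg_zero, rot_succ, rot_succ, rot_succ]
    generalize rot a n x = z
    induction z using ten_induction with
    | zero => simp only [map_zero]
    | add x y hx hy => simp only [map_add, hx, hy]
    | cons l z => simp
  | succ i ih =>
    obtain ⟨n, rfl⟩ : ∃ n', n = n' + 1 := ⟨n - 1, by omega⟩
    obtain ⟨n, rfl⟩ : ∃ n', n = n' + 1 := ⟨n - 1, by omega⟩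
    induction x using ten_induction with
    | zero => simp only [map_zero]
    | add x y hx hy => simp only [map_add, hx, hy]
    | cons h x =>
    rw [oneDeg_succ, rot_succ, rot_succ, ← ih (n + 1) (by omega)]
    generalize rot a (n + 1) x = z
    induction z using ten_induction with
    | zero => simp only [map_zero]
    | add x y hx hy => simp only [map_add, hx, hy]
    | cons l z => simp

theorem mulFace_rot_rot (act : H →ₐ[k] Module.End k V) (n : ℕ) (x : Ten k H V (n + 2)) :
    mulFace k H V n 0 (rot act.toLinearMap (n + 1) (rot act.toLinearMap (n + 1) x)) =
      rot act.toLinearMap n (mulFace k H V n n x) := by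
  induction n with
  | zero =>
    induction x using ten_induction with
    | zero => simp only [map_zero]
    | add x y hx hy => simp only [map_add, hx, hy]
    | cons h x =>
    induction x using ten_induction with
    | zero => simp only [map_zero]
    | add x y hx hy => simp only [map_add, hx, hy]
    | cons g v =>
    rw [mulFace_zero, rot_succ, rot_zero, rot_zero, Bialgebra.comul_mul]
    generalize comul (R := k) g = t
    induction t with
    | zero => simp only [mul_zero, map_zero, LinearMap.zero_apply]
    | add x y hx hy => simp only [mul_add, map_add, LinearMap.add_apply, hx, hy]
    | tmul c d =>
    rw [tsmash_tmul, swapT_tcons, rot_succ, rot_zero]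
    generalize comul (R := k) h = s
    induction s with
    | zero => simp only [zero_mul, map_zero, LinearMap.zero_apply]
    | add x y hx hy => simp only [add_mul, map_add, LinearMap.add_apply, hx, hy]
    | tmul a b =>
    rw [tsmash_tmul, swapT_tcons, mulFace_zero, Algebra.TensorProduct.tmul_mul_tmul, tsmash_tmul]
    congr 1
    induction v using ten_zero_cases with
    | nil v => simp
  | succ n ih =>
    induction x using ten_induction with
    | zero => simp only [map_zero]
    | add x y hx hy => simp only [map_add, hx, hy]
    | cons h x =>
    rw [mulFace_succ, rot_succ, rot_succ, ← ih]
    generalize rot act.toLinearMap (n + 1) x = z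
    induction z using ten_induction with
    | zero => simp only [map_zero]
    | add x y hx hy => simp only [map_add, hx, hy]
    | cons l z =>
    rw [swapT_tcons, rot_succ, rot_succ, rot_succ]
    generalize rot act.toLinearMap n z = w
    induction w using ten_induction with
    | zero => simp only [map_zero]
    | add x y hx hy => simp only [map_add, hx, hy]
    | cons p w => simp

/-- `h₁ ⊗ ⋯ ⊗ h_n ⊗ v ↦ h₁ ⊗ ⋯ ⊗ h_j ⊗ h ⊗ h_{j+1} ⊗ ⋯ ⊗ h_n ⊗ v`, for `j ≤ n`. -/
def ins (h : H) : ∀ n _j : ℕ, Ten k H V n →ₗ[k] Ten k H V (n + 1)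
  | _, 0 => tcons h
  | 0, _ + 1 => 0
  | n + 1, j + 1 => LinearMap.lTensor H (ins h n j)

theorem ins_zero (h : H) (n : ℕ) (x : Ten k H V n) : ins h n 0 x = tcons h x := by
  cases n <;> rfl

@[simp]
theorem ins_succ (h g : H) (n j : ℕ) (x : Ten k H V n) :
    ins h (n + 1) (j + 1) (tcons g x) = tcons g (ins h n j x) := rfl

theorem rot_ins (a : H →ₗ[k] V →ₗ[k] V) (h : H) (n j : ℕ) (hj : j ≤ n) (x : Ten k H V (n + 1)) :
    rot a (n + 1) (ins h (n + 1) j x) = ins h (n + 1) (j + 1) (rot a n x) := by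
  induction j generalizing n with
  | zero =>
    rw [ins_zero, rot_succ]
    generalize rot a n x = z
    induction z using ten_induction with
    | zero => simp only [map_zero]
    | add x y hx hy => simp only [map_add, hx, hy]
    | cons l z => simp [ins_zero]
  | succ j ih =>
    obtain ⟨n, rfl⟩ : ∃ n', n = n' + 1 := ⟨n - 1, by omega⟩
    induction x using ten_induction with
    | zero => simp only [map_zero]
    | add x y hx hy => simp only [map_add, hx, hy]
    | cons g x =>
    rw [ins_succ, rot_succ, rot_succ, ih n (by omega)]
    generalize rot a n x = z
    induction z using ten_induction with
    | zero => simp only [map_zero]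
    | add x y hx hy => simp only [map_add, hx, hy]
    | cons l z => simp

theorem oneDeg_rot_last (act : H →ₐ[k] Module.End k V) (n : ℕ) (x : Ten k H V (n + 1)) :
    oneDeg k H V n 0 (rot act.toLinearMap n x) =
      rot act.toLinearMap (n + 1) (rot act.toLinearMap (n + 1) (oneDeg k H V n n x)) := by
  induction n with
  | zero =>
    induction x using ten_induction with
    | zero => simp only [map_zero]
    | add x y hx hy => simp only [map_add, hx, hy]
    | cons h v =>
    induction v using ten_zero_cases with
    | nil v =>
    have h1 : act.toLinearMap (1 : H) v = v := by
      rw [AlgHom.toLinearMap_apply, map_one, Module.End.one_apply]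
    rw [oneDeg_zero, rot_succ, rot_zero, rot_zero, Bialgebra.comul_one,
      Algebra.TensorProduct.one_def, tsmash_tmul, swapT_tcons, rot_succ, actZero_tnil, h1,
      rot_zero]
    generalize comul (R := k) h = s
    induction s with
    | zero => simp only [map_zero, LinearMap.zero_apply]
    | add x y hx hy => simp only [map_add, LinearMap.add_apply, hx, hy]
    | tmul a b => simp
  | succ n ih =>
    induction x using ten_induction with
    | zero => simp only [map_zero]
    | add x y hx hy => simp only [map_add, hx, hy]
    | cons h x =>
    rw [oneDeg_succ, ← ins_zero h (n + 2) (oneDeg k H V n n x), rot_ins _ _ _ _ (by omega),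
      rot_ins _ _ _ _ (by omega), ← ih, rot_succ]
    generalize rot act.toLinearMap n x = z
    induction z using ten_induction with
    | zero => simp only [map_zero]
    | add x y hx hy => simp only [map_add, hx, hy]
    | cons l z => simp [ins_zero]

theorem rot_ins_iterate (a : H →ₗ[k] V →ₗ[k] V) (h : H) (n j : ℕ) (hj : j ≤ n + 1)
    (x : Ten k H V (n + 1)) :
    (rot a (n + 1))^[j] (tcons h x) = ins h (n + 1) j ((rot a n)^[j] x) := by
  induction j with
  | zero => rw [ins_zero]; rfl
  | succ j ih =>
    rw [Function.iterate_succ_apply', Function.iterate_succ_apply', ih (by omega),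
      rot_ins _ _ _ _ (by omega)]

theorem rot_ins_last (a : H →ₗ[k] V →ₗ[k] V) (h : H) (n : ℕ) (x : Ten k H V n) :
    rot a n (ins h n n x) = tsmash (tmap LinearMap.id n ∘ₗ a) (comul h) x := by
  induction n with
  | zero => rw [ins_zero, rot_zero]; rfl
  | succ n ih =>
    induction x using ten_induction with
    | zero => simp only [map_zero]
    | add x y hx hy => simp only [map_add, hx, hy]
    | cons g x =>
    rw [ins_succ, rot_succ, ih]
    generalize comul (R := k) h = s
    induction s with
    | zero => simp only [map_zero, LinearMap.zero_apply]
    | add x y hx hy => simp only [map_add, LinearMap.add_apply, hx, hy]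
    | tmul b c => simp

theorem rot_iterate (act : H →ₐ[k] Module.End k V) (n : ℕ) (x : Ten k H V (n + 1)) :
    (rot act.toLinearMap n)^[n + 1] x =
      tmap LinearMap.id (n + 1) (TensorProduct.lift act.toLinearMap)
        (coactT k H V (n + 1) x) := by
  have hact : ∀ (m : ℕ) (b : H) (y : Ten k H (H ⊗[k] V) m),
      tmap LinearMap.id m (act b) (tmap LinearMap.id m (TensorProduct.lift act.toLinearMap) y) =
        tmap LinearMap.id m (TensorProduct.lift act.toLinearMap) (lmulT k H V m b y) := by
    intro m b y
    rw [lmulT, LinearMap.comp_apply, tmap_tmap, tmap_tmap]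
    congr 2
    ext c v
    simp
  induction n with
  | zero =>
    induction x using ten_induction with
    | zero => simp only [map_zero, Function.iterate_one, zero_add]
    | add x y hx hy => simp only [zero_add, Function.iterate_one, map_add] at hx hy ⊢; rw [hx, hy]
    | cons h v =>
    induction v using ten_zero_cases with
    | nil v =>
    change rot act.toLinearMap 0 (tcons h (tnil v)) = _
    rw [rot_zero, coactT_succ, coactT_tnil]
    generalize comul (R := k) h = s
    induction s with
    | zero => simp only [map_zero, LinearMap.zero_apply]
    | add x y hx hy => simp only [map_add, LinearMap.add_apply, hx, hy]
    | tmul b c => simp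
  | succ n ih =>
    induction x using ten_induction with
    | zero => rw [map_zero, map_zero]; exact Function.iterate_fixed (map_zero _) _
    | add x y hx hy =>
      rw [map_add, map_add, ← hx, ← hy]
      simp only [← Module.End.pow_apply, map_add]
    | cons h x =>
    rw [Function.iterate_succ_apply', rot_ins_iterate _ _ _ _ le_rfl, rot_ins_last, ih,
      coactT_succ]
    generalize comul (R := k) h = s
    generalize coactT k H V (n + 1) x = y
    induction s with
    | zero => simp only [map_zero, LinearMap.zero_apply]
    | add x y hx hy => simp only [map_add, LinearMap.add_apply, hx, hy]
    | tmul b c =>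
      rw [tsmash_tmul, tsmash_tmul, tmap_tcons]
      congr 1
      exact hact (n + 1) c y

end Rot

/-! ## The cyclic module of a Hopf algebra with coefficients -/

section Coaction

variable {k H V : Type u} [Field k] [Ring H] [HopfAlgebra k H] [AddCommGroup V] [Module k V]

/-- `h ⊗ x ↦ ∑ h₁ ⊗ (h₂ g) ρ(x)` for the right coaction `ρ` of `H` on `H^{⊗ n}`. -/
def coactR (n : ℕ) (g : H) : Ten k H V (n + 1) →ₗ[k] Ten k H (H ⊗[k] V) (n + 1) :=
  tcosmash (lmulT k H V n ∘ₗ LinearMap.mulRight k g) ∘ₗ LinearMap.lTensor H (coactT k H V n)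

theorem coactR_tcons (n : ℕ) (g h : H) (x : Ten k H V n) :
    coactR n g (tcons h x) =
      tsmash (lmulT k H V n ∘ₗ LinearMap.mulRight k g) (comul h) (coactT k H V n x) := rfl

theorem coactR_one (n : ℕ) (x : Ten k H V (n + 1)) :
    coactR n 1 x = coactT k H V (n + 1) x := by
  induction x using ten_induction with
  | zero => simp only [map_zero]
  | add x y hx hy => simp only [map_add, hx, hy]
  | cons h x =>
    rw [coactR_tcons, coactT_succ, LinearMap.mulRight_one, LinearMap.comp_id]

theorem tmap_coactT {K W : Type u} [Ring K] [HopfAlgebra k K] [AddCommGroup W] [Module k W]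
    (f : H →ₐc[k] K) (g : V →ₗ[k] W) (n : ℕ) (x : Ten k H V n) :
    tmap (f : H →ₗ[k] K) n (TensorProduct.map (f : H →ₗ[k] K) g) (coactT k H V n x) =
      coactT k K W n (tmap (f : H →ₗ[k] K) n g x) := by
  have hl : ∀ (m : ℕ) (b : H) (y : Ten k H (H ⊗[k] V) m),
      tmap (f : H →ₗ[k] K) m (TensorProduct.map (f : H →ₗ[k] K) g) (lmulT k H V m b y) =
        lmulT k K W m (f b) (tmap (f : H →ₗ[k] K) m (TensorProduct.map (f : H →ₗ[k] K) g) y) := by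
    intro m b y
    simp only [lmulT, LinearMap.comp_apply, tmap_tmap]
    congr 2
    ext c v
    simp
  induction n with
  | zero =>
    induction x using ten_zero_cases with
    | nil v => simp
  | succ n ih =>
    induction x using ten_induction with
    | zero => simp only [map_zero]
    | add x y hx hy => simp only [map_add, hx, hy]
    | cons h x =>
    have hf : comul (R := k) ((f : H →ₗ[k] K) h) =
        TensorProduct.map (f : H →ₗ[k] K) (f : H →ₗ[k] K) (comul h) :=
      (CoalgHomClass.map_comp_comul_apply f h).symm
    rw [coactT_succ, tmap_tcons, coactT_succ, hf, ← ih]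
    generalize comul (R := k) h = s
    induction s with
    | zero => simp only [map_zero, LinearMap.zero_apply]
    | add x y hx hy => simp only [map_add, LinearMap.add_apply, hx, hy]
    | tmul a b =>
      rw [tsmash_tmul, tmap_tcons, hl, TensorProduct.map_tmul, tsmash_tmul]
      rfl

theorem rot_lmulT_coactT [HasBijectiveAntipode k H] (act : H →ₐ[k] Module.End k V) (n : ℕ) (g : H)
    (x : Ten k H V (n + 1)) :
    rot (aydAct k H V act) n (lmulT k H V (n + 1) g (coactT k H V (n + 1) x)) =
      coactR n g (rot act.toLinearMap n x) := by
  induction n generalizing g with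
  | zero =>
    induction x using ten_induction with
    | zero => simp only [map_zero]
    | add x y hx hy => simp only [map_add, hx, hy]
    | cons h v =>
    induction v using ten_zero_cases with
    | nil v =>
    let L : H ⊗[k] H →ₗ[k] H ⊗[k] V := TensorProduct.lift ((aydAct k H V act).compl₂
      ((TensorProduct.mk k H V).flip v ∘ₗ LinearMap.mulLeft k g))
    let L' : H ⊗[k] H →ₗ[k] H ⊗[k] V :=
      TensorProduct.map (LinearMap.mulRight k g) (act.toLinearMap.flip v)
    have h1 : ∀ s : H ⊗[k] H, rot (aydAct k H V act) 0 (lmulT k H V 1 g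
        (tsmash (lmulT k H V 0) s (tnil (1 ⊗ₜ v)))) =
        LinearMap.lTensor H L (TensorProduct.assoc k H H H (LinearMap.rTensor H comul s)) := by
      intro s
      induction s with
      | zero => simp only [map_zero, LinearMap.zero_apply]; rfl
      | add x y hx hy => simp only [map_add, LinearMap.add_apply, hx, hy]; rfl
      | tmul a b =>
        rw [tsmash_tmul, lmulT_tcons, lmulT_tnil, lmulT_tnil, rot_zero, LinearMap.rTensor_tmul,
          mul_one]
        generalize comul (R := k) a = s
        induction s with
        | zero => simp only [map_zero, LinearMap.zero_apply, TensorProduct.zero_tmul]; rfl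
        | add x y hx hy => simp only [map_add, LinearMap.add_apply, TensorProduct.add_tmul, hx, hy]; rfl
        | tmul p q => rfl
    have h2 : ∀ s : H ⊗[k] H, coactR 0 g (tsmash (actZero act.toLinearMap) s (tnil v)) =
        LinearMap.lTensor H L' (TensorProduct.assoc k H H H (LinearMap.rTensor H comul s)) := by
      intro s
      induction s with
      | zero => simp only [map_zero, LinearMap.zero_apply]; rfl
      | add x y hx hy => simp only [map_add, LinearMap.add_apply, hx, hy]; rfl
      | tmul a b =>
        rw [tsmash_tmul, coactR_tcons, LinearMap.rTensor_tmul, actZero_tnil, coactT_tnil]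
        generalize comul (R := k) a = s
        induction s with
        | zero => simp only [map_zero, LinearMap.zero_apply, TensorProduct.zero_tmul]; rfl
        | add x y hx hy => simp only [map_add, LinearMap.add_apply, TensorProduct.add_tmul, hx, hy]; rfl
        | tmul p q =>
          rw [tsmash_tmul, LinearMap.comp_apply, lmulT_tnil, mul_one]
          rfl
    have h3 : ∀ s : H ⊗[k] H, LinearMap.lTensor H L (LinearMap.lTensor H comul s) =
        LinearMap.lTensor H L' (LinearMap.lTensor H comul s) := by
      intro s
      induction s with
      | zero => simp only [map_zero]
      | add x y hx hy => simp only [map_add, hx, hy]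
      | tmul a b =>
        simp only [LinearMap.lTensor_tmul]
        rw [SAYD.aydAct_aux]
    rw [rot_zero, coactT_succ, coactT_tnil, h1, h2, Coalgebra.coassoc_apply, h3]
  | succ n ih =>
    induction x using ten_induction with
    | zero => simp only [map_zero]
    | add x y hx hy => simp only [map_add, hx, hy]
    | cons h x =>
    rw [coactT_succ, rot_succ]
    have h1 : comul (R := k) h = _ := (Coalgebra.Repr.eq (ℛ k h)).symm
    rw [h1]
    simp only [map_sum, LinearMap.sum_apply, tsmash_tmul, lmulT_tcons, ← lmulT_mul, rot_succ, ih]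
    generalize rot act.toLinearMap n x = z
    induction z using ten_induction with
    | zero => simp only [map_zero, Finset.sum_const_zero]
    | add x y hx hy => simp only [map_add, Finset.sum_add_distrib, hx, hy]
    | cons p z =>
    rw [swapT_tcons, coactR_tcons]
    simp only [coactR_tcons]
    generalize comul (R := k) p = s
    induction s with
    | zero => simp only [map_zero, LinearMap.zero_apply, Finset.sum_const_zero]
    | add x y hx hy => simp only [map_add, LinearMap.add_apply, Finset.sum_add_distrib, hx, hy]
    | tmul c d =>
    rw [coactT_succ, h1]
    simp only [map_sum, LinearMap.sum_apply, tsmash_tmul, LinearMap.comp_apply,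
      LinearMap.mulRight_apply, lmulT_tcons, swapT_tcons, ← lmulT_mul, mul_assoc]

theorem coactT_rot [HasBijectiveAntipode k H] (act : H →ₐ[k] Module.End k V) (n : ℕ)
    (x : Ten k H V (n + 1)) :
    coactT k H V (n + 1) (rot act.toLinearMap n x) =
      rot (aydAct k H V act) n (coactT k H V (n + 1) x) := by
  rw [← coactR_one, ← rot_lmulT_coactT, lmulT_one]

end Coaction

section HopfCyclic

variable {k H M : Type u} [Field k] [Ring H] [HopfAlgebra k H]
  [AddCommGroup M] [Module k M]

/-- The faces on `H^{⊗ n+2} ⊗ M`: multiplication of neighbours for `i ≤ n`, and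
`h₀ ⊗ ⋯ ⊗ h_{n+1} ⊗ m ↦ (h_{n+1})₁ h₀ ⊗ h₁ ⊗ ⋯ ⊗ h_n ⊗ (h_{n+1})₂ m` for `i = n + 1`. -/
def hopfFace (act : H →ₐ[k] Module.End k M) (n i : ℕ) :
    Ten k H M (n + 2) →ₗ[k] Ten k H M (n + 1) :=
  if i ≤ n then mulFace k H M n i else mulFace k H M n 0 ∘ₗ rot act.toLinearMap (n + 1)

theorem hopfFace_of_le (act : H →ₐ[k] Module.End k M) {n i : ℕ} (h : i ≤ n)
    (x : Ten k H M (n + 2)) : hopfFace act n i x = mulFace k H M n i x := by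
  rw [hopfFace, if_pos h]

theorem hopfFace_last (act : H →ₐ[k] Module.End k M) (n : ℕ) (x : Ten k H M (n + 2)) :
    hopfFace act n (n + 1) x = mulFace k H M n 0 (rot act.toLinearMap (n + 1) x) := by
  rw [hopfFace, if_neg (by omega), LinearMap.comp_apply]

theorem oneDeg_eq_ins (n : ℕ) (x : Ten k H M (n + 1)) :
    oneDeg k H M n n x = ins 1 (n + 1) (n + 1) x := by
  induction n with
  | zero =>
    induction x using ten_induction with
    | zero => simp only [map_zero]
    | add x y hx hy => simp only [map_add, hx, hy]
    | cons h x => rw [oneDeg_zero, ins_succ, ins_zero]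
  | succ n ih =>
    induction x using ten_induction with
    | zero => simp only [map_zero]
    | add x y hx hy => simp only [map_add, hx, hy]
    | cons h x => rw [oneDeg_succ, ins_succ, ih]

theorem rot_oneDeg_last (act : H →ₐ[k] Module.End k M) (n : ℕ) (x : Ten k H M (n + 1)) :
    rot act.toLinearMap (n + 1) (oneDeg k H M n n x) = tcons 1 x := by
  have h1 : act.toLinearMap (1 : H) = LinearMap.id := by
    rw [AlgHom.toLinearMap_apply, map_one]; rfl
  rw [oneDeg_eq_ins, rot_ins_last, Bialgebra.comul_one, Algebra.TensorProduct.one_def,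
    tsmash_tmul, LinearMap.comp_apply, h1, tmap_id]

theorem hopfFace_hopfFace (act : H →ₐ[k] Module.End k M) (n i j : ℕ) (hij : i ≤ j)
    (hj : j ≤ n + 1) (x : Ten k H M (n + 3)) :
    hopfFace act n i (hopfFace act (n + 1) (j + 1) x) =
      hopfFace act n j (hopfFace act (n + 1) i x) := by
  rcases Nat.lt_or_ge n j with h | h
  · obtain rfl : j = n + 1 := by omega
    rw [hopfFace_last, hopfFace_last, hopfFace_of_le act hij]
    rcases Nat.lt_or_ge n i with h' | h'
    · obtain rfl : i = n + 1 := by omega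
      rw [hopfFace_last, ← mulFace_rot _ _ _ (by omega), mulFace_mulFace _ _ _ le_rfl,
        mulFace_rot_rot]
    · rw [hopfFace_of_le act h', ← mulFace_rot _ _ _ (by omega), mulFace_mulFace _ _ _ (by omega)]
  · rw [hopfFace_of_le act (by omega), hopfFace_of_le act (by omega), hopfFace_of_le act h,
      hopfFace_of_le act (by omega), mulFace_mulFace _ _ _ hij]

variable [HasBijectiveAntipode k H]

/-- The cotensor product `C̃_n(H, M) = H^{⊗ n+1} □_H M ⊆ H^{⊗ n+1} ⊗ M`: the equalizer of the
right coaction of `H` on `H^{⊗ n+1}` and the left coaction of `H` on `M`. -/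
def cotensor (𝓜 : SAYD k H M) (n : ℕ) : Submodule k (Ten k H M (n + 1)) :=
  LinearMap.eqLocus (coactT k H M (n + 1)) (tmap LinearMap.id (n + 1) 𝓜.coact)

theorem mem_cotensor {𝓜 : SAYD k H M} {n : ℕ} {x : Ten k H M (n + 1)} :
    x ∈ cotensor 𝓜 n ↔ coactT k H M (n + 1) x = tmap LinearMap.id (n + 1) 𝓜.coact x := Iff.rfl

theorem rot_mem_cotensor (𝓜 : SAYD k H M) (n : ℕ) {x : Ten k H M (n + 1)}
    (hx : x ∈ cotensor 𝓜 n) : rot 𝓜.act.toLinearMap n x ∈ cotensor 𝓜 n := by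
  rw [mem_cotensor] at hx ⊢
  rw [coactT_rot, hx]
  refine (tmap_rot LinearMap.id (fun h => ?_) _ _ _ (fun h v => ?_) n x).symm
  · rw [TensorProduct.map_id]; rfl
  · exact 𝓜.ayd h v

theorem mulFace_mem_cotensor (𝓜 : SAYD k H M) (n i : ℕ) {x : Ten k H M (n + 2)}
    (hx : x ∈ cotensor 𝓜 (n + 1)) : mulFace k H M n i x ∈ cotensor 𝓜 n := by
  rw [mem_cotensor] at hx ⊢
  rw [coactT_mulFace, hx]
  exact (tmap_mulFace LinearMap.id (fun _ _ => rfl) _ n i x).symm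

theorem oneDeg_mem_cotensor (𝓜 : SAYD k H M) (n i : ℕ) {x : Ten k H M (n + 1)}
    (hx : x ∈ cotensor 𝓜 n) : oneDeg k H M n i x ∈ cotensor 𝓜 (n + 1) := by
  rw [mem_cotensor] at hx ⊢
  rw [coactT_oneDeg, hx]
  exact (tmap_oneDeg LinearMap.id rfl _ n i x).symm

theorem hopfFace_mem_cotensor (𝓜 : SAYD k H M) (n i : ℕ) {x : Ten k H M (n + 2)}
    (hx : x ∈ cotensor 𝓜 (n + 1)) : hopfFace 𝓜.act n i x ∈ cotensor 𝓜 n := by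
  rw [hopfFace]
  split
  · exact mulFace_mem_cotensor 𝓜 n i hx
  · exact mulFace_mem_cotensor 𝓜 n 0 (rot_mem_cotensor 𝓜 (n + 1) hx)

theorem rot_pow_cotensor (𝓜 : SAYD k H M) (n : ℕ) {x : Ten k H M (n + 1)}
    (hx : x ∈ cotensor 𝓜 n) : (rot 𝓜.act.toLinearMap n)^[n + 1] x = x := by
  rw [mem_cotensor] at hx
  have h : TensorProduct.lift 𝓜.act.toLinearMap ∘ₗ 𝓜.coact = LinearMap.id :=
    LinearMap.ext 𝓜.stable
  rw [rot_iterate, hx, tmap_tmap, h, LinearMap.id_comp, tmap_id]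

/-- The cyclic module `C̃_*(H, M)` of a Hopf algebra `H` with coefficients in the stable
anti-Yetter-Drinfeld module `M`, dual to the Connes-Moscovici cyclic module. -/
def hopfCyclic (𝓜 : SAYD k H M) : CyclicModule.{u, u} k where
  X n := cotensor 𝓜 n
  d n i := (hopfFace 𝓜.act n i).restrict fun _ hx => hopfFace_mem_cotensor 𝓜 n i hx
  s n i := (oneDeg k H M n i).restrict fun _ hx => oneDeg_mem_cotensor 𝓜 n i hx
  t n := (rot 𝓜.act.toLinearMap n).restrict fun _ hx => rot_mem_cotensor 𝓜 n hx
  d_d n i j hij hj x := Subtype.ext (hopfFace_hopfFace 𝓜.act n i j hij hj x)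
  s_s n i j hij hj x := Subtype.ext (oneDeg_oneDeg n i j hij hj x.1)
  d_s_lt n i j hij hj x := Subtype.ext <| by
    change hopfFace 𝓜.act (n + 1) i (oneDeg k H M (n + 1) (j + 1) x.1) =
      oneDeg k H M n j (hopfFace 𝓜.act n i x.1)
    rw [hopfFace_of_le _ (by omega), hopfFace_of_le _ (by omega),
      mulFace_oneDeg_lt _ _ _ hij hj]
  d_s_self n j hj x := Subtype.ext <| by
    change hopfFace 𝓜.act n j (oneDeg k H M n j x.1) = x.1
    rw [hopfFace_of_le _ hj, mulFace_oneDeg_self _ _ hj]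
  d_s_succ n j hj x := Subtype.ext <| by
    change hopfFace 𝓜.act n (j + 1) (oneDeg k H M n j x.1) = x.1
    rcases Nat.lt_or_ge j n with h | h
    · rw [hopfFace_of_le _ h, mulFace_oneDeg_succ _ _ h]
    · obtain rfl : j = n := by omega
      rw [hopfFace_last, rot_oneDeg_last]
      generalize x.1 = y
      induction y using ten_induction with
      | zero => simp only [map_zero]
      | add x y hx hy => simp only [map_add, hx, hy]
      | cons h y => rw [mulFace_zero, one_mul]
  d_s_gt n i j hij hi x := Subtype.ext <| by
    change hopfFace 𝓜.act (n + 1) (i + 1) (oneDeg k H M (n + 1) j x.1) =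
      oneDeg k H M n j (hopfFace 𝓜.act n i x.1)
    rcases Nat.lt_or_ge n i with h | h
    · obtain rfl : i = n + 1 := by omega
      rw [hopfFace_last, hopfFace_last, ← oneDeg_rot _ _ _ hij,
        mulFace_oneDeg_lt _ _ _ (by omega) (by omega)]
    · rw [hopfFace_of_le _ (by omega), hopfFace_of_le _ h, mulFace_oneDeg_gt _ _ _ hij h]
  d_t_succ n i hi x := Subtype.ext <| by
    change hopfFace 𝓜.act n (i + 1) (rot 𝓜.act.toLinearMap (n + 1) x.1) =
      rot 𝓜.act.toLinearMap n (hopfFace 𝓜.act n i x.1)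
    rcases Nat.lt_or_ge i n with h | h
    · rw [hopfFace_of_le _ h, hopfFace_of_le _ hi, mulFace_rot _ _ _ h]
    · obtain rfl : i = n := by omega
      rw [hopfFace_last, hopfFace_of_le _ le_rfl, mulFace_rot_rot]
  d_t_zero n x := Subtype.ext <| by
    change hopfFace 𝓜.act n 0 (rot 𝓜.act.toLinearMap (n + 1) x.1) =
      hopfFace 𝓜.act n (n + 1) x.1
    rw [hopfFace_last, hopfFace_of_le _ (by omega)]
  s_t_succ n i hi x := Subtype.ext (oneDeg_rot _ n i hi x.1)
  s_t_zero n x := Subtype.ext (oneDeg_rot_last 𝓜.act n x.1)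
  t_pow n x := by
    have h : ∀ (m : ℕ) (y : cotensor 𝓜 n),
        ((((rot 𝓜.act.toLinearMap n).restrict fun _ hx => rot_mem_cotensor 𝓜 n hx) ^ m :
          Module.End k (cotensor 𝓜 n)) y).1 = (rot 𝓜.act.toLinearMap n)^[m] y.1 := by
      intro m y
      induction m with
      | zero => rfl
      | succ m ih => rw [pow_succ', Function.iterate_succ_apply', ← ih]; rfl
    exact Subtype.ext ((h _ x).trans (rot_pow_cotensor 𝓜 n x.2))

variable {K N : Type u} [Ring K] [HopfAlgebra k K] [HasBijectiveAntipode k K]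
  [AddCommGroup N] [Module k N]

theorem tmap_hopfFace {𝓜 : SAYD k H M} {𝓝 : SAYD k K N} (φ : SAYD.Hom 𝓜 𝓝) (n i : ℕ)
    (x : Ten k H M (n + 2)) :
    tmap (φ.f : H →ₗ[k] K) (n + 1) φ.g (hopfFace 𝓜.act n i x) =
      hopfFace 𝓝.act n i (tmap (φ.f : H →ₗ[k] K) (n + 2) φ.g x) := by
  have hm : ∀ a b, (φ.f : H →ₗ[k] K) (a * b) = (φ.f : H →ₗ[k] K) a * (φ.f : H →ₗ[k] K) b :=
    fun a b => map_mul φ.f a b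
  have hr := tmap_rot (φ.f : H →ₗ[k] K)
    (fun h => (CoalgHomClass.map_comp_comul_apply φ.f h).symm)
    𝓜.act.toLinearMap 𝓝.act.toLinearMap φ.g φ.g_act (n + 1) x
  rw [hopfFace, hopfFace]
  split
  · exact tmap_mulFace _ hm _ _ _ _
  · rw [LinearMap.comp_apply, LinearMap.comp_apply, tmap_mulFace _ hm, hr]

/-- The morphism of cyclic modules `C̃_*(H, M) → C̃_*(K, N)` induced by `(H, M) → (K, N)`,
`h₀ ⊗ ⋯ ⊗ h_n ⊗ m ↦ f(h₀) ⊗ ⋯ ⊗ f(h_n) ⊗ g(m)`. -/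
def SAYD.Hom.toCyclic {𝓜 : SAYD k H M} {𝓝 : SAYD k K N} (φ : SAYD.Hom 𝓜 𝓝) :
    CyclicModule.Hom (hopfCyclic 𝓜) (hopfCyclic 𝓝) where
  f n := (tmap (φ.f : H →ₗ[k] K) (n + 1) φ.g).restrict fun x hx => by
    rw [mem_cotensor] at hx ⊢
    rw [← tmap_coactT, hx, tmap_tmap, tmap_tmap]
    congr 2
    exact LinearMap.ext fun m => (φ.g_coact m).symm
  f_d n i _ x := Subtype.ext (tmap_hopfFace φ n i x.1)
  f_s n i _ x := Subtype.ext (tmap_oneDeg (φ.f : H →ₗ[k] K) (map_one φ.f) _ _ _ x.1)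
  f_t n x := Subtype.ext <| tmap_rot (φ.f : H →ₗ[k] K)
    (fun h => (CoalgHomClass.map_comp_comul_apply φ.f h).symm)
    𝓜.act.toLinearMap 𝓝.act.toLinearMap φ.g φ.g_act n x.1

end HopfCyclic

/-! ## The product -/

section Pairing

variable {k H K V W : Type u} [Field k] [Ring H] [Ring K]
  [AddCommGroup V] [Module k V] [AddCommGroup W] [Module k W]

section

variable [Algebra k H] [Algebra k K]

/-- The canonical pairing of `H^{⊗ n} ⊗ V` and `K^{⊗ n} ⊗ W` with values in
`(H ⊗ K)^{⊗ n} ⊗ (V ⊗ W)`,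
`(h₁ ⊗ ⋯ ⊗ h_n ⊗ v, g₁ ⊗ ⋯ ⊗ g_n ⊗ w) ↦ (h₁ ⊗ g₁) ⊗ ⋯ ⊗ (h_n ⊗ g_n) ⊗ (v ⊗ w)`. -/
def pairT : ∀ n : ℕ, Ten k H V n →ₗ[k] Ten k K W n →ₗ[k] Ten k (H ⊗[k] K) (V ⊗[k] W) n
  | 0 => TensorProduct.mk k V W
  | n + 1 => TensorProduct.map₂ (TensorProduct.mk k H K)
      (pairT n : TenObj k H V n →ₗ[k] TenObj k K W n →ₗ[k] TenObj k (H ⊗[k] K) (V ⊗[k] W) n)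

@[simp]
theorem pairT_tnil (v : V) (w : W) :
    pairT 0 (tnil v : Ten k H V 0) (tnil w : Ten k K W 0) = tnil (v ⊗ₜ w) := rfl

@[simp]
theorem pairT_tcons (n : ℕ) (h : H) (g : K) (x : Ten k H V n) (y : Ten k K W n) :
    pairT (n + 1) (tcons h x) (tcons g y) = tcons (h ⊗ₜ g) (pairT n x y) := rfl

theorem ten_induction₂ {n : ℕ} {P : Ten k H V (n + 1) → Ten k K W (n + 1) → Prop}
    (zl : ∀ y, P 0 y) (zr : ∀ x, P x 0)
    (al : ∀ x x' y, P x y → P x' y → P (x + x') y)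
    (ar : ∀ x y y', P x y → P x y' → P x (y + y'))
    (cons : ∀ h x g y, P (tcons h x) (tcons g y)) (x : Ten k H V (n + 1))
    (y : Ten k K W (n + 1)) : P x y := by
  induction x using ten_induction with
  | zero => exact zl y
  | add x x' hx hx' => exact al _ _ _ hx hx'
  | cons h x =>
    induction y using ten_induction with
    | zero => exact zr _
    | add y y' hy hy' => exact ar _ _ _ hy hy'
    | cons g y => exact cons _ _ _ _

theorem pairT_mulFace (n i : ℕ) (x : Ten k H V (n + 2)) (y : Ten k K W (n + 2)) :
    pairT (n + 1) (mulFace k H V n i x) (mulFace k K W n i y) =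
      mulFace k (H ⊗[k] K) (V ⊗[k] W) n i (pairT (n + 2) x y) := by
  induction i generalizing n with
  | zero =>
    induction x, y using ten_induction₂ with
    | zl y => simp only [map_zero, LinearMap.zero_apply]
    | zr x => simp only [map_zero]
    | al x x' y hx hx' => simp only [map_add, LinearMap.add_apply, hx, hx']
    | ar x y y' hy hy' => simp only [map_add, hy, hy']
    | cons h x g y =>
    induction x, y using ten_induction₂ with
    | zl y => simp only [map_zero, LinearMap.zero_apply]
    | zr x => simp only [map_zero]
    | al x x' y hx hx' => simp only [map_add, LinearMap.add_apply, hx, hx']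
    | ar x y y' hy hy' => simp only [map_add, hy, hy']
    | cons h' x g' y => simp
  | succ i ih =>
    cases n with
    | zero => simp [mulFace]
    | succ n =>
      induction x, y using ten_induction₂ with
      | zl y => simp only [map_zero, LinearMap.zero_apply]
      | zr x => simp only [map_zero]
      | al x x' y hx hx' => simp only [map_add, LinearMap.add_apply, hx, hx']
      | ar x y y' hy hy' => simp only [map_add, hy, hy']
      | cons h x g y =>
        rw [mulFace_succ, mulFace_succ, pairT_tcons, pairT_tcons, mulFace_succ, ih]

theorem pairT_oneDeg (n i : ℕ) (x : Ten k H V (n + 1)) (y : Ten k K W (n + 1)) :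
    pairT (n + 2) (oneDeg k H V n i x) (oneDeg k K W n i y) =
      oneDeg k (H ⊗[k] K) (V ⊗[k] W) n i (pairT (n + 1) x y) := by
  induction i generalizing n with
  | zero =>
    induction x, y using ten_induction₂ with
    | zl y => simp only [map_zero, LinearMap.zero_apply]
    | zr x => simp only [map_zero]
    | al x x' y hx hx' => simp only [map_add, LinearMap.add_apply, hx, hx']
    | ar x y y' hy hy' => simp only [map_add, hy, hy']
    | cons h x g y => simp [Algebra.TensorProduct.one_def]
  | succ i ih =>
    cases n with
    | zero => simp [oneDeg]
    | succ n =>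
      induction x, y using ten_induction₂ with
      | zl y => simp only [map_zero, LinearMap.zero_apply]
      | zr x => simp only [map_zero]
      | al x x' y hx hx' => simp only [map_add, LinearMap.add_apply, hx, hx']
      | ar x y y' hy hy' => simp only [map_add, hy, hy']
      | cons h x g y =>
        rw [oneDeg_succ, oneDeg_succ, pairT_tcons, pairT_tcons, oneDeg_succ, ih]

theorem pairT_swapT (n : ℕ) (x : Ten k H V (n + 2)) (y : Ten k K W (n + 2)) :
    pairT (n + 2) (swapT k H V n x) (swapT k K W n y) =
      swapT k (H ⊗[k] K) (V ⊗[k] W) n (pairT (n + 2) x y) := by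
  induction x, y using ten_induction₂ with
  | zl y => simp only [map_zero, LinearMap.zero_apply]
  | zr x => simp only [map_zero]
  | al x x' y hx hx' => simp only [map_add, LinearMap.add_apply, hx, hx']
  | ar x y y' hy hy' => simp only [map_add, hy, hy']
  | cons h x g y =>
  induction x, y using ten_induction₂ with
  | zl y => simp only [map_zero, LinearMap.zero_apply]
  | zr x => simp only [map_zero]
  | al x x' y hx hx' => simp only [map_add, LinearMap.add_apply, hx, hx']
  | ar x y y' hy hy' => simp only [map_add, hy, hy']
  | cons h' x g' y => simp

theorem pairT_tmap {H' K' V' W' : Type u} [Ring H'] [Algebra k H'] [Ring K'] [Algebra k K']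
    [AddCommGroup V'] [Module k V'] [AddCommGroup W'] [Module k W']
    (f : H →ₗ[k] H') (f' : K →ₗ[k] K') (g : V →ₗ[k] V') (g' : W →ₗ[k] W') (n : ℕ)
    (x : Ten k H V n) (y : Ten k K W n) :
    pairT n (tmap f n g x) (tmap f' n g' y) =
      tmap (TensorProduct.map f f') n (TensorProduct.map g g') (pairT n x y) := by
  induction n with
  | zero => rfl
  | succ n ih =>
    induction x, y using ten_induction₂ with
    | zl y => simp only [map_zero, LinearMap.zero_apply]
    | zr x => simp only [map_zero]
    | al x x' y hx hx' => simp only [map_add, LinearMap.add_apply, hx, hx']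
    | ar x y y' hy hy' => simp only [map_add, hy, hy']
    | cons h x g y => simp [ih]

variable (k H K V W) in
/-- The rearrangement `(h ⊗ v) ⊗ (g ⊗ w) ↦ (h ⊗ g) ⊗ (v ⊗ w)`. -/
def ttt : (H ⊗[k] V) ⊗[k] (K ⊗[k] W) →ₗ[k] (H ⊗[k] K) ⊗[k] (V ⊗[k] W) :=
  (TensorProduct.tensorTensorTensorComm k H V K W).toLinearMap

theorem lmulT_pairT (n : ℕ) (h : H) (g : K) (x : Ten k H (H ⊗[k] V) n)
    (y : Ten k K (K ⊗[k] W) n) :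
    lmulT k (H ⊗[k] K) (V ⊗[k] W) n (h ⊗ₜ g)
        (tmap LinearMap.id n (ttt k H K V W) (pairT n x y)) =
      tmap LinearMap.id n (ttt k H K V W)
        (pairT n (lmulT k H V n h x) (lmulT k K W n g y)) := by
  simp only [lmulT, LinearMap.comp_apply, tmap_tmap, pairT_tmap]
  rw [TensorProduct.map_id, LinearMap.id_comp]
  congr 2
  ext a v b w
  simp [ttt]

end

variable [HopfAlgebra k H] [HopfAlgebra k K]

theorem pairT_rot (a : H →ₐ[k] Module.End k V) (b : K →ₐ[k] Module.End k W) (n : ℕ)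
    (x : Ten k H V (n + 1)) (y : Ten k K W (n + 1)) :
    pairT (n + 1) (rot a.toLinearMap n x) (rot b.toLinearMap n y) =
      rot (SAYD.tensorAct a b).toLinearMap n (pairT (n + 1) x y) := by
  induction n with
  | zero =>
    induction x, y using ten_induction₂ with
    | zl y => simp only [map_zero, LinearMap.zero_apply]
    | zr x => simp only [map_zero]
    | al x x' y hx hx' => simp only [map_add, LinearMap.add_apply, hx, hx']
    | ar x y y' hy hy' => simp only [map_add, hy, hy']
    | cons h x g y =>
    induction x using ten_zero_cases with
    | nil v =>
    induction y using ten_zero_cases with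
    | nil w =>
    rw [rot_zero, rot_zero, pairT_tcons, rot_zero, TensorProduct.comul_tmul, pairT_tnil]
    generalize comul (R := k) h = s
    generalize comul (R := k) g = t
    induction s with
    | zero => simp only [map_zero, LinearMap.zero_apply, TensorProduct.zero_tmul]
    | add x y hx hy => simp only [map_add, LinearMap.add_apply, TensorProduct.add_tmul, hx, hy]
    | tmul c d =>
    induction t with
    | zero => simp only [map_zero, LinearMap.zero_apply, TensorProduct.tmul_zero]
    | add x y hx hy => simp only [map_add, LinearMap.add_apply, TensorProduct.tmul_add, hx, hy]
    | tmul c' d' => rfl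
  | succ n ih =>
    induction x, y using ten_induction₂ with
    | zl y => simp only [map_zero, LinearMap.zero_apply]
    | zr x => simp only [map_zero]
    | al x x' y hx hx' => simp only [map_add, LinearMap.add_apply, hx, hx']
    | ar x y y' hy hy' => simp only [map_add, hy, hy']
    | cons h x g y =>
    rw [rot_succ, rot_succ, pairT_swapT, pairT_tcons, ih, pairT_tcons, rot_succ]

theorem coactT_pairT (n : ℕ) (x : Ten k H V n) (y : Ten k K W n) :
    coactT k (H ⊗[k] K) (V ⊗[k] W) n (pairT n x y) =
      tmap LinearMap.id n (ttt k H K V W) (pairT n (coactT k H V n x) (coactT k K W n y)) := by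
  induction n with
  | zero => rfl
  | succ n ih =>
    induction x, y using ten_induction₂ with
    | zl y => simp only [map_zero, LinearMap.zero_apply]
    | zr x => simp only [map_zero]
    | al x x' y hx hx' => simp only [map_add, LinearMap.add_apply, hx, hx']
    | ar x y y' hy hy' => simp only [map_add, hy, hy']
    | cons h x g y =>
    rw [pairT_tcons, coactT_succ, coactT_succ, coactT_succ, ih, TensorProduct.comul_tmul]
    generalize comul (R := k) h = s
    generalize comul (R := k) g = t
    induction s with
    | zero => simp only [map_zero, LinearMap.zero_apply, TensorProduct.zero_tmul]
    | add x y hx hy => simp only [map_add, LinearMap.add_apply, TensorProduct.add_tmul, hx, hy]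
    | tmul c d =>
    induction t with
    | zero => simp only [map_zero, LinearMap.zero_apply, TensorProduct.tmul_zero]
    | add x y hx hy => simp only [map_add, LinearMap.add_apply, TensorProduct.tmul_add, hx, hy]
    | tmul c' d' =>
    rw [TensorProduct.AlgebraTensorModule.tensorTensorTensorComm_tmul, tsmash_tmul, tsmash_tmul,
      tsmash_tmul, lmulT_pairT, pairT_tcons, tmap_tcons]
    rfl

theorem pairT_hopfFace (a : H →ₐ[k] Module.End k V) (b : K →ₐ[k] Module.End k W) (n i : ℕ)
    (x : Ten k H V (n + 2)) (y : Ten k K W (n + 2)) :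
    pairT (n + 1) (hopfFace a n i x) (hopfFace b n i y) =
      hopfFace (SAYD.tensorAct a b) n i (pairT (n + 2) x y) := by
  simp only [hopfFace]
  split
  · exact pairT_mulFace _ _ _ _
  · simp only [LinearMap.comp_apply, pairT_mulFace, pairT_rot]

variable [HasBijectiveAntipode k H] [HasBijectiveAntipode k K]

theorem pairT_mem_cotensor {𝓜 : SAYD k H V} {𝓝 : SAYD k K W} {n : ℕ} {x : Ten k H V (n + 1)}
    {y : Ten k K W (n + 1)} (hx : x ∈ cotensor 𝓜 n) (hy : y ∈ cotensor 𝓝 n) :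
    pairT (n + 1) x y ∈ cotensor (𝓜.tensor 𝓝) n := by
  rw [mem_cotensor] at hx hy ⊢
  rw [coactT_pairT, hx, hy, pairT_tmap, TensorProduct.map_id, tmap_tmap]
  rfl

/-- The pairing of cyclic modules `C̃_*(H, M) × C̃_*(K, N) → C̃_*(H ⊗ K, M ⊗ N)`,
`(h₀ ⊗ ⋯ ⊗ h_n ⊗ m, g₀ ⊗ ⋯ ⊗ g_n ⊗ m') ↦ (h₀ ⊗ g₀) ⊗ ⋯ ⊗ (h_n ⊗ g_n) ⊗ (m ⊗ m')`. -/
def hopfPairing (𝓜 : SAYD k H V) (𝓝 : SAYD k K W) :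
    CyclicModule.Pairing (hopfCyclic 𝓜) (hopfCyclic 𝓝) (hopfCyclic (𝓜.tensor 𝓝)) where
  f n := LinearMap.mk₂ k
    (fun x y => ⟨pairT (n + 1) x.1 y.1, pairT_mem_cotensor x.2 y.2⟩)
    (fun x x' y => Subtype.ext (LinearMap.map_add₂ (pairT (n + 1)) x.1 x'.1 y.1))
    (fun c x y => Subtype.ext (LinearMap.map_smul₂ (pairT (n + 1)) c x.1 y.1))
    (fun x y y' => Subtype.ext (map_add (pairT (n + 1) x.1) y.1 y'.1))
    (fun c x y => Subtype.ext (map_smul (pairT (n + 1) x.1) c y.1))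
  f_d n i _ x y := Subtype.ext (pairT_hopfFace 𝓜.act 𝓝.act n i x.1 y.1)
  f_s n i _ x y := Subtype.ext (pairT_oneDeg n i x.1 y.1)
  f_t n x y := Subtype.ext (pairT_rot 𝓜.act 𝓝.act n x.1 y.1)

end Pairing

section HopfHC

variable {k H K M N : Type u} [Field k]
  [Ring H] [HopfAlgebra k H] [HasBijectiveAntipode k H]
  [Ring K] [HopfAlgebra k K] [HasBijectiveAntipode k K]
  [AddCommGroup M] [Module k M] [AddCommGroup N] [Module k N]

/-- The dual Hopf-cyclic homology `HC̃_n(H, M)`: the cyclic homology of the cyclic module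
`C̃_*(H, M)`. -/
abbrev HopfHC (𝓜 : SAYD k H M) (n : ℕ) : Type u := (hopfCyclic 𝓜).HC n

/-- The map `HC̃_n(H, M) → HC̃_n(K, N)` induced by a morphism `(H, M) → (K, N)`. -/
def HopfHC.map {𝓜 : SAYD k H M} {𝓝 : SAYD k K N} (φ : SAYD.Hom 𝓜 𝓝) (n : ℕ) :
    HopfHC 𝓜 n →ₗ[k] HopfHC 𝓝 n :=
  φ.toCyclic.mapHC n

/-- The map `HC̃_p(H, M) × HC̃_q(K, N) → HC̃_n(H ⊗ K, M ⊗ N)`, `n = p + q + 1`, induced by `⋆`. -/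
def HopfHC.star (𝓜 : SAYD k H M) (𝓝 : SAYD k K N) {p q n : ℕ} (_h : p + q + 1 = n) :
    HopfHC 𝓜 p →ₗ[k] HopfHC 𝓝 q →ₗ[k] HopfHC (𝓜.tensor 𝓝) n :=
  (hopfPairing 𝓜 𝓝).star p q n

/-- The exterior product `x • y = (-1)^{p+1} (x ⋆ y)` for `x` of degree `p + 1`, with the sign
that comes with an operation of degree one. -/
def HopfHC.prod (𝓜 : SAYD k H M) (𝓝 : SAYD k K N) {p q n : ℕ} (h : p + q + 1 = n) :
    HopfHC 𝓜 p →ₗ[k] HopfHC 𝓝 q →ₗ[k] HopfHC (𝓜.tensor 𝓝) n :=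
  (-1 : k) ^ (p + 1) • HopfHC.star 𝓜 𝓝 h

/-- The internal product of a commutative Hopf algebra `A` on `HC̃_*(A) = HC̃_*(A, k)`: the
exterior product followed by the map induced by the multiplication `A ⊗ A → A`. -/
def HopfHC.mul {A : Type u} [CommRing A] [HopfAlgebra k A] {p q n : ℕ} (h : p + q + 1 = n) :
    HopfHC (SAYD.trivialComm k A) p →ₗ[k] HopfHC (SAYD.trivialComm k A) q →ₗ[k]
      HopfHC (SAYD.trivialComm k A) n :=
  (HopfHC.prod (SAYD.trivialComm k A) (SAYD.trivialComm k A) h).compr₂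
    (HopfHC.map (SAYD.mulHom k A) n)

end HopfHC

end

noncomputable section

open TensorProduct

/-! Let D = b + B be the untruncated operator on the product of all terms of the normalized complex
(`dN`). The differential of Tot_p forgets the term B x_p in degree p + 1; hence x in Tot_p is a
cycle exactly when D x is concentrated in degree p + 1, where it equals B x_p
(`dN_eq_of_mem_cycles`). The theorem follows from an Eilenberg-Zilber formula for cyclic modules.
Let × be the shuffle product and ×' the cyclic shuffle product, which raises the total degree by
two, and put E(x, y) = x × y + (-1)^{|x|} x ×' y. Then, in the normalized complexes, D E(x, y) =
E(Dx, y) + (-1)^{|x|} E(x, Dy) (`dN_eilT`).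

The product Bx ×' y is degenerate, so x ⋆ y = E(Dx, y) for a cycle x (`starTot_eq_eilT`). Since D² =
0, D(x ⋆ y) = ±E(Dx, Dy), which for cycles lives in degree p + q + 2 only; so x ⋆ y is a cycle, and
the same computation deals with boundaries. Commutativity: D E(x, y) = x ⋆ y ± y ⋆ x, so E(x, y) is
the required homotopy (`starTot_comm`). Associativity: comparing top degrees gives B of the leading
term of x ⋆ y as ±Bx_p × By_q (`BN_starTot`), and both triple products become ±Bx_p × By_q × z on
the level of chains, by associativity of shuffles.

The formula for E splits into three statements: b is a derivation for × (`bge_shuf`); the boundary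
of ×' is x × By, Bx × y and B(x × y) with signs, up to ×' applied to bx or by (`bge_cyc`); and B(x
×' y), Bx ×' y, x ×' By are degenerate. The second one is combinatorial. View an element of degree p
as a path with vertices 0, …, p. Up to degenerate elements, Bx is the signed sum of the closed paths
a, …, p, 0, …, a (`bigB_eq_sum`). A shuffle is a lattice path, and x ×' y is the sum, over pairs of
closed paths, of those lattice paths in which the step p → 0 of x precedes the step q → 0 of y
(`cyc`). In the boundary of such a sum, the faces at corners of lattice paths cancel in pairs,
except at a corner formed by these two marked steps, where the other path of the pair is forbidden
(`bge_part`). There the diagonal (p, q) → (0, 0) is left, and the result is a closed path made from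
an ordinary shuffle: all of these together form B(x × y) (`sum_loop_shuf`). The end faces of the
closed paths telescope and leave x × By and Bx × y (`sum_loop_boundary`).

All of this holds for any pairing of cyclic modules over a commutative ring; Hopf algebras enter
only through the associativity and symmetry of `pairT`. -/

/-- The sign `(-1)^n` of an integer `n`, as an element of a commutative ring. -/
def sg (k : Type u) [CommRing k] (n : ℤ) : k := ((Int.negOnePow n : ℤ) : k)

/-! ### Signs with integer exponents -/

section Sign

variable (k : Type u) [CommRing k]

theorem sg_add (m n : ℤ) : sg k (m + n) = sg k m * sg k n := by
  simp [sg, Int.negOnePow_add]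

@[simp] theorem sg_zero : sg k 0 = 1 := by simp [sg]

@[simp] theorem sg_one : sg k 1 = -1 := by simp [sg]

theorem sg_neg (n : ℤ) : sg k (-n) = sg k n := by simp [sg]

theorem sg_sub (m n : ℤ) : sg k (m - n) = sg k m * sg k n := by
  rw [sub_eq_add_neg, sg_add, sg_neg]

theorem sg_succ (n : ℤ) : sg k (n + 1) = -sg k n := by simp [sg_add]

theorem sg_pred (n : ℤ) : sg k (n - 1) = -sg k n := by simp [sg_sub]

theorem sg_natCast (n : ℕ) : sg k n = (-1) ^ n := by
  induction n with
  | zero => simp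
  | succ n ih => rw [Nat.cast_succ, sg_succ, ih, pow_succ]; ring

theorem sg_mul_self (n : ℤ) : sg k n * sg k n = 1 := by
  rw [← sg_add]; simp [sg]

/-- All comparisons of signs below go through this: the witness that is supplied is half of the
difference of the exponents. -/
theorem sg_eq_of_even {m n : ℤ} (h : Even (m - n)) : sg k m = sg k n := by
  have : m = n + (m - n) := by ring
  rw [this, sg_add]
  have h1 : sg k (m - n) = 1 := by rw [sg, Int.negOnePow_even _ h]; simp
  rw [h1, mul_one]

end Sign

namespace CyclicModule

variable {k : Type u} [CommRing k]

/-! ### Faces, degeneracies and rotation on the product of all degrees -/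

section Total

variable (C : CyclicModule.{u, v} k)

/-- The product of all the modules of a cyclic module. -/
abbrev Total : Type v := ∀ n, C.X n

/-- The inverse `t⁻¹ = tⁿ` of the cyclic operator. -/
def r (n : ℕ) : C.X n →ₗ[k] C.X n := C.t n ^ n

theorem t_r (n : ℕ) (x : C.X n) : C.t n (C.r n x) = x := by
  have := C.t_pow n x
  rwa [pow_succ', Module.End.mul_apply] at this

theorem r_t (n : ℕ) (x : C.X n) : C.r n (C.t n x) = x := by
  have := C.t_pow n x
  rwa [pow_succ, Module.End.mul_apply] at this

theorem r_pow_succ (n : ℕ) (x : C.X n) : (C.r n ^ (n + 1)) x = x := by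
  have h : C.t n ^ (n + 1) = 1 := LinearMap.ext fun x => C.t_pow n x
  rw [r, ← pow_mul, mul_comm, pow_mul, h, one_pow]; rfl

theorem d_r (n i : ℕ) (h : i ≤ n) (x : C.X (n + 1)) :
    C.d n i (C.r (n + 1) x) = C.r n (C.d n (i + 1) x) := by
  have := C.d_t_succ n i h (C.r (n + 1) x)
  rw [t_r] at this
  rw [this, r_t]

theorem d_r_last (n : ℕ) (x : C.X (n + 1)) : C.d n (n + 1) (C.r (n + 1) x) = C.d n 0 x := by
  rw [← C.d_t_zero, t_r]

theorem s_r (n i : ℕ) (h : i < n) (x : C.X n) :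
    C.s n i (C.r n x) = C.r (n + 1) (C.s n (i + 1) x) := by
  have := C.s_t_succ n i h (C.r n x)
  rw [t_r] at this
  rw [this, r_t]

theorem r_r_s_zero (n : ℕ) (x : C.X n) :
    C.r (n + 1) (C.r (n + 1) (C.s n 0 x)) = C.s n n (C.r n x) := by
  have := C.s_t_zero n (C.r n x)
  rw [t_r] at this
  rw [this, r_t, r_t]

/-- The face `d_i` as an operator on `∏ n, X n`, lowering degrees by one. -/
def dOp (i : ℕ) : C.Total →ₗ[k] C.Total :=
  LinearMap.pi fun n => if i ≤ n + 1 then C.d n i ∘ₗ LinearMap.proj (n + 1) else 0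

/-- The inverse of the cyclic operator on `∏ n, X n`. -/
def rOp : C.Total →ₗ[k] C.Total := LinearMap.pi fun n => C.r n ∘ₗ LinearMap.proj n

/-- The alternating sum of the faces `d_i - d_{i+1} + ⋯`. -/
def bge (i : ℕ) : C.Total →ₗ[k] C.Total :=
  LinearMap.pi fun n => ∑ e ∈ Finset.range (n + 2 - i),
    (-1 : k) ^ e • C.d n (i + e) ∘ₗ LinearMap.proj (n + 1)

variable {C}

theorem dOp_apply (i : ℕ) (x : C.Total) (n : ℕ) :
    C.dOp i x n = if i ≤ n + 1 then C.d n i (x (n + 1)) else 0 := by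
  rw [dOp, LinearMap.pi_apply]; split <;> rfl

theorem sOp_apply_succ (i : ℕ) (x : C.Total) (n : ℕ) :
    C.sOp i x (n + 1) = if i ≤ n then C.s n i (x n) else 0 := by
  rw [sOp, LinearMap.pi_apply]; dsimp only; split <;> rfl

theorem sOp_apply_zero (i : ℕ) (x : C.Total) : C.sOp i x 0 = 0 := rfl

theorem rOp_apply (x : C.Total) (n : ℕ) : C.rOp x n = C.r n (x n) := rfl

theorem bge_apply (i : ℕ) (x : C.Total) (n : ℕ) :
    C.bge i x n = ∑ e ∈ Finset.range (n + 2 - i), (-1 : k) ^ e • C.d n (i + e) (x (n + 1)) := by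
  simp [bge, LinearMap.sum_apply]

theorem bge_zero_apply (x : C.Total) (n : ℕ) : C.bge 0 x n = C.b n (x (n + 1)) := by
  simp [bge_apply, b, LinearMap.sum_apply]

/-- Peeling off one face at a time is what matches `bge` with shuffles that start at position i:
only the faces from d_i on interact with them. -/
theorem bge_eq (i : ℕ) (x : C.Total) : C.bge i x = C.dOp i x - C.bge (i + 1) x := by
  funext n
  rw [Pi.sub_apply, bge_apply, bge_apply, dOp_apply]
  split
  · next h =>
    obtain ⟨m, hm⟩ : ∃ m, n + 2 - i = m + 1 := ⟨n + 1 - i, by omega⟩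
    have hm' : n + 2 - (i + 1) = m := by omega
    rw [hm, hm', Finset.sum_range_succ', add_comm, sub_eq_add_neg, ← Finset.sum_neg_distrib]
    congr 1
    · simp
    · refine Finset.sum_congr rfl fun e _ => ?_
      rw [pow_succ, mul_neg, mul_one, neg_smul, add_assoc i 1 e, add_comm 1 e]
  · next h =>
    have h1 : n + 2 - i = 0 := by omega
    have h2 : n + 2 - (i + 1) = 0 := by omega
    rw [h1, h2]; simp

theorem dOp_sOp_lt {i j : ℕ} (h : i ≤ j) (x : C.Total) :
    C.dOp i (C.sOp (j + 1) x) = C.sOp j (C.dOp i x) := by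
  funext n
  rcases n with _ | n
  · simp only [dOp_apply, sOp_apply_succ, sOp_apply_zero]
    rw [if_neg (by omega : ¬ j + 1 ≤ 0)]; simp
  · simp only [dOp_apply, sOp_apply_succ]
    by_cases hj : j ≤ n
    · rw [if_pos (by omega), if_pos (by omega), if_pos hj, if_pos (by omega),
        C.d_s_lt n i j h hj]
    · rw [if_neg (by omega : ¬ j + 1 ≤ n + 1), if_neg hj]; simp

theorem dOp_sOp_gt {i j : ℕ} (h : j < i) (x : C.Total) :
    C.dOp (i + 1) (C.sOp j x) = C.sOp j (C.dOp i x) := by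
  funext n
  rcases n with _ | n
  · simp only [dOp_apply, sOp_apply_zero]
    rw [if_neg (by omega)]
  · simp only [dOp_apply, sOp_apply_succ]
    by_cases hi : i ≤ n + 1
    · rw [if_pos (by omega), if_pos (by omega), if_pos (by omega), if_pos hi,
        C.d_s_gt n i j h hi]
    · rw [if_neg (by omega : ¬ i + 1 ≤ n + 1 + 1), if_neg hi]; simp

/-- The operator `sOp j` is zero in degrees below j, so this simplicial identity needs an element
supported in degrees at least j. -/
theorem dOp_sOp_self {j : ℕ} {x : C.Total} (hx : ∀ m < j, x m = 0) :
    C.dOp j (C.sOp j x) = x := by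
  funext n
  rw [dOp_apply, sOp_apply_succ]
  by_cases hj : j ≤ n
  · rw [if_pos (by omega), if_pos hj, C.d_s_self n j hj]
  · rw [if_neg hj, hx n (by omega)]; simp

theorem dOp_sOp_succ {j : ℕ} {x : C.Total} (hx : ∀ m < j, x m = 0) :
    C.dOp (j + 1) (C.sOp j x) = x := by
  funext n
  rw [dOp_apply, sOp_apply_succ]
  by_cases hj : j ≤ n
  · rw [if_pos (by omega), if_pos hj, C.d_s_succ n j hj]
  · rw [if_neg hj, hx n (by omega)]; simp

/-! ### Homogeneous elements -/

variable (C) in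
/-- The homogeneous elements of degree `n`. -/
def IsHomog (n : ℤ) (x : C.Total) : Prop := ∀ m : ℕ, (m : ℤ) ≠ n → x m = 0

theorem IsHomog.lt {n : ℤ} {x : C.Total} (hx : C.IsHomog n x) {j : ℕ} (h : (j : ℤ) ≤ n) :
    ∀ m < j, x m = 0 := fun m hm => hx m (by omega)

theorem IsHomog.eq_zero {n : ℤ} {x : C.Total} (hx : C.IsHomog n x) (h : n < 0) : x = 0 :=
  funext fun m => hx m (by omega)

theorem isHomog_single (n : ℕ) (x : C.X n) : C.IsHomog n (LinearMap.single k C.X n x) :=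
  fun m hm => Pi.single_eq_of_ne (by omega) x

theorem IsHomog.eq_single {n : ℕ} {x : C.Total} (hx : C.IsHomog n x) :
    x = LinearMap.single k C.X n (x n) := by
  funext m
  by_cases h : m = n
  · subst h; simp
  · rw [hx m (by omega)]
    exact (Pi.single_eq_of_ne h _).symm

theorem IsHomog.dOp {n : ℤ} {x : C.Total} (hx : C.IsHomog n x) (i : ℕ) :
    C.IsHomog (n - 1) (C.dOp i x) := fun m hm => by
  rw [dOp_apply, hx (m + 1) (by push_cast; omega)]; simp

theorem IsHomog.bge {n : ℤ} {x : C.Total} (hx : C.IsHomog n x) (i : ℕ) :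
    C.IsHomog (n - 1) (C.bge i x) := fun m hm => by
  rw [bge_apply, hx (m + 1) (by push_cast; omega)]; simp

theorem IsHomog.sOp {n : ℤ} {x : C.Total} (hx : C.IsHomog n x) (i : ℕ) :
    C.IsHomog (n + 1) (C.sOp i x) := fun m hm => by
  rcases m with _ | m
  · rfl
  · rw [sOp_apply_succ, hx m (by push_cast at hm; omega)]; simp

theorem IsHomog.rOp {n : ℤ} {x : C.Total} (hx : C.IsHomog n x) : C.IsHomog n (C.rOp x) :=
  fun m hm => by rw [rOp_apply, hx m hm, map_zero]

theorem IsHomog.add {n : ℤ} {x y : C.Total} (hx : C.IsHomog n x) (hy : C.IsHomog n y) :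
    C.IsHomog n (x + y) := fun m hm => by rw [Pi.add_apply, hx m hm, hy m hm, add_zero]

theorem IsHomog.smul {n : ℤ} {x : C.Total} (hx : C.IsHomog n x) (c : k) :
    C.IsHomog n (c • x) := fun m hm => by rw [Pi.smul_apply, hx m hm, smul_zero]

theorem IsHomog.sum {ι : Type*} {n : ℤ} {s : Finset ι} {f : ι → C.Total}
    (h : ∀ i ∈ s, C.IsHomog n (f i)) : C.IsHomog n (∑ i ∈ s, f i) := fun m hm => by
  rw [Finset.sum_apply]; exact Finset.sum_eq_zero fun i hi => h i hi m hm

theorem IsHomog.zero (n : ℤ) : C.IsHomog n 0 := fun _ _ => rfl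

/-- In degree i the face d_i is the last one. -/
theorem bge_of_isHomog {i : ℕ} {x : C.Total} (hx : C.IsHomog i x) : C.bge i x = C.dOp i x := by
  rw [bge_eq]
  suffices C.bge (i + 1) x = 0 by rw [this, sub_zero]
  funext m
  rw [bge_apply]
  by_cases h : m + 1 = i
  · subst h
    have : m + 2 - (m + 1 + 1) = 0 := by omega
    rw [this]; simp
  · rw [hx (m + 1) (by omega)]; simp

/-- The face d_{i+1} undoes s_i, and every higher face passes s_i with its index lowered by one,
which turns the alternating sum into minus itself. -/
theorem bge_succ_sOp {i : ℕ} {x : C.Total} (hx : ∀ m < i, x m = 0) :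
    C.bge (i + 1) (C.sOp i x) = x - C.sOp i (C.bge (i + 1) x) := by
  rw [bge_eq, dOp_sOp_succ hx]
  congr 1
  funext n
  rcases n with _ | n
  · rw [sOp_apply_zero, bge_apply]
    have : 0 + 2 - (i + 1 + 1) = 0 := by omega
    rw [this]; simp
  · rw [bge_apply, sOp_apply_succ i (C.bge (i + 1) x)]
    by_cases h : i ≤ n
    · rw [if_pos h, bge_apply, map_sum]
      have : n + 1 + 2 - (i + 1 + 1) = n + 2 - (i + 1) := by omega
      rw [this]
      refine Finset.sum_congr rfl fun e he => ?_
      have he' := Finset.mem_range.1 he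
      rw [map_smul, sOp_apply_succ, if_pos (by omega),
        show i + 1 + 1 + e = i + 1 + e + 1 by omega,
        C.d_s_gt n (i + 1 + e) i (by omega) (by omega)]
    · have : n + 1 + 2 - (i + 1 + 1) = 0 := by omega
      rw [this, if_neg h]; simp

/-- The alternating sum of the `r` faces `d_i, …, d_{i+r-1}`. -/
def lo (C : CyclicModule.{u, v} k) (i r : ℕ) : C.Total →ₗ[k] C.Total :=
  ∑ e ∈ Finset.range r, (-1 : k) ^ e • C.dOp (i + e)

/-- The alternating sum of the faces from `d_{i+r}` on, with the signs of `bge i`. -/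
def hi (C : CyclicModule.{u, v} k) (i r : ℕ) : C.Total →ₗ[k] C.Total := C.bge i - C.lo i r

theorem lo_zero (i : ℕ) (x : C.Total) : C.lo i 0 x = 0 := by simp [lo]

theorem lo_succ (i r : ℕ) (x : C.Total) : C.lo i (r + 1) x = C.dOp i x - C.lo (i + 1) r x := by
  simp only [lo, LinearMap.sum_apply, LinearMap.smul_apply]
  rw [Finset.sum_range_succ', add_comm, sub_eq_add_neg, ← Finset.sum_neg_distrib]
  congr 1
  · simp
  · refine Finset.sum_congr rfl fun e _ => ?_
    rw [pow_succ, mul_neg, mul_one, neg_smul, add_assoc i 1 e, add_comm 1 e]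

theorem hi_zero (i : ℕ) (x : C.Total) : C.hi i 0 x = C.bge i x := by
  rw [hi, LinearMap.sub_apply, lo_zero, sub_zero]

theorem hi_succ (i r : ℕ) (x : C.Total) : C.hi i (r + 1) x = -C.hi (i + 1) r x := by
  rw [hi, hi, LinearMap.sub_apply, LinearMap.sub_apply, lo_succ, bge_eq]; abel

/-- The argument is that of `bge_succ_sOp`; here the window of faces is finite, and it loses one
face because d_{i+1} is used up by s_i. -/
theorem lo_succ_sOp {i : ℕ} (r : ℕ) {x : C.Total} (hx : ∀ m < i, x m = 0) :
    C.lo (i + 1) (r + 1) (C.sOp i x) = x - C.sOp i (C.lo (i + 1) r x) := by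
  rw [lo_succ, dOp_sOp_succ hx]
  congr 1
  simp only [lo, LinearMap.sum_apply, LinearMap.smul_apply, map_sum, map_smul]
  refine Finset.sum_congr rfl fun e _ => ?_
  rw [show i + 1 + 1 + e = i + 1 + e + 1 by omega, dOp_sOp_gt (by omega)]

theorem hi_succ_sOp {i : ℕ} (r : ℕ) {x : C.Total} (hx : ∀ m < i, x m = 0) :
    C.hi (i + 1) (r + 1) (C.sOp i x) = -C.sOp i (C.hi (i + 1) r x) := by
  rw [hi, hi, LinearMap.sub_apply, LinearMap.sub_apply, lo_succ_sOp r hx, bge_succ_sOp hx,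
    map_sub]
  abel

end Total

/-! ### Recursive shuffles and partial shuffles -/

section Shuf

variable {C C' : CyclicModule.{u, v} k} {M : Type w} [AddCommGroup M] [Module k M]

/-- Shuffles of `p` and `q` steps, starting at position `i` and followed by the bilinear map `κ`,
for natural numbers `p` and `q`. -/
def shufN (κ : C.Total →ₗ[k] C'.Total →ₗ[k] M) :
    ℕ → ℕ → ℕ → (C.Total →ₗ[k] C'.Total →ₗ[k] M)
  | 0, 0, _ => κ
  | p + 1, 0, i => (shufN κ p 0 (i + 1)).compl₂ (C'.sOp i)
  | 0, q + 1, i => (shufN κ 0 q (i + 1)) ∘ₗ C.sOp i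
  | p + 1, q + 1, i => (shufN κ p (q + 1) (i + 1)).compl₂ (C'.sOp i) +
      sg k ((p + 1 : ℕ) : ℤ) • (shufN κ (p + 1) q (i + 1)) ∘ₗ C.sOp i

/-- Shuffles of `p` and `q` steps, starting at position `i` and followed by the bilinear map `κ`;
it is zero if `p` or `q` is negative. -/
def shuf (κ : C.Total →ₗ[k] C'.Total →ₗ[k] M) (p q : ℤ) (i : ℕ) :
    C.Total →ₗ[k] C'.Total →ₗ[k] M :=
  if p < 0 ∨ q < 0 then 0 else shufN κ p.toNat q.toNat i

variable (κ : C.Total →ₗ[k] C'.Total →ₗ[k] M)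

theorem shuf_neg_left {p : ℤ} (q : ℤ) (i : ℕ) (h : p < 0) : shuf κ p q i = 0 :=
  if_pos (Or.inl h)

theorem shuf_neg_right (p : ℤ) {q : ℤ} (i : ℕ) (h : q < 0) : shuf κ p q i = 0 :=
  if_pos (Or.inr h)

theorem shuf_natCast (p q i : ℕ) : shuf κ p q i = shufN κ p q i := by
  rw [shuf, if_neg (by omega)]; simp

theorem shuf_zero (i : ℕ) : shuf κ 0 0 i = κ := by
  rw [shuf, if_neg (by omega), Int.toNat_zero, shufN]

/-- A shuffle is determined by its first step: one of the first kind puts s_i on y, one of the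
second kind puts s_i on x and passes the p steps of the first kind, whence the sign. Extending by
zero to negative p, q makes this one recursion valid everywhere except at (0, 0). -/
theorem shuf_rec {p q : ℤ} (i : ℕ) (h : ¬(p = 0 ∧ q = 0)) (x : C.Total) (y : C'.Total) :
    shuf κ p q i x y = shuf κ (p - 1) q (i + 1) x (C'.sOp i y) +
      sg k p • shuf κ p (q - 1) (i + 1) (C.sOp i x) y := by
  rcases lt_or_ge p 0 with hp | hp
  · simp [shuf_neg_left _ _ _ hp, shuf_neg_left _ _ _ (show p - 1 < 0 by omega)]
  rcases lt_or_ge q 0 with hq | hq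
  · simp [shuf_neg_right _ _ _ hq, shuf_neg_right _ _ _ (show q - 1 < 0 by omega)]
  lift p to ℕ using hp
  lift q to ℕ using hq
  rcases p with _ | p <;> rcases q with _ | q
  · exact absurd ⟨rfl, rfl⟩ h
  · rw [shuf_neg_left _ _ _ (show ((0 : ℕ) : ℤ) - 1 < 0 by simp), show ((q + 1 : ℕ) : ℤ) - 1 = q by push_cast; ring,
      shuf_natCast, shuf_natCast]
    simp [shufN]
  · rw [shuf_neg_right _ _ _ (show ((0 : ℕ) : ℤ) - 1 < 0 by simp),
      show ((p + 1 : ℕ) : ℤ) - 1 = p by push_cast; ring, shuf_natCast, shuf_natCast]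
    simp [shufN]
  · rw [show ((q + 1 : ℕ) : ℤ) - 1 = q by push_cast; ring,
      show ((p + 1 : ℕ) : ℤ) - 1 = p by push_cast; ring, shuf_natCast, shuf_natCast, shuf_natCast]
    simp [shufN]

/-- Induction on p + q along the recursion of `shuf`; the pairs with a negative entry are base
cases, where `shuf` vanishes. -/
theorem int_pair_induction {P : ℤ → ℤ → Prop} (negL : ∀ p q, p < 0 → P p q)
    (negR : ∀ p q, q < 0 → P p q) (zero : P 0 0)
    (step : ∀ p q, 0 ≤ p → 0 ≤ q → ¬(p = 0 ∧ q = 0) → P (p - 1) q → P p (q - 1) → P p q)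
    (p q : ℤ) : P p q := by
  suffices h : ∀ n : ℕ, ∀ p q : ℤ, p + q < (n : ℤ) → P p q from
    h (p + q + 1).toNat p q (by omega)
  intro n
  induction n with
  | zero =>
    intro p q h
    rcases lt_or_ge p 0 with hp | hp
    · exact negL p q hp
    · exact negR p q (by push_cast at h; omega)
  | succ n ih =>
    intro p q h
    rcases lt_or_ge p 0 with hp | hp
    · exact negL p q hp
    rcases lt_or_ge q 0 with hq | hq
    · exact negR p q hq
    by_cases h0 : p = 0 ∧ q = 0
    · rw [h0.1, h0.2]; exact zero
    · exact step p q hp hq h0 (ih _ _ (by push_cast at h; omega)) (ih _ _ (by push_cast at h; omega))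

/-- Partial shuffles: those shuffles of `p` and `q` steps for which the `r`-th step of the first
kind precedes the `s`-th step of the second kind. For `r = 0` there is no condition. -/
def part (κ : C.Total →ₗ[k] C'.Total →ₗ[k] M) :
    ℕ → ℕ → ℤ → ℤ → ℕ → (C.Total →ₗ[k] C'.Total →ₗ[k] M)
  | 0, _, p, q, i => shuf κ p q i
  | _ + 1, 0, _, _, _ => 0
  | r + 1, s + 1, p, q, i => (part κ r (s + 1) (p - 1) q (i + 1)).compl₂ (C'.sOp i) +
      sg k p • (part κ (r + 1) s p (q - 1) (i + 1)) ∘ₗ C.sOp i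

theorem part_zero_left (s : ℕ) (p q : ℤ) (i : ℕ) : part κ 0 s p q i = shuf κ p q i := by
  rw [part]

theorem part_zero_right (r : ℕ) (p q : ℤ) (i : ℕ) : part κ (r + 1) 0 p q i = 0 := by
  rw [part]

theorem part_rec (r s : ℕ) (p q : ℤ) (i : ℕ) (x : C.Total) (y : C'.Total) :
    part κ (r + 1) (s + 1) p q i x y = part κ r (s + 1) (p - 1) q (i + 1) x (C'.sOp i y) +
      sg k p • part κ (r + 1) s p (q - 1) (i + 1) (C.sOp i x) y := by
  rw [part]; rfl

/-- There is no r-th step of the first kind, so it cannot precede anything. This is one of the end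
values of the telescoping sums in `bge_cyc`. -/
theorem part_of_lt (r s : ℕ) (p q : ℤ) (i : ℕ) (h : p < r) (x : C.Total) (y : C'.Total) :
    part κ r s p q i x y = 0 := by
  fun_induction part κ r s p q i generalizing x y with
  | case1 s p q i => rw [shuf_neg_left _ _ _ (by simpa using h)]; rfl
  | case2 => rfl
  | case3 r s p q i ih1 ih2 =>
    change part κ r (s + 1) (p - 1) q (i + 1) x (C'.sOp i y) +
      sg k p • part κ (r + 1) s p (q - 1) (i + 1) (C.sOp i x) y = 0
    rw [ih1 (by push_cast at h; omega), ih2 h, smul_zero, add_zero]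

/-- There is no (q+1)-st step of the second kind, so the condition is void. This is the other
non-trivial end value in `bge_cyc`. -/
theorem part_eq_shuf (r s : ℕ) (p q : ℤ) (i : ℕ) (h : r ≤ p) (hs : (s : ℤ) = q + 1)
    (x : C.Total) (y : C'.Total) :
    part κ r s p q i x y = shuf κ p q i x y := by
  fun_induction part κ r s p q i generalizing x y with
  | case1 s p q i => rfl
  | case2 r p q i => rw [shuf_neg_right _ _ _ (by simp only [Nat.cast_zero] at hs; omega)]
  | case3 r s p q i ih1 ih2 =>
    change part κ r (s + 1) (p - 1) q (i + 1) x (C'.sOp i y) +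
      sg k p • part κ (r + 1) s p (q - 1) (i + 1) (C.sOp i x) y = _
    rw [ih1 (by simp only [Nat.succ_eq_add_one] at h; push_cast at h; omega) hs,
      ih2 h (by simp only [Nat.succ_eq_add_one] at hs; push_cast at hs; omega)]
    exact (shuf_rec κ i (by simp only [Nat.succ_eq_add_one] at h; push_cast at h; omega) x y).symm

theorem IsHomog.natLe {D : CyclicModule.{u, w} k} {i : ℕ} {p : ℤ} {x : D.Total}
    (hx : D.IsHomog (i + p) x) (hp : 0 ≤ p) : ∀ m < i, x m = 0 := hx.lt (by omega)

theorem IsHomog.cast {D : CyclicModule.{u, w} k} {m n : ℤ} {x : D.Total} (hx : D.IsHomog m x)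
    (h : m = n) : D.IsHomog n x := h ▸ hx

end Shuf

/-! ### Boundaries of shuffles and of partial shuffles -/

section Boundary

variable {C C' : CyclicModule.{u, v} k} {D : CyclicModule.{u, w} k} (ω : Pairing C C' D)

/-- The pairing on the product of all degrees. -/
def Pairing.tot : C.Total →ₗ[k] C'.Total →ₗ[k] D.Total :=
  LinearMap.mk₂ k (fun x y n => ω.f n (x n) (y n))
    (fun x x' y => by funext n; simp) (fun c x y => by funext n; simp)
    (fun x y y' => by funext n; simp) (fun c x y => by funext n; simp)

theorem tot_apply (x : C.Total) (y : C'.Total) (n : ℕ) :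
    ω.tot x y n = ω.f n (x n) (y n) := rfl

theorem dOp_tot (i : ℕ) (x : C.Total) (y : C'.Total) :
    D.dOp i (ω.tot x y) = ω.tot (C.dOp i x) (C'.dOp i y) := by
  funext n
  simp only [dOp_apply, tot_apply]
  split
  · next h => rw [ω.f_d n i h]
  · simp

theorem sOp_tot (i : ℕ) (x : C.Total) (y : C'.Total) :
    D.sOp i (ω.tot x y) = ω.tot (C.sOp i x) (C'.sOp i y) := by
  funext n
  rcases n with _ | n
  · simp [tot_apply, sOp_apply_zero]
  · simp only [sOp_apply_succ, tot_apply]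
    split
    · next h => rw [ω.f_s n i h]
    · simp

theorem rOp_tot (x : C.Total) (y : C'.Total) :
    D.rOp (ω.tot x y) = ω.tot (C.rOp x) (C'.rOp y) := by
  funext n
  simp only [rOp_apply, tot_apply, r]
  have h : ∀ j, (D.t n ^ j) (ω.f n (x n) (y n)) = ω.f n ((C.t n ^ j) (x n)) ((C'.t n ^ j) (y n)) := by
    intro j
    induction j with
    | zero => rfl
    | succ j ih => simp only [pow_succ', Module.End.mul_apply, ih, ω.f_t]
  exact h n

theorem IsHomog.tot {n : ℤ} {x : C.Total} (hx : C.IsHomog n x) (y : C'.Total) :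
    D.IsHomog n (ω.tot x y) := fun m hm => by
  rw [tot_apply, hx m hm, map_zero, LinearMap.zero_apply]

theorem shuf_isHomog {n : ℤ} (p q : ℤ) (i : ℕ) (x : C.Total) (y : C'.Total)
    (hx : C.IsHomog (n - q) x) : D.IsHomog n (shuf ω.tot p q i x y) := by
  induction p, q using int_pair_induction generalizing i x y with
  | negL p q hlt => rw [shuf_neg_left _ _ _ hlt]; exact IsHomog.zero _
  | negR p q hlt => rw [shuf_neg_right _ _ _ hlt]; exact IsHomog.zero _
  | zero => rw [shuf_zero]; exact (hx.cast (by ring)).tot ω y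
  | step p q hp hq h ih1 ih2 =>
    rw [shuf_rec _ _ h]
    exact (ih1 _ _ _ hx).add ((ih2 _ _ _ ((hx.sOp i).cast (by ring))).smul _)

theorem part_isHomog {n : ℤ} (r s : ℕ) (p q : ℤ) (i : ℕ) (x : C.Total) (y : C'.Total)
    (hx : C.IsHomog (n - q) x) : D.IsHomog n (part ω.tot r s p q i x y) := by
  fun_induction part ω.tot r s p q i generalizing x y with
  | case1 s p q i => exact shuf_isHomog ω p q i x y hx
  | case2 => exact IsHomog.zero _
  | case3 r s p q i ih1 ih2 =>
    exact (ih1 _ _ hx).add ((ih2 _ _ ((hx.sOp i).cast (by ring))).smul _)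

/-- Low faces commute with shuffles. -/
theorem dOp_shuf {e : ℕ} (p q : ℤ) (i : ℕ) (h : e ≤ i) (x : C.Total) (y : C'.Total) :
    D.dOp e (shuf ω.tot p q (i + 1) x y) = shuf ω.tot p q i (C.dOp e x) (C'.dOp e y) := by
  induction p, q using int_pair_induction generalizing i x y with
  | negL p q hlt => simp [shuf_neg_left _ _ _ hlt]
  | negR p q hlt => simp [shuf_neg_right _ _ _ hlt]
  | zero => rw [shuf_zero, shuf_zero, dOp_tot]
  | step p q hp hq hpq ih1 ih2 =>
    rw [shuf_rec _ _ hpq, shuf_rec _ _ hpq, map_add, map_smul, ih1 _ (by omega),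
      ih2 _ (by omega), dOp_sOp_lt h, dOp_sOp_lt h]

theorem dOp_part {e : ℕ} (r s : ℕ) (p q : ℤ) (i : ℕ) (h : e ≤ i) (x : C.Total) (y : C'.Total) :
    D.dOp e (part ω.tot r s p q (i + 1) x y) =
      part ω.tot r s p q i (C.dOp e x) (C'.dOp e y) := by
  fun_induction part ω.tot r s p q i generalizing x y with
  | case1 s p q i => rw [part_zero_left, dOp_shuf ω _ _ _ h]
  | case2 => simp [part_zero_right]
  | case3 r s p q i ih1 ih2 =>
    rw [part_rec, map_add, map_smul, ih1 (by omega), ih2 (by omega), dOp_sOp_lt h, dOp_sOp_lt h]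
    rfl

/-- A degeneracy common to both factors, at a place before the shuffle begins, only shifts the start
of the shuffle by one. -/
theorem sOp_shuf {e : ℕ} (p q : ℤ) (i : ℕ) (h : e ≤ i) (x : C.Total) (y : C'.Total) :
    shuf ω.tot p q (i + 1) (C.sOp e x) (C'.sOp e y) = D.sOp e (shuf ω.tot p q i x y) := by
  induction p, q using int_pair_induction generalizing i x y with
  | negL p q hlt => simp [shuf_neg_left _ _ _ hlt]
  | negR p q hlt => simp [shuf_neg_right _ _ _ hlt]
  | zero => rw [shuf_zero, shuf_zero, sOp_tot]
  | step p q hp hq hpq ih1 ih2 =>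
    rw [shuf_rec _ _ hpq, shuf_rec _ _ hpq, map_add, map_smul, ← ih1 _ (by omega),
      ← ih2 _ (by omega), C.sOp_sOp h, C'.sOp_sOp h]

theorem sOp_part {e : ℕ} (r s : ℕ) (p q : ℤ) (i : ℕ) (h : e ≤ i) (x : C.Total) (y : C'.Total) :
    part ω.tot r s p q (i + 1) (C.sOp e x) (C'.sOp e y) =
      D.sOp e (part ω.tot r s p q i x y) := by
  fun_induction part ω.tot r s p q i generalizing x y with
  | case1 s p q i => rw [part_zero_left, sOp_shuf ω _ _ _ h]
  | case2 => simp [part_zero_right]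
  | case3 r s p q i ih1 ih2 =>
    rw [part_rec, ← C.sOp_sOp h, ← C'.sOp_sOp h, ih1 (by omega), ih2 (by omega), ← map_smul,
      ← map_add]
    rfl

/-- The boundary of the shuffle product. -/
theorem bge_shuf {p q : ℤ} (i : ℕ) (h : ¬(p = 0 ∧ q = 0)) {x : C.Total} {y : C'.Total}
    (hx : C.IsHomog (i + p) x) (hy : C'.IsHomog (i + q) y) :
    D.bge i (shuf ω.tot p q i x y) = shuf ω.tot (p - 1) q i (C.bge i x) y +
      sg k p • shuf ω.tot p (q - 1) i x (C'.bge i y) := by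
  induction p, q using int_pair_induction generalizing i x y with
  | negL p q hlt => simp [shuf_neg_left _ _ _ hlt, shuf_neg_left _ _ _ (show p - 1 < 0 by omega)]
  | negR p q hlt => simp [shuf_neg_right _ _ _ hlt, shuf_neg_right _ _ _ (show q - 1 < 0 by omega)]
  | zero => simp at h
  | step p q hp hq hpq ih1 ih2 =>
    have hx0 := hx.natLe hp
    have hy0 := hy.natLe hq
    -- With a single step the rest of the shuffle has type (0, 0), to which the induction hypothesis
    -- does not apply. It is homogeneous of degree i + 1, so that only d_i and d_{i+1} occur.
    by_cases h1 : p = 1 ∧ q = 0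
    · obtain ⟨rfl, rfl⟩ := h1
      rw [shuf_rec _ _ hpq, shuf_neg_right _ _ _ (show (0 : ℤ) - 1 < 0 by omega),
        shuf_neg_right _ _ _ (show (0 : ℤ) - 1 < 0 by omega), show (1 : ℤ) - 1 = 0 by ring,
        shuf_zero, shuf_zero]
      simp only [LinearMap.zero_apply, smul_zero, add_zero]
      rw [bge_eq, bge_of_isHomog (i := i + 1) (hx.tot ω _ |>.cast (by push_cast; ring)), dOp_tot,
        dOp_tot, dOp_sOp_self hy0, dOp_sOp_succ hy0, bge_eq,
        bge_of_isHomog (i := i + 1) (hx.cast (by push_cast; ring)), map_sub, LinearMap.sub_apply]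
    by_cases h2 : p = 0 ∧ q = 1
    · obtain ⟨rfl, rfl⟩ := h2
      rw [shuf_rec _ _ hpq, shuf_neg_left _ _ _ (show (0 : ℤ) - 1 < 0 by omega),
        shuf_neg_left _ _ _ (show (0 : ℤ) - 1 < 0 by omega), show (1 : ℤ) - 1 = 0 by ring,
        shuf_zero, shuf_zero]
      simp only [LinearMap.zero_apply, zero_add, sg_zero, one_smul]
      rw [bge_eq, bge_of_isHomog (i := i + 1) ((hx.sOp i).tot ω _ |>.cast (by push_cast; ring)),
        dOp_tot, dOp_tot, dOp_sOp_self hx0, dOp_sOp_succ hx0, bge_eq i y,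
        bge_of_isHomog (i := i + 1) (hy.cast (by push_cast; ring)), map_sub]
    have e1 := ih1 (i + 1) (by omega) (hx.cast (by push_cast; ring))
      ((hy.sOp i).cast (by push_cast; ring))
    have e2 := ih2 (i + 1) (by omega) ((hx.sOp i).cast (by push_cast; ring))
      (hy.cast (by push_cast; ring))
    -- The face d_i commutes with the rest of the shuffle and undoes the first degeneracy. From
    -- `bge_succ_sOp` each of the two summands acquires a term in (p - 1, q - 1) without any s_i,
    -- coming from two initial steps of different kinds; these two terms have opposite signs and
    -- cancel.
    rw [shuf_rec _ _ hpq, map_add, map_smul, bge_eq, bge_eq i (shuf _ p _ _ _ _), e1, e2,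
      dOp_shuf ω _ _ _ le_rfl, dOp_shuf ω _ _ _ le_rfl, dOp_sOp_self hx0, dOp_sOp_self hy0,
      bge_succ_sOp hx0, bge_succ_sOp hy0, bge_eq i x, bge_eq i y, map_sub (shuf ω.tot (p - 1) q i),
      map_sub (shuf ω.tot p (q - 1) i x), LinearMap.sub_apply,
      shuf_rec _ _ (show ¬(p - 1 = 0 ∧ q = 0) by omega) (C.bge (i + 1) x),
      shuf_rec _ _ (show ¬(p = 0 ∧ q - 1 = 0) by omega) x (C'.bge (i + 1) y)]
    simp only [map_sub, LinearMap.sub_apply, smul_sub, smul_add, smul_smul, sg_pred, neg_mul,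
      mul_neg, neg_smul]
    abel

set_option maxHeartbeats 1000000 in
/-- The boundary of the partial shuffle product. -/
theorem bge_part (r s : ℕ) {p q : ℤ} (i : ℕ) (hr : (r : ℤ) + 1 ≤ p) (hs : (s : ℤ) + 1 ≤ q)
    {x : C.Total} {y : C'.Total} (hx : C.IsHomog (i + p) x) (hy : C'.IsHomog (i + q) y) :
    D.bge i (part ω.tot (r + 1) (s + 1) p q i x y) =
      part ω.tot r (s + 1) (p - 1) q i (C.lo i (r + 1) x) y +
      part ω.tot (r + 1) (s + 1) (p - 1) q i (C.hi i (r + 1) x) y +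
      sg k p • (part ω.tot (r + 1) s p (q - 1) i x (C'.lo i (s + 1) y) +
        part ω.tot (r + 1) (s + 1) p (q - 1) i x (C'.hi i (s + 1) y)) +
      sg k (p + s + (p - r) * s) •
        shuf (shuf ω.tot (p - r - 1) (q - s - 1) (i + r + s + 1)) r s i x y := by
  -- The last summand consists of the paths which take r and s steps, then the diagonal, then the
  -- remaining steps. Its inner lengths p', q', its inner start j and its sign c are variables tied
  -- by equations, so that both induction hypotheses yield the inner shuffle in literally the same
  -- form.
  have key : ∀ n : ℕ, ∀ (r s : ℕ) {p q p' q' : ℤ} (i j : ℕ) (c : k) {x : C.Total} {y : C'.Total},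
      r + s = n → (r : ℤ) + 1 ≤ p → (s : ℤ) + 1 ≤ q → C.IsHomog (i + p) x →
      C'.IsHomog (i + q) y → j = i + r + s + 1 → p' = p - r - 1 → q' = q - s - 1 →
      sg k (p + s + (p - r) * s) = c →
      D.bge i (part ω.tot (r + 1) (s + 1) p q i x y) =
      part ω.tot r (s + 1) (p - 1) q i (C.lo i (r + 1) x) y +
      part ω.tot (r + 1) (s + 1) (p - 1) q i (C.hi i (r + 1) x) y +
      sg k p • (part ω.tot (r + 1) s p (q - 1) i x (C'.lo i (s + 1) y) +
        part ω.tot (r + 1) (s + 1) p (q - 1) i x (C'.hi i (s + 1) y)) +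
      c • shuf (shuf ω.tot p' q' j) r s i x y := by
    intro n
    induction n with
    | zero =>
      intro r s p q p' q' i j c x y hn hr hs hx hy hj hp' hq' hc
      -- Here the first step must be of the first kind, and the rest is an unrestricted shuffle. The
      -- diagonal term of `bge_shuf` for steps of different kinds at the start has no partner, since
      -- the opposite order is forbidden.
      obtain ⟨rfl, rfl⟩ : r = 0 ∧ s = 0 := by omega
      subst hj hc hp' hq'
      have hx0 := hx.natLe (by omega)
      have hy0 := hy.natLe (by omega)
      have hx1 : C.IsHomog ((i + 1 : ℕ) + (p - 1)) x := hx.cast (by push_cast; ring)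
      have hy1 : C'.IsHomog ((i + 1 : ℕ) + q) (C'.sOp i y) :=
        (hy.sOp i).cast (by push_cast; ring)
      simp only [part_rec, part_zero_left, part_zero_right, LinearMap.zero_apply, smul_zero,
        add_zero]
      rw [bge_eq, dOp_shuf ω _ _ _ le_rfl, dOp_sOp_self hy0,
        bge_shuf ω (i + 1) (by omega) hx1 hy1, lo_succ, lo_zero, hi_succ, hi_succ, hi_zero,
        hi_zero, bge_succ_sOp hy0]
      simp only [map_sub, map_neg, LinearMap.sub_apply, LinearMap.neg_apply, smul_sub, sg_pred,
        neg_smul, smul_neg, sub_zero, Nat.cast_zero, mul_zero, add_zero, zero_add, shuf_zero]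
      abel
    | succ n ih =>
      intro r s p q p' q' i j c x y hn hr hs hx hy hj hp' hq' hc
      have hx0 := hx.natLe (by omega)
      have hy0 := hy.natLe (by omega)
      have hx1 : C.IsHomog ((i + 1 : ℕ) + (p - 1)) x := hx.cast (by push_cast; ring)
      have hy1 : C'.IsHomog ((i + 1 : ℕ) + q) (C'.sOp i y) :=
        (hy.sOp i).cast (by push_cast; ring)
      have hx2 : C.IsHomog ((i + 1 : ℕ) + p) (C.sOp i x) :=
        (hx.sOp i).cast (by push_cast; ring)
      have hy2 : C'.IsHomog ((i + 1 : ℕ) + (q - 1)) y := hy.cast (by push_cast; ring)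
      have hby : ∀ m, C'.bge (i + 1) y = C'.lo (i + 1) m y + C'.hi (i + 1) m y := fun m => by
        rw [CyclicModule.hi, LinearMap.sub_apply]; abel
      -- When r or s is zero one of the two summands of the recursion is an unrestricted shuffle,
      -- respectively zero, and the induction hypothesis is replaced by `bge_shuf` or is absent.
      rcases r with _ | r <;> rcases s with _ | s
      · omega
      · have e2 := ih 0 s (p' := p') (q' := q') (i + 1) j (-sg k p * c) (by omega) hr
          (by push_cast at hs ⊢; omega) hx2 hy2 (by omega) hp' (by push_cast at hq'; omega)
          (by
            rw [← hc, neg_mul, ← sg_add, ← sg_succ]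
            refine sg_eq_of_even _ ⟨-p - 1, ?_⟩
            push_cast; ring)
        rw [part_rec, map_add, map_smul, bge_eq, bge_eq i (part _ _ (s + 1) _ _ _ _ _), e2]
        simp only [part_zero_left]
        rw [dOp_shuf ω _ _ _ le_rfl, dOp_part ω _ _ _ _ _ le_rfl,
          bge_shuf ω (i + 1) (by omega) hx1 hy1, dOp_sOp_self hx0, dOp_sOp_self hy0,
          shuf_rec _ i (show ¬(((0 : ℕ) : ℤ) = 0 ∧ ((s + 1 : ℕ) : ℤ) = 0) by push_cast; omega),
          shuf_neg_left _ _ _ (show ((0 : ℕ) : ℤ) - 1 < 0 by simp),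
          show ((s + 1 : ℕ) : ℤ) - 1 = s by push_cast; ring, lo_succ_sOp _ hx0, hi_succ_sOp _ hx0,
          lo_zero, hi_zero, bge_succ_sOp hy0, lo_succ i, lo_succ i, lo_zero, hi_succ i, hi_succ i,
          hi_zero, hby (s + 1)]
        simp only [part_rec ω.tot 0 (s + 1) (p - 1) q i, part_rec ω.tot 0 s p (q - 1) i,
          part_rec ω.tot 0 (s + 1) p (q - 1) i,
          part_zero_left]
        simp only [map_sub, map_add, map_neg, map_zero, LinearMap.sub_apply, LinearMap.neg_apply,
          LinearMap.add_apply, LinearMap.zero_apply, smul_sub, smul_add, smul_neg, smul_smul,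
          neg_smul, sg_pred, neg_mul, mul_neg, ← mul_assoc, sg_mul_self, one_mul, one_smul, sg_zero,
          sub_zero, zero_add, mul_one, Nat.cast_zero, add_zero, smul_zero, neg_neg, neg_zero]
        abel
      · have e1 := ih r 0 (p' := p') (q' := q') (i + 1) j (-c) (by omega)
          (by push_cast at hr ⊢; omega) hs hx1 hy1 (by omega) (by push_cast at hp'; omega) hq'
          (by
            rw [← hc, ← sg_succ]
            refine sg_eq_of_even _ ⟨-1, ?_⟩
            push_cast; ring)
        rw [part_rec, map_add, map_smul, bge_eq, e1, part_zero_right,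
          dOp_part ω _ _ _ _ _ le_rfl, dOp_sOp_self hy0,
          shuf_rec _ i (show ¬(((r + 1 : ℕ) : ℤ) = 0 ∧ ((0 : ℕ) : ℤ) = 0) by push_cast; omega),
          shuf_neg_right _ _ _ (show ((0 : ℕ) : ℤ) - 1 < 0 by simp),
          show ((r + 1 : ℕ) : ℤ) - 1 = r by push_cast; ring, lo_succ_sOp _ hy0, hi_succ_sOp _ hy0,
          lo_zero, hi_zero, lo_succ i, hi_succ i,
          lo_succ i, hi_succ i, lo_zero, hi_zero, hby 0, lo_zero]
        simp only [part_rec ω.tot r 0 (p - 1) q i, part_rec ω.tot (r + 1) 0 (p - 1) q i,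
          part_rec ω.tot (r + 1) 0 p (q - 1) i, part_zero_right]
        simp only [map_sub, map_add, map_neg, map_zero, LinearMap.sub_apply, LinearMap.neg_apply,
          LinearMap.add_apply, LinearMap.zero_apply, smul_sub, smul_add, smul_neg, smul_smul,
          neg_smul, sg_pred, neg_mul, mul_neg, ← mul_assoc, sg_mul_self, one_mul, one_smul, sg_zero,
          sub_zero, zero_add, mul_one, Nat.cast_zero, add_zero, smul_zero, neg_neg, neg_zero]
        abel
      · have e1 := ih r (s + 1) (p' := p') (q' := q') (i + 1) j (-c) (by omega)
          (by push_cast at hr ⊢; omega) hs hx1 hy1 (by omega) (by push_cast at hp'; omega) hq'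
          (by
            rw [← hc, ← sg_succ]
            refine sg_eq_of_even _ ⟨-1, ?_⟩
            push_cast; ring)
        have e2 := ih (r + 1) s (p' := p') (q' := q') (i + 1) j (-sg k p * (c * sg k (r + 1 : ℕ)))
          (by omega) hr (by push_cast at hs ⊢; omega) hx2 hy2 (by omega) hp'
          (by push_cast at hq'; omega)
          (by
            rw [← hc, neg_mul, ← sg_add, ← sg_add, ← sg_succ]
            refine sg_eq_of_even _ ⟨-p - 1, ?_⟩
            push_cast; ring)
        -- The first step now lies before both marked steps, so all corners at the first step cancel
        -- as in `bge_shuf`. The diagonal terms of e1 and e2 add up to the one wanted, by `shuf_rec`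
        -- for the outer shuffle of r and s steps.
        rw [part_rec, map_add, map_smul, bge_eq, bge_eq i (part _ _ (s + 1) _ _ _ _ _), e1, e2,
          dOp_part ω _ _ _ _ _ le_rfl, dOp_part ω _ _ _ _ _ le_rfl, dOp_sOp_self hx0,
          dOp_sOp_self hy0,
          shuf_rec _ i (show ¬(((r + 1 : ℕ) : ℤ) = 0 ∧ ((s + 1 : ℕ) : ℤ) = 0) by push_cast; omega),
          show ((s + 1 : ℕ) : ℤ) - 1 = s by push_cast; ring,
          show ((r + 1 : ℕ) : ℤ) - 1 = r by push_cast; ring, lo_succ_sOp _ hx0, hi_succ_sOp _ hx0,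
          lo_succ_sOp _ hy0, hi_succ_sOp _ hy0, lo_succ i, lo_succ i, hi_succ i, hi_succ i]
        simp only [part_rec ω.tot (r + 1) (s + 1) (p - 1) q i, part_rec ω.tot r (s + 1) (p - 1) q i,
          part_rec ω.tot (r + 1) (s + 1) p (q - 1) i, part_rec ω.tot (r + 1) s p (q - 1) i]
        simp only [map_sub, map_add, map_neg, map_zero, LinearMap.sub_apply, LinearMap.neg_apply,
          LinearMap.add_apply, LinearMap.zero_apply, smul_sub, smul_add, smul_neg, smul_smul,
          neg_smul, sg_pred, neg_mul, mul_neg, ← mul_assoc, sg_mul_self, one_mul, one_smul, sg_zero,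
          sub_zero, zero_add, mul_one, Nat.cast_zero, add_zero, smul_zero, neg_neg, neg_zero]
        abel
  exact key (r + s) r s i _ _ rfl hr hs hx hy rfl rfl rfl rfl

end Boundary

/-! ### Closed paths and their faces -/

section Loop

variable {C : CyclicModule.{u, v} k}

theorem IsHomog.rOp_pow {n : ℤ} {x : C.Total} (hx : C.IsHomog n x) (a : ℕ) :
    C.IsHomog n ((C.rOp ^ a) x) := by
  induction a with
  | zero => exact hx
  | succ a ih => rw [pow_succ', Module.End.mul_apply]; exact ih.rOp

theorem rOp_pow_apply (a : ℕ) (x : C.Total) (n : ℕ) :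
    (C.rOp ^ a) x n = (C.r n ^ a) (x n) := by
  induction a with
  | zero => rfl
  | succ a ih => rw [pow_succ', pow_succ', Module.End.mul_apply, Module.End.mul_apply, rOp_apply, ih]

theorem IsHomog.ext {n : ℕ} {x y : C.Total} (hx : C.IsHomog n x) (hy : C.IsHomog n y)
    (h : x n = y n) : x = y := by rw [hx.eq_single, hy.eq_single, h]

theorem rOp_pow_succ {p : ℕ} {x : C.Total} (hx : C.IsHomog p x) : (C.rOp ^ (p + 1)) x = x :=
  (hx.rOp_pow _).ext hx (by rw [rOp_pow_apply, r_pow_succ])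

theorem dOp_rOp {p i : ℕ} {x : C.Total} (hx : C.IsHomog p x) (h : i < p) :
    C.dOp i (C.rOp x) = C.rOp (C.dOp (i + 1) x) := by
  obtain ⟨p, rfl⟩ : ∃ p', p = p' + 1 := ⟨p - 1, by omega⟩
  refine IsHomog.ext (n := p) ((hx.rOp.dOp i).cast (by push_cast; ring))
    ((hx.dOp (i + 1)).rOp.cast (by push_cast; ring)) ?_
  rw [dOp_apply, rOp_apply, rOp_apply, dOp_apply, if_pos (by omega), if_pos (by omega),
    C.d_r p i (by omega)]

theorem dOp_rOp_last {p : ℕ} {x : C.Total} (hx : C.IsHomog p x) :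
    C.dOp p (C.rOp x) = C.dOp 0 x := by
  funext m
  rw [dOp_apply, rOp_apply, dOp_apply]
  by_cases h : m + 1 = p
  · subst h
    rw [if_pos le_rfl, if_pos (by omega), C.d_r_last]
  · rw [hx (m + 1) (by omega)]; simp

theorem sOp_rOp {p i : ℕ} {x : C.Total} (hx : C.IsHomog p x) (h : i < p) :
    C.sOp i (C.rOp x) = C.rOp (C.sOp (i + 1) x) := by
  refine IsHomog.ext (n := p + 1) ((hx.rOp.sOp i).cast (by push_cast; ring))
    ((hx.sOp (i + 1)).rOp.cast (by push_cast; ring)) ?_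
  rw [sOp_apply_succ, rOp_apply, rOp_apply, sOp_apply_succ, if_pos (by omega), if_pos (by omega),
    C.s_r p i (by omega)]

theorem rOp_rOp_sOp_zero {p : ℕ} {x : C.Total} (hx : C.IsHomog p x) :
    C.rOp (C.rOp (C.sOp 0 x)) = C.sOp p (C.rOp x) := by
  refine IsHomog.ext (n := p + 1) ((hx.sOp 0).rOp.rOp.cast (by push_cast; ring))
    ((hx.rOp.sOp p).cast (by push_cast; ring)) ?_
  rw [sOp_apply_succ, rOp_apply, rOp_apply, rOp_apply, sOp_apply_succ, if_pos (by omega),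
    if_pos (by omega), C.r_r_s_zero]

theorem dOp_rOp_pow {p : ℕ} {x : C.Total} (hx : C.IsHomog p x) (a e : ℕ) (h : e + a ≤ p) :
    C.dOp e ((C.rOp ^ a) x) = (C.rOp ^ a) (C.dOp (e + a) x) := by
  induction a generalizing e with
  | zero => rfl
  | succ a ih =>
    rw [pow_succ', Module.End.mul_apply, dOp_rOp (hx.rOp_pow a) (by omega), ih _ (by omega),
      Module.End.mul_apply, add_right_comm, add_assoc]

/-- Position e of the rotated path carries a vertex j which has already been moved past the end;
removing it makes the rotation one step shorter. -/
theorem dOp_rOp_pow_wrap {p : ℕ} {x : C.Total} (hx : C.IsHomog p x) (a e j : ℕ) (he : e ≤ p)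
    (h : e + a = p + j) (hj : j ≤ p) :
    C.dOp e ((C.rOp ^ (a + 1)) x) = (C.rOp ^ a) (C.dOp j x) := by
  have h1 : a + 1 = (p - e) + 1 + j := by omega
  have h2 : a = (p - e) + j := by omega
  rw [h1, pow_add, pow_succ, Module.End.mul_apply, Module.End.mul_apply,
    dOp_rOp_pow (hx.rOp_pow j).rOp _ _ (by omega), show e + (p - e) = p by omega,
    dOp_rOp_last (hx.rOp_pow j), dOp_rOp_pow hx _ _ (by omega), zero_add, ← Module.End.mul_apply,
    ← pow_add, ← h2]

theorem sOp_rOp_pow {p : ℕ} {x : C.Total} (hx : C.IsHomog p x) (a i : ℕ) (h : i + a ≤ p) :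
    C.sOp i ((C.rOp ^ a) x) = (C.rOp ^ a) (C.sOp (i + a) x) := by
  induction a generalizing i with
  | zero => rfl
  | succ a ih =>
    rw [pow_succ', Module.End.mul_apply, sOp_rOp (hx.rOp_pow a) (by omega), ih _ (by omega),
      Module.End.mul_apply, add_right_comm, add_assoc]

variable (C) in
/-- The operator which sends `x`, with vertices `0, …, p`, to the closed path with vertices
`a, …, p, 0, …, a`. -/
def loop (a : ℕ) : C.Total →ₗ[k] C.Total := C.rOp ∘ₗ C.sOp 0 ∘ₗ (C.rOp ^ a)

theorem loop_apply (a : ℕ) (x : C.Total) : C.loop a x = C.rOp (C.sOp 0 ((C.rOp ^ a) x)) := rfl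

theorem loop_eq (a : ℕ) (x : C.Total) : C.loop a x = C.loop 0 ((C.rOp ^ a) x) := rfl

theorem IsHomog.loop {n : ℤ} {x : C.Total} (hx : C.IsHomog n x) (a : ℕ) :
    C.IsHomog (n + 1) (C.loop a x) := ((hx.rOp_pow a).sOp 0).rOp

/-- Dropping the first vertex of a, …, p, 0, …, a leaves the rotated path that starts at a + 1;
dropping the last vertex leaves the one that starts at a. Hence the first face of one loop is the
last face of the next. -/
theorem dOp_zero_loop {p : ℕ} {x : C.Total} (hx : C.IsHomog p x) (a : ℕ) :
    C.dOp 0 (C.loop a x) = (C.rOp ^ (a + 1)) x := by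
  rw [loop_apply, dOp_rOp (p := p + 1) (((hx.rOp_pow a).sOp 0).cast (by push_cast; ring))
    (by omega), dOp_sOp_succ (by omega), pow_succ', Module.End.mul_apply]

theorem dOp_last_loop {p : ℕ} {x : C.Total} (hx : C.IsHomog p x) (a : ℕ) :
    C.dOp (p + 1) (C.loop a x) = (C.rOp ^ a) x := by
  rw [loop_apply, dOp_rOp_last (p := p + 1) (((hx.rOp_pow a).sOp 0).cast (by push_cast; ring)),
    dOp_sOp_self (by omega)]

theorem dOp_loop_aux {p : ℕ} {x : C.Total} (hx : C.IsHomog p x) (a : ℕ) {e : ℕ} (h : 1 ≤ e)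
    (he : e ≤ p) : C.dOp e (C.loop a x) = C.rOp (C.sOp 0 (C.dOp e ((C.rOp ^ a) x))) := by
  rw [loop_apply, dOp_rOp (p := p + 1) (((hx.rOp_pow a).sOp 0).cast (by push_cast; ring))
    (by omega), dOp_sOp_gt (by omega)]

theorem dOp_loop {p : ℕ} {x : C.Total} (hx : C.IsHomog p x) (a e : ℕ) (h : 1 ≤ e)
    (he : e + a ≤ p) : C.dOp e (C.loop a x) = C.loop a (C.dOp (e + a) x) := by
  rw [dOp_loop_aux hx a h (by omega), dOp_rOp_pow hx _ _ he, loop_apply]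

/-- A vertex j after the step p → 0 is removed from x before the closed path is formed; the base
point a + 1 then becomes number a. -/
theorem dOp_loop_wrap {p : ℕ} {x : C.Total} (hx : C.IsHomog p x) (a e j : ℕ) (h : 1 ≤ e)
    (he : e ≤ p) (hj : e + a = p + j) (hjp : j ≤ p) :
    C.dOp e (C.loop (a + 1) x) = C.loop a (C.dOp j x) := by
  rw [dOp_loop_aux hx _ h he, dOp_rOp_pow_wrap hx a e j he hj hjp, loop_apply]

theorem loop_sOp {p : ℕ} {x : C.Total} (hx : C.IsHomog p x) (a j : ℕ) (h : a + j ≤ p) :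
    C.loop a (C.sOp (j + a) x) = C.sOp j (C.loop a x) := by
  rw [loop_apply, ← sOp_rOp_pow hx _ _ (by omega), C.sOp_sOp (Nat.zero_le _), loop_apply,
    sOp_rOp (p := p + 1) (((hx.rOp_pow a).sOp 0).cast (by push_cast; ring)) (by omega)]

/-- The path `C.loop 0 x` is already closed, so closing it up again at its base point repeats the
last vertex. -/
theorem rOp_sOp_loop_zero {p : ℕ} {x : C.Total} (hx : C.IsHomog p x) :
    C.loop 0 (C.loop 0 x) = C.sOp (p + 1) (C.loop 0 x) := by
  have h0 : C.IsHomog (p + 1 : ℕ) (C.sOp 0 x) := (hx.sOp 0).cast (by push_cast; ring)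
  rw [loop_apply, loop_apply, pow_zero, Module.End.one_apply, Module.End.one_apply,
    sOp_rOp h0 (by omega), ← C.sOp_sOp le_rfl, rOp_rOp_sOp_zero h0]

/-- The doubled vertex i lies before the base point, hence is met after the step p → 0, at position
p + 1 - e of the closed path. For e = 0 the base point is the second copy of vertex i, and the
repetition is at the very end. -/
theorem loop_sOp_wrap {p : ℕ} {x : C.Total} (hx : C.IsHomog p x) (i e : ℕ) (h : i + e ≤ p) :
    C.loop (i + e + 1) (C.sOp i x) = C.sOp (p + 1 - e) (C.loop (i + e) x) := by
  have hi : (C.rOp ^ i) (C.sOp i x) = C.sOp 0 ((C.rOp ^ i) x) := by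
    rw [sOp_rOp_pow hx _ _ (by omega), zero_add]
  rw [loop_eq, show i + e + 1 = e + 1 + i by omega, pow_add, Module.End.mul_apply, hi]
  rcases e with _ | e
  · exact rOp_sOp_loop_zero (hx.rOp_pow i)
  · have hh := hx.rOp_pow i
    rw [pow_add _ e.succ, pow_succ, pow_one, Module.End.mul_apply, Module.End.mul_apply,
      rOp_rOp_sOp_zero hh]
    have h1 : C.sOp p (C.rOp ((C.rOp ^ i) x)) = C.sOp (p - e + e) (C.rOp ((C.rOp ^ i) x)) := by
      congr 2; omega
    have h3 : (C.rOp ^ e) (C.rOp ((C.rOp ^ i) x)) = (C.rOp ^ (i + (e + 1))) x := by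
      rw [show i + (e + 1) = e + 1 + i by omega, pow_add, pow_succ]; rfl
    rw [h1, ← sOp_rOp_pow hh.rOp _ _ (by omega), h3, show p + 1 - (e + 1) = p - e by omega]
    have h2 := hx.rOp_pow (i + (e + 1))
    rw [loop_apply, pow_zero, Module.End.one_apply, C.sOp_sOp (Nat.zero_le _), ← sOp_rOp (p := p + 1)
      ((h2.sOp 0).cast (by push_cast; ring)) (by omega), loop_apply]

/-- The end point of the inner closed path is a repeated vertex, and the outer one runs through both
copies. The bound on e is what `cyc_mem_left_of` needs. -/
theorem loop_loop_zero {p : ℕ} {x : C.Total} (hx : C.IsHomog p x) (a : ℕ) (h : a ≤ p + 1) :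
    ∃ e ≤ p + 1, ∃ c, C.loop a (C.loop 0 x) = C.sOp e (C.loop c x) := by
  have h1 : C.loop a (C.loop 0 x) = C.loop (a + 1) (C.sOp 0 x) := by
    rw [loop_eq (a + 1), pow_succ, Module.End.mul_apply]; rfl
  rw [h1]
  rcases Nat.lt_or_ge p a with ha | ha
  · obtain rfl : a = p + 1 := by omega
    refine ⟨0, by omega, 0, ?_⟩
    rw [loop_eq, rOp_pow_succ ((hx.sOp 0).cast (by push_cast; ring)), ← loop_sOp hx 0 0 (by omega)]
  · have := loop_sOp_wrap hx 0 a (by omega)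
    rw [zero_add] at this
    exact ⟨_, by omega, _, this⟩

/-- A repeated vertex stays repeated on every closed path through it; the two cases are that the
base point comes after it or not. -/
theorem exists_loop_sOp {p : ℕ} {x : C.Total} (hx : C.IsHomog p x) (a i : ℕ) (hi : i ≤ p)
    (h : a ≤ p + 1) : ∃ e ≤ p + 1, ∃ c, C.loop a (C.sOp i x) = C.sOp e (C.loop c x) := by
  rcases Nat.lt_or_ge i a with ha | ha
  · obtain ⟨e, rfl⟩ : ∃ e, a = i + e + 1 := ⟨a - i - 1, by omega⟩
    exact ⟨_, by omega, _, loop_sOp_wrap hx i e (by omega)⟩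
  · obtain ⟨j, rfl⟩ : ∃ j, i = j + a := ⟨i - a, by omega⟩
    exact ⟨j, by omega, _, loop_sOp hx a j (by omega)⟩

/-- Degeneracies of loops are loops. -/
theorem exists_sOp_loop {n : ℤ} {x : C.Total} (hx : C.IsHomog n x) (i : ℕ) :
    ∃ y, C.IsHomog (n + 1) y ∧ C.sOp i (C.loop 0 x) = C.loop 0 y := by
  rcases lt_or_ge n 0 with hn | hn
  · exact ⟨0, IsHomog.zero _, by rw [hx.eq_zero hn]; simp⟩
  lift n to ℕ using hn
  rcases lt_trichotomy i (n + 1) with h | h | h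
  · exact ⟨_, hx.sOp i, (loop_sOp hx 0 i (by omega)).symm⟩
  · subst h
    exact ⟨_, hx.loop 0, (rOp_sOp_loop_zero hx).symm⟩
  -- For i > n + 1 the operator `sOp i` is zero on the degree n + 1 of the loop.
  · refine ⟨0, IsHomog.zero _, ?_⟩
    rw [map_zero]
    funext m
    rcases m with _ | m
    · rfl
    · rw [sOp_apply_succ]
      split
      · rw [hx.loop 0 m (by omega)]; simp
      · rfl

theorem bge_zero_eq_sum {p : ℕ} {x : C.Total} (hx : C.IsHomog p x) :
    C.bge 0 x = ∑ e ∈ Finset.range (p + 1), (-1 : k) ^ e • C.dOp e x := by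
  funext n
  rw [bge_apply, Finset.sum_apply]
  by_cases h : n + 1 = p
  · subst h
    refine Finset.sum_congr rfl fun e he => ?_
    have := Finset.mem_range.1 he
    rw [Pi.smul_apply, dOp_apply, if_pos (by omega), zero_add]
  · have h0 := hx (n + 1) (by omega)
    rw [h0, Finset.sum_eq_zero (by simp), Finset.sum_eq_zero]
    intro e _
    rw [Pi.smul_apply, dOp_apply, h0]; simp

theorem hi_zero_eq_sum {p : ℕ} {x : C.Total} (hx : C.IsHomog p x) (r : ℕ) (hr : r ≤ p + 1) :
    C.hi 0 r x = ∑ e ∈ Finset.Ico r (p + 1), (-1 : k) ^ e • C.dOp e x := by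
  rw [CyclicModule.hi, LinearMap.sub_apply, bge_zero_eq_sum hx, Finset.sum_Ico_eq_sub _ hr]
  congr 1
  simp [CyclicModule.lo, LinearMap.sum_apply]

/-- These are the faces at the vertices a, …, p, before the step p → 0. The first is an end face;
the others are loops of faces of x. -/
theorem lo_loop {p : ℕ} {x : C.Total} (hx : C.IsHomog p x) (a c : ℕ) (h : a + c = p) :
    C.lo 0 (c + 1) (C.loop a x) = (C.rOp ^ (a + 1)) x +
      ∑ e ∈ Finset.range c, sg k (e + 1) • C.loop a (C.dOp (a + 1 + e) x) := by
  simp only [CyclicModule.lo, LinearMap.sum_apply, LinearMap.smul_apply]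
  rw [Finset.sum_range_succ', add_comm]
  congr 1
  · simp [dOp_zero_loop hx]
  · refine Finset.sum_congr rfl fun e he => ?_
    have := Finset.mem_range.1 he
    rw [zero_add, dOp_loop hx _ _ (by omega) (by omega), ← sg_natCast, Nat.cast_succ,
      show e + 1 + a = a + 1 + e by omega]

theorem hi_loop_zero {p : ℕ} {x : C.Total} (hx : C.IsHomog p x) :
    C.hi 0 (p + 1) (C.loop 0 x) = sg k (p + 1) • x := by
  rw [hi_zero_eq_sum (p := p + 1) ((hx.loop 0).cast (by push_cast; ring)) _ (by omega)]
  simp [dOp_last_loop hx, ← sg_natCast]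

/-- These are the faces at the vertices 0, …, a + 1 after the step p → 0. The loops of faces are
based at a, as in `lo_loop` for the preceding loop; this allows the two to be combined. -/
theorem hi_loop_succ {p : ℕ} {x : C.Total} (hx : C.IsHomog p x) (a c : ℕ) (h : a + 1 + c = p) :
    C.hi 0 (c + 1) (C.loop (a + 1) x) = sg k (p + 1) • (C.rOp ^ (a + 1)) x +
      ∑ j ∈ Finset.range (a + 1), sg k (c + 1 + j) • C.loop a (C.dOp j x) := by
  rw [hi_zero_eq_sum (p := p + 1) ((hx.loop _).cast (by push_cast; ring)) _ (by omega),
    Finset.sum_Ico_succ_top (by omega), add_comm]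
  congr 1
  · rw [dOp_last_loop hx, ← sg_natCast]; push_cast; rfl
  · rw [Finset.sum_Ico_eq_sum_range, show p + 1 - (c + 1) = a + 1 by omega]
    refine Finset.sum_congr rfl fun j hj => ?_
    have := Finset.mem_range.1 hj
    rw [dOp_loop_wrap hx _ _ j (by omega) (by omega) (by omega) (by omega), ← sg_natCast]
    push_cast; rfl

/-- Summation over the boundaries of the loops of an element. -/
theorem sum_loop_boundary {M : Type*} [AddCommGroup M] [Module k M] {p : ℕ} {x : C.Total}
    (hx : C.IsHomog p x) (V : ℕ → C.Total →ₗ[k] M) :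
    ∑ a ∈ Finset.range (p + 1), sg k (p * (a + 1)) •
        (V (p - a) (C.lo 0 (p - a + 1) (C.loop a x)) +
          V (p - a + 1) (C.hi 0 (p - a + 1) (C.loop a x))) =
      V 0 x - V (p + 1) x -
        ∑ a ∈ Finset.range p, sg k ((p - 1) * (a + 1)) • V (p - a) (C.loop a (C.bge 0 x)) := by
  simp only [smul_add, Finset.sum_add_distrib]
  -- The index of V is the number of the marked step p → 0 after the face has been taken. Set apart
  -- are the first face of the last loop and the last face of the first loop, both equal to x up to
  -- sign.
  rw [Finset.sum_range_succ, Finset.sum_range_succ' (fun a => sg k (p * (a + 1)) •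
    V (p - a + 1) (C.hi 0 (p - a + 1) (C.loop a x)))]
  have h1 : C.lo 0 (p - p + 1) (C.loop p x) = x := by
    rw [lo_loop hx p (p - p) (by omega), rOp_pow_succ hx]; simp
  have h2 : C.hi 0 (p - 0 + 1) (C.loop 0 x) = sg k (p + 1) • x := hi_loop_zero hx
  have e1 : sg k ((p : ℤ) * (p + 1)) = 1 := by
    rw [← sg_zero k]; exact sg_eq_of_even _ (by rw [sub_zero]; exact Int.even_mul_succ_self _)
  have e2 : sg k ((p : ℤ) * ((0 : ℕ) + 1)) * sg k (p + 1) = -1 := by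
    rw [← sg_add, ← sg_one k]; exact sg_eq_of_even _ ⟨p, by push_cast; ring⟩
  rw [h1, h2, e1, map_smul, smul_smul, e2, Nat.sub_self, Nat.sub_zero]
  -- The `lo` part of loop a goes with the `hi` part of loop a + 1: the end faces agree and cancel,
  -- and the inner faces give the loops, based at a, of all faces of x. The index of V is p - a for
  -- both.
  suffices h : ∀ a ∈ Finset.range p, sg k (p * (a + 1)) •
        V (p - a) (C.lo 0 (p - a + 1) (C.loop a x)) + sg k (p * ((a + 1 : ℕ) + 1)) •
          V (p - (a + 1) + 1) (C.hi 0 (p - (a + 1) + 1) (C.loop (a + 1) x)) =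
        -(sg k ((p - 1) * (a + 1)) • V (p - a) (C.loop a (C.bge 0 x))) by
    have := Finset.sum_congr rfl h
    rw [Finset.sum_add_distrib, Finset.sum_neg_distrib] at this
    rw [one_smul, neg_smul, one_smul, sub_eq_add_neg _ (Finset.sum _ _), ← this]
    abel
  intro a ha
  have ha := Finset.mem_range.1 ha
  obtain ⟨c, rfl⟩ : ∃ c, p = a + 1 + c := ⟨p - a - 1, by omega⟩
  rw [show a + 1 + c - (a + 1) = c by omega, show a + 1 + c - a = c + 1 by omega,
    lo_loop hx a (c + 1) (by omega), hi_loop_succ hx a c rfl, bge_zero_eq_sum hx,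
    show a + 1 + c + 1 = a + 1 + (c + 1) by omega,
    Finset.sum_range_add (fun e => (-1 : k) ^ e • C.dOp e x) (a + 1) (c + 1)]
  simp only [map_add, map_sum, map_smul, smul_add, Finset.smul_sum, smul_smul, ← sg_add,
    ← sg_natCast, ← sg_succ, neg_add, ← Finset.sum_neg_distrib, ← neg_smul]
  have f1 : sg k (((a + 1 + c : ℕ) : ℤ) * ((a + 1 : ℕ) + 1) + ((a + 1 + c : ℕ) + 1)) =
      -sg k (((a + 1 + c : ℕ) : ℤ) * (a + 1)) := by
    rw [← sg_succ]
    exact sg_eq_of_even _ ⟨a + 1 + c, by push_cast; ring⟩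
  rw [f1, neg_smul]
  have f2 : ∀ e : ℕ, sg k (((a + 1 + c : ℕ) : ℤ) * (a + 1) + (e + 1)) =
      sg k ((((a + 1 + c : ℕ) : ℤ) - 1) * (a + 1) + ((a + 1 + e : ℕ) : ℤ) + 1) := fun e =>
    sg_eq_of_even _ ⟨0, by push_cast; ring⟩
  have f3 : ∀ j : ℕ, sg k (((a + 1 + c : ℕ) : ℤ) * ((a + 1 : ℕ) + 1) + (c + 1 + j)) =
      sg k ((((a + 1 + c : ℕ) : ℤ) - 1) * (a + 1) + j + 1) := fun j =>
    sg_eq_of_even _ ⟨c + a + 1, by push_cast; ring⟩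
  simp only [f2, f3]
  abel

end Loop

/-! ### Moving high degeneracies through shuffles -/

section ShufLinear

variable {C C' : CyclicModule.{u, v} k} {M : Type w} [AddCommGroup M] [Module k M]
  (κ : C.Total →ₗ[k] C'.Total →ₗ[k] M)

theorem shuf_add_smul (κ' : C.Total →ₗ[k] C'.Total →ₗ[k] M) (c : k) (p q : ℤ) (i : ℕ)
    (x : C.Total) (y : C'.Total) :
    shuf (κ + c • κ') p q i x y = shuf κ p q i x y + c • shuf κ' p q i x y := by
  induction p, q using int_pair_induction generalizing i x y with
  | negL p q hlt => simp [shuf_neg_left _ _ _ hlt]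
  | negR p q hlt => simp [shuf_neg_right _ _ _ hlt]
  | zero => simp [shuf_zero]
  | step p q hp hq hpq ih1 ih2 =>
    rw [shuf_rec _ _ hpq, shuf_rec _ _ hpq, shuf_rec _ _ hpq, ih1, ih2, smul_add, smul_add,
      smul_comm (sg k p) c]
    abel

/-- High degeneracies of the second factor commute with shuffles. -/
theorem shuf_sOp_right (p q : ℤ) (i c c' : ℕ) (h : i + q ≤ c) (hc : (c' : ℤ) = c + p)
    (x : C.Total) (y : C'.Total) :
    shuf κ p q i x (C'.sOp c y) = shuf (κ.compl₂ (C'.sOp c')) p q i x y := by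
  induction p, q using int_pair_induction generalizing i c x y with
  | negL p q hlt => simp [shuf_neg_left _ _ _ hlt]
  | negR p q hlt => simp [shuf_neg_right _ _ _ hlt]
  | zero =>
    obtain rfl : c' = c := by omega
    simp [shuf_zero]
  | step p q hp hq hpq ih1 ih2 =>
    rw [shuf_rec _ _ hpq, shuf_rec _ _ hpq, C'.sOp_sOp (by omega),
      ih1 _ _ (by push_cast; omega) (by push_cast; omega),
      ih2 _ _ (by push_cast; omega) (by omega)]

/-- High degeneracies of the first factor commute with shuffles. -/
theorem shuf_sOp_left (p q : ℤ) (i c c' : ℕ) (h : i + p ≤ c) (hc : (c' : ℤ) = c + q)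
    (x : C.Total) (y : C'.Total) :
    shuf κ p q i (C.sOp c x) y = shuf (κ ∘ₗ C.sOp c') p q i x y := by
  induction p, q using int_pair_induction generalizing i c x y with
  | negL p q hlt => simp [shuf_neg_left _ _ _ hlt]
  | negR p q hlt => simp [shuf_neg_right _ _ _ hlt]
  | zero =>
    obtain rfl : c' = c := by omega
    simp [shuf_zero]
  | step p q hp hq hpq ih1 ih2 =>
    rw [shuf_rec _ _ hpq, shuf_rec _ _ hpq, C.sOp_sOp (by omega),
      ih1 _ _ (by push_cast; omega) (by omega),
      ih2 _ _ (by push_cast; omega) (by push_cast; omega)]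

end ShufLinear

/-! ### Closed paths of shuffles -/

section Rotation

variable {C C' : CyclicModule.{u, v} k} {D : CyclicModule.{u, w} k} (ω : Pairing C C' D)

/-- The vertex moved to the end lies before the start of the shuffle, so the shuffle merely starts
one place earlier. The bounds on m and n keep the shuffle away from the final vertex, where
`sOp_rOp` fails. -/
theorem rOp_shuf {p q m n : ℤ} (i : ℕ) {x : C.Total} {y : C'.Total}
    (hx : C.IsHomog m x) (hm : i + 1 + p ≤ m) (hy : C'.IsHomog n y) (hn : i + 1 + q ≤ n) :
    D.rOp (shuf ω.tot p q (i + 1) x y) = shuf ω.tot p q i (C.rOp x) (C'.rOp y) := by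
  induction p, q using int_pair_induction generalizing i x y m n with
  | negL p q hlt => simp [shuf_neg_left _ _ _ hlt]
  | negR p q hlt => simp [shuf_neg_right _ _ _ hlt]
  | zero => rw [shuf_zero, shuf_zero, rOp_tot]
  | step p q hp hq hpq ih1 ih2 =>
    have e1 : C.sOp i (C.rOp x) = C.rOp (C.sOp (i + 1) x) :=
      sOp_rOp (p := m.toNat) (hx.cast (by omega)) (by omega)
    have e2 : C'.sOp i (C'.rOp y) = C'.rOp (C'.sOp (i + 1) y) :=
      sOp_rOp (p := n.toNat) (hy.cast (by omega)) (by omega)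
    rw [shuf_rec _ _ hpq, shuf_rec _ _ hpq, map_add, map_smul, e1, e2,
      ih1 _ hx (by push_cast; omega) (hy.sOp _) (by push_cast; omega),
      ih2 _ (hx.sOp _) (by push_cast; omega) hy (by push_cast; omega)]

theorem rOp_pow_shuf {p q m n : ℤ} (i a : ℕ) {x : C.Total} {y : C'.Total}
    (hx : C.IsHomog m x) (hm : i + a + p ≤ m) (hy : C'.IsHomog n y) (hn : i + a + q ≤ n) :
    (D.rOp ^ a) (shuf ω.tot p q (i + a) x y) =
      shuf ω.tot p q i ((C.rOp ^ a) x) ((C'.rOp ^ a) y) := by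
  induction a generalizing i with
  | zero => rfl
  | succ a ih =>
    rw [pow_succ', pow_succ', pow_succ', Module.End.mul_apply, Module.End.mul_apply,
      Module.End.mul_apply, show i + (a + 1) = i + 1 + a by omega,
      ih (i + 1) (by push_cast at hm ⊢; omega) (by push_cast at hn ⊢; omega),
      rOp_shuf ω i (hx.rOp_pow a) (by push_cast at hm; omega)
        (hy.rOp_pow a) (by push_cast at hn; omega)]

/-- If the base point is the start i of the shuffle, all of its steps are met before the closed path
wraps around, and closing up both factors separately gives the same path. -/
theorem loop_shuf {p q : ℤ} (i : ℕ) {x : C.Total} {y : C'.Total}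
    (hx : C.IsHomog (i + p) x) (hy : C'.IsHomog (i + q) y) :
    D.loop i (shuf ω.tot p q i x y) = shuf ω.tot p q 0 (C.loop i x) (C'.loop i y) := by
  have h := rOp_pow_shuf ω (p := p) (q := q) 0 i hx (by simp) hy (by simp)
  rw [zero_add] at h
  rw [loop_apply, h, ← sOp_shuf ω _ _ _ le_rfl, rOp_shuf ω 0 ((hx.rOp_pow i).sOp 0)
    (by push_cast; omega) ((hy.rOp_pow i).sOp 0) (by push_cast; omega), loop_apply, loop_apply]

/-- The summands of the boundary of the cyclic shuffle product. -/
def corner (p q i a b : ℕ) : C.Total →ₗ[k] C'.Total →ₗ[k] D.Total :=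
  sg k ((p - a) * b + (i + p + q) * (p - a + (q - b))) •
    (shuf (shuf ω.tot a b ((p - a) + (q - b) + 1 + i)) ((p - a : ℕ) : ℤ) ((q - b : ℕ) : ℤ)
      0).compl₁₂ (C.loop (i + a)) (C'.loop (i + b))

/-- The part of `corner` where the last loop starts with a step of the first kind. -/
def cornerLeft (p q i a b : ℕ) : C.Total →ₗ[k] C'.Total →ₗ[k] D.Total :=
  sg k ((p - a) * b + (i + p + q) * (p - a + (q - b))) •
    (shuf ((shuf ω.tot (a - 1) b ((p - a) + (q - b) + 1 + i + 1)).compl₂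
      (C'.sOp ((p - a) + (q - b) + 1 + i))) ((p - a : ℕ) : ℤ) ((q - b : ℕ) : ℤ)
      0).compl₁₂ (C.loop (i + a)) (C'.loop (i + b))

/-- The part of `corner` where the last loop starts with a step of the second kind. -/
def cornerRight (p q i a b : ℕ) : C.Total →ₗ[k] C'.Total →ₗ[k] D.Total :=
  sg k (p + (p - a) * (b - 1) + (i + p + q) * (p - a + (q - b))) •
    (shuf ((shuf ω.tot a (b - 1) ((p - a) + (q - b) + 1 + i + 1)) ∘ₗ
      (C.sOp ((p - a) + (q - b) + 1 + i))) ((p - a : ℕ) : ℤ) ((q - b : ℕ) : ℤ)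
      0).compl₁₂ (C.loop (i + a)) (C'.loop (i + b))

/-- The recursion of `shuf` is applied to the a + b steps after the wrap, that is, to the beginning
of the original lattice path. -/
theorem corner_eq (p q i a b : ℕ) (h : ¬(a = 0 ∧ b = 0)) (x : C.Total) (y : C'.Total) :
    corner ω p q i a b x y = cornerLeft ω p q i a b x y + cornerRight ω p q i a b x y := by
  have e : shuf ω.tot a b ((p - a) + (q - b) + 1 + i) =
      (shuf ω.tot (a - 1) b ((p - a) + (q - b) + 1 + i + 1)).compl₂
        (C'.sOp ((p - a) + (q - b) + 1 + i)) +
      sg k a • (shuf ω.tot a (b - 1) ((p - a) + (q - b) + 1 + i + 1)) ∘ₗ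
        (C.sOp ((p - a) + (q - b) + 1 + i)) := by
    refine LinearMap.ext fun u => LinearMap.ext fun v => ?_
    rw [shuf_rec _ _ (by omega)]
    rfl
  simp only [corner, cornerLeft, cornerRight, LinearMap.smul_apply, LinearMap.compl₁₂_apply]
  rw [e, shuf_add_smul, smul_add, smul_smul, ← sg_add]
  congr 2
  exact sg_eq_of_even _ ⟨0, by ring⟩

theorem shuf_zero_left {M : Type w} [AddCommGroup M] [Module k M] (p q : ℤ) (i : ℕ) :
    shuf (0 : C.Total →ₗ[k] C'.Total →ₗ[k] M) p q i = 0 := by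
  refine LinearMap.ext fun x => LinearMap.ext fun y => ?_
  have := shuf_add_smul (0 : C.Total →ₗ[k] C'.Total →ₗ[k] M) 0 (1 : k) p q i x y
  rw [smul_zero, add_zero, one_smul] at this
  simpa using this

theorem cornerLeft_zero (p q i b : ℕ) (x : C.Total) (y : C'.Total) :
    cornerLeft ω p q i 0 b x y = 0 := by
  simp only [cornerLeft]
  rw [shuf_neg_left _ _ _ (show ((0 : ℕ) : ℤ) - 1 < 0 by simp)]
  have : (0 : C.Total →ₗ[k] C'.Total →ₗ[k] D.Total).compl₂
    (C'.sOp (p - 0 + (q - b) + 1 + i)) = 0 := rfl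
  rw [this, shuf_zero_left]
  simp

theorem cornerRight_zero (p q i a : ℕ) (x : C.Total) (y : C'.Total) :
    cornerRight ω p q i a 0 x y = 0 := by
  simp only [cornerRight]
  rw [shuf_neg_right _ _ _ (show ((0 : ℕ) : ℤ) - 1 < 0 by simp), LinearMap.zero_comp,
    shuf_zero_left]
  simp

/-- With base point at the start of the shuffle nothing remains to be shuffled after the wrap, so
this is `loop_shuf`; the two sign exponents differ by an even number because n(n + 1) is even for n
= i + p + q. -/
theorem corner_zero (p q i : ℕ) {x : C.Total} {y : C'.Total} (hx : C.IsHomog (i + p) x)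
    (hy : C'.IsHomog (i + q) y) :
    corner ω p q i 0 0 x y = sg k ((i + p + q) * (i + 1)) • D.loop i (shuf ω.tot p q i x y) := by
  rw [loop_shuf ω i hx hy]
  simp only [corner, LinearMap.smul_apply, LinearMap.compl₁₂_apply, Nat.cast_zero, Nat.sub_zero,
    shuf_zero, add_zero, sub_zero]
  congr 1
  have := Int.even_mul_succ_self (i + p + q)
  rw [← sub_add_cancel ((p : ℤ) * 0 + (i + p + q) * (p + q)) ((i + p + q) * (i + 1)), sg_add]
  rw [sg_eq_of_even k (m := _ - _) (n := 0), sg_zero, one_mul]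
  obtain ⟨c, hc⟩ := this
  exact ⟨c - (i + p + q) * (i + 1), by linear_combination hc⟩

/-- A base point on a lattice path lies over a unique lattice point (a, b). The closed path runs
from there to (p, q), takes the diagonal to the origin, and returns to (a, b). Sorting by (a, b)
gives the right-hand side. The proof fixes the first step of the lattice path and uses induction on
p + q; the general i stands for i common initial steps. -/
theorem sum_loop_shuf (p q i : ℕ) {x : C.Total} {y : C'.Total} (hx : C.IsHomog (i + p) x)
    (hy : C'.IsHomog (i + q) y) :
    ∑ j ∈ Finset.Ico i (i + p + q + 1), sg k ((i + p + q) * (j + 1)) •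
        D.loop j (shuf ω.tot p q i x y) =
      ∑ a ∈ Finset.range (p + 1), ∑ b ∈ Finset.range (q + 1), corner ω p q i a b x y := by
  have key : ∀ n p q i : ℕ, p + q = n → ∀ {x : C.Total} {y : C'.Total}, C.IsHomog (i + p) x →
    C'.IsHomog (i + q) y → ∑ j ∈ Finset.Ico i (i + p + q + 1), sg k ((i + p + q) * (j + 1)) •
        D.loop j (shuf ω.tot p q i x y) =
      ∑ a ∈ Finset.range (p + 1), ∑ b ∈ Finset.range (q + 1), corner ω p q i a b x y := by
    intro n
    induction n with
    | zero =>
      intro p q i h x y hx hy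
      obtain ⟨rfl, rfl⟩ : p = 0 ∧ q = 0 := by omega
      simp only [zero_add, Finset.sum_range_one, corner_zero ω 0 0 i hx hy, add_zero,
        Nat.Ico_succ_singleton, Finset.sum_singleton]
    | succ n ih =>
      intro p q i h x y hx hy
      have hp : ¬((p : ℤ) = 0 ∧ (q : ℤ) = 0) := by omega
      -- These are the lattice paths whose first step is of the first kind, with base point after
      -- that step.
      have hl : ∑ a ∈ Finset.range (p + 1), ∑ b ∈ Finset.range (q + 1),
          cornerLeft ω p q i a b x y = ∑ j ∈ Finset.Ico (i + 1) (i + p + q + 1),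
          sg k ((i + p + q) * (j + 1)) • D.loop j (shuf ω.tot (p - 1) q (i + 1) x (C'.sOp i y)) := by
        rw [Finset.sum_range_succ', Finset.sum_eq_zero (s := Finset.range (q + 1)), add_zero]
        · rcases p with _ | p
          · rw [Finset.sum_range_zero, shuf_neg_left _ _ _ (by simp)]; simp
          · have := ih p q (i + 1) (by omega) (x := x) (y := C'.sOp i y)
              (hx.cast (by push_cast; ring)) ((hy.sOp i).cast (by push_cast; ring))
            rw [show i + (p + 1) + q + 1 = i + 1 + p + q + 1 by omega,
              show ((p + 1 : ℕ) : ℤ) - 1 = p by push_cast; ring]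
            have e : ∀ j : ℕ, ((i : ℤ) + (p + 1 : ℕ) + q) * (j + 1) =
              ((i + 1 : ℕ) + p + q) * (j + 1) := fun j => by push_cast; ring
            simp only [e]
            rw [this]
            refine Finset.sum_congr rfl fun a ha => Finset.sum_congr rfl fun b hb => ?_
            have ha := Finset.mem_range.1 ha
            have hb := Finset.mem_range.1 hb
            simp only [corner, cornerLeft, LinearMap.smul_apply, LinearMap.compl₁₂_apply]
            -- The degeneracy of the first step is met only after the wrap, so it becomes a high
            -- degeneracy of the loop; it then passes the outer shuffle and becomes the first step
            -- of the inner one.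
            rw [show i + 1 + b = i + b + 1 by omega,
              loop_sOp_wrap (p := i + q) (hy.cast (by push_cast; ring)) _ _ (by omega),
              shuf_sOp_right _ ((p - a : ℕ) : ℤ) ((q - b : ℕ) : ℤ) 0 (i + q + 1 - b)
                (p - a + (q - b) + 1 + i) (by omega) (by omega),
              show p + 1 - (a + 1) = p - a by omega, show i + 1 + a = i + (a + 1) by omega,
              show p - a + (q - b) + 1 + i + 1 = p - a + (q - b) + 1 + (i + 1) by omega,
              show ((a + 1 : ℕ) : ℤ) - 1 = a by push_cast; ring]
            congr 2
            push_cast; ring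
        · intro b _
          exact cornerLeft_zero ω p q i b x y
      have hr : ∑ a ∈ Finset.range (p + 1), ∑ b ∈ Finset.range (q + 1),
          cornerRight ω p q i a b x y = ∑ j ∈ Finset.Ico (i + 1) (i + p + q + 1),
          sg k ((i + p + q) * (j + 1)) • sg k p •
            D.loop j (shuf ω.tot p (q - 1) (i + 1) (C.sOp i x) y) := by
        rw [Finset.sum_comm, Finset.sum_range_succ',
          Finset.sum_eq_zero (s := Finset.range (p + 1)), add_zero]
        · rcases q with _ | q
          · rw [Finset.sum_range_zero, shuf_neg_right _ _ _ (by simp)]; simp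
          · have := ih p q (i + 1) (by omega) (x := C.sOp i x) (y := y)
              ((hx.sOp i).cast (by push_cast; ring)) (hy.cast (by push_cast; ring))
            rw [show i + p + (q + 1) + 1 = i + 1 + p + q + 1 by omega,
              show ((q + 1 : ℕ) : ℤ) - 1 = q by push_cast; ring]
            have e : ∀ j : ℕ, ((i : ℤ) + p + (q + 1 : ℕ)) * (j + 1) =
              ((i + 1 : ℕ) + p + q) * (j + 1) := fun j => by push_cast; ring
            simp only [e, smul_comm _ (sg k p)]
            rw [← Finset.smul_sum, this, Finset.sum_comm, Finset.smul_sum]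
            refine Finset.sum_congr rfl fun a ha => ?_
            rw [Finset.smul_sum]
            refine Finset.sum_congr rfl fun b hb => ?_
            have ha := Finset.mem_range.1 ha
            have hb := Finset.mem_range.1 hb
            simp only [corner, cornerRight, LinearMap.smul_apply, LinearMap.compl₁₂_apply]
            rw [show i + 1 + a = i + a + 1 by omega,
              loop_sOp_wrap (p := i + p) (hx.cast (by push_cast; ring)) _ _ (by omega),
              shuf_sOp_left _ ((p - a : ℕ) : ℤ) ((q - b : ℕ) : ℤ) 0 (i + p + 1 - a)
                (p - a + (q - b) + 1 + i) (by omega) (by omega),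
              show q + 1 - (b + 1) = q - b by omega, show i + 1 + b = i + (b + 1) by omega,
              show p - a + (q - b) + 1 + i + 1 = p - a + (q - b) + 1 + (i + 1) by omega,
              show ((b + 1 : ℕ) : ℤ) - 1 = b by push_cast; ring, smul_smul, ← sg_add]
            congr 2
            push_cast; ring
        · intro a _
          exact cornerRight_zero ω p q i a x y
      rw [Finset.sum_eq_sum_Ico_succ_bot (by omega)]
      have hz : cornerLeft ω p q i 0 0 x y + cornerRight ω p q i 0 0 x y = 0 := by
        rw [cornerLeft_zero, cornerRight_zero, add_zero]
      -- The base point at the very start precedes the first step, so the corner at (0, 0) cannot be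
      -- split; it is the summand j = i.
      have hsplit : ∀ a ∈ Finset.range (p + 1), ∀ b ∈ Finset.range (q + 1),
          corner ω p q i a b x y = cornerLeft ω p q i a b x y + cornerRight ω p q i a b x y +
            if a = 0 ∧ b = 0 then corner ω p q i 0 0 x y else 0 := by
        intro a _ b _
        by_cases hab : a = 0 ∧ b = 0
        · obtain ⟨rfl, rfl⟩ := hab
          rw [hz]; simp
        · rw [if_neg hab, add_zero, corner_eq ω _ _ _ _ _ hab]
      rw [Finset.sum_congr rfl fun a ha => Finset.sum_congr rfl fun b hb => hsplit a ha b hb]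
      simp only [Finset.sum_add_distrib]
      rw [hl, hr, corner_zero ω p q i hx hy, ← Finset.sum_add_distrib, add_comm]
      congr 1
      · refine Finset.sum_congr rfl fun j _ => ?_
        rw [shuf_rec _ _ hp, map_add, map_smul, smul_add]
      · rw [Finset.sum_eq_single 0, Finset.sum_eq_single 0]
        · simp
        · intro b _ hb; simp [hb]
        · simp
        · intro a _ ha; simp [ha]
        · simp
  exact key _ p q i rfl hx hy

end Rotation

/-! ### Connes' operator as a sum of closed paths -/

section BigB

variable (C : CyclicModule.{u, v} k)

/-- The operator `s_{-1} N` on the product of all degrees, which agrees with Connes' operator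
modulo degenerate elements. -/
def bigB : C.Total →ₗ[k] C.Total :=
  LinearMap.pi fun m => match m with
    | 0 => 0
    | n + 1 => C.extra n ∘ₗ C.norm n ∘ₗ LinearMap.proj n

variable {C}

theorem bigB_apply_zero (x : C.Total) : C.bigB x 0 = 0 := rfl

theorem bigB_apply_succ (x : C.Total) (n : ℕ) :
    C.bigB x (n + 1) = C.extra n (C.norm n (x n)) := rfl

theorem IsHomog.bigB {n : ℤ} {x : C.Total} (hx : C.IsHomog n x) :
    C.IsHomog (n + 1) (C.bigB x) := fun m hm => by
  rcases m with _ | m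
  · rfl
  · rw [bigB_apply_succ, hx m (by push_cast at hm; omega), map_zero, map_zero]

theorem r_s_zero (n : ℕ) (x : C.X n) : C.r (n + 1) (C.s n 0 x) = C.extra n (C.r n x) := by
  rw [extra, LinearMap.comp_apply, ← r_r_s_zero, t_r]

theorem t_pow_r_pow (n i : ℕ) (x : C.X n) : (C.t n ^ i) ((C.r n ^ i) x) = x := by
  induction i generalizing x with
  | zero => rfl
  | succ i ih =>
    rw [pow_succ, pow_succ', Module.End.mul_apply, Module.End.mul_apply, t_r, ih]

theorem loop_apply_succ (a : ℕ) (x : C.Total) (n : ℕ) :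
    C.loop a x (n + 1) = C.extra n ((C.r n ^ (a + 1)) (x n)) := by
  rw [loop_apply, rOp_apply, sOp_apply_succ, if_pos (by omega), rOp_pow_apply, r_s_zero, pow_succ',
    Module.End.mul_apply]

theorem lam_pow_apply (n i : ℕ) (x : C.X n) :
    (C.lam n ^ i) x = sg k (n * i) • (C.t n ^ i) x := by
  rw [lam, smul_pow, LinearMap.smul_apply, ← pow_mul, ← sg_natCast, Nat.cast_mul]

/-- Since t^{p+1} = 1, the loop based at a is the extra degeneracy of t^{p-a} x. Thus the sum is the
norm read backwards, and p(p - a) and p(a + 1) have the same parity. -/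
theorem bigB_eq_sum {p : ℕ} {x : C.Total} (hx : C.IsHomog p x) :
    C.bigB x = ∑ a ∈ Finset.range (p + 1), sg k (p * (a + 1)) • C.loop a x := by
  refine IsHomog.ext (n := p + 1) (hx.bigB.cast (by push_cast; ring))
    (IsHomog.sum fun a _ => ((hx.loop a).smul _).cast (by push_cast; ring)) ?_
  rw [bigB_apply_succ, norm, LinearMap.sum_apply, map_sum, Finset.sum_apply,
    ← Finset.sum_range_reflect]
  refine Finset.sum_congr rfl fun a ha => ?_
  have := Finset.mem_range.1 ha
  obtain ⟨c, rfl⟩ : ∃ c, p = a + c := ⟨p - a, by omega⟩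
  rw [Pi.smul_apply, loop_apply_succ, show a + c + 1 - 1 - a = c by omega, lam_pow_apply, map_smul]
  congr 1
  · refine sg_eq_of_even _ ?_
    have h := Int.even_mul_succ_self ((a + c : ℕ) : ℤ)
    obtain ⟨d, hd⟩ := h
    exact ⟨(a + c : ℕ) * c - d, by push_cast at hd ⊢; linear_combination -hd⟩
  · congr 1
    have h := t_pow_r_pow (a + c) c ((C.r (a + c) ^ (a + 1)) (x (a + c)))
    rw [← Module.End.mul_apply (C.r (a + c) ^ c), ← pow_add, show c + (a + 1) = a + c + 1 by omega,
      r_pow_succ] at h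
    exact h

end BigB

/-! ### The cyclic shuffle product and its boundary -/

section Cyc

variable {C C' : CyclicModule.{u, v} k} {D : CyclicModule.{u, w} k} (ω : Pairing C C' D)

/-- The cyclic shuffle product of elements with `p` and `q` vertices. -/
def cyc (p q : ℕ) : C.Total →ₗ[k] C'.Total →ₗ[k] D.Total :=
  ∑ a ∈ Finset.range p, ∑ b ∈ Finset.range q, sg k ((p - 1) * (a + 1) + (q - 1) * (b + 1)) •
    (part ω.tot (p - a) (q - b) p q 0).compl₁₂ (C.loop a) (C'.loop b)

theorem cyc_apply (p q : ℕ) (x : C.Total) (y : C'.Total) :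
    cyc ω p q x y = ∑ a ∈ Finset.range p, ∑ b ∈ Finset.range q,
      sg k ((p - 1) * (a + 1) + (q - 1) * (b + 1)) •
        part ω.tot (p - a) (q - b) p q 0 (C.loop a x) (C'.loop b y) := by
  simp [cyc, LinearMap.sum_apply]

theorem cyc_isHomog {n : ℤ} (p q : ℕ) (x : C.Total) (y : C'.Total)
    (hx : C.IsHomog (n - q - 1) x) : D.IsHomog n (cyc ω p q x y) := by
  rw [cyc_apply]
  exact IsHomog.sum fun a _ => IsHomog.sum fun b _ =>
    (part_isHomog ω _ _ _ _ _ _ _ ((hx.loop a).cast (by ring))).smul _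

/-- The boundary of the cyclic shuffle product. -/
theorem bge_cyc {p q : ℕ} {x : C.Total} {y : C'.Total} (hx : C.IsHomog p x)
    (hy : C'.IsHomog q y) :
    D.bge 0 (cyc ω (p + 1) (q + 1) x y) =
      (shuf ω.tot p (q + 1) 0 x (C'.bigB y) - cyc ω p (q + 1) (C.bge 0 x) y) +
      sg k (p + 1) • (- shuf ω.tot (p + 1) q 0 (C.bigB x) y - cyc ω (p + 1) q x (C'.bge 0 y)) +
      sg k (p + 1) • D.bigB (shuf ω.tot p q 0 x y) := by
  -- Faces of the loops of x. In `cyc` the marked step of the loop based at a is the step from the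
  -- last vertex back to 0.
  have hX : ∑ a ∈ Finset.range (p + 1), ∑ b ∈ Finset.range (q + 1), sg k (p * (a + 1)) •
      sg k (q * (b + 1)) •
        (part ω.tot (p - a) (q - b + 1) p (q + 1) 0 (C.lo 0 (p - a + 1) (C.loop a x))
            (C'.loop b y) +
          part ω.tot (p - a + 1) (q - b + 1) p (q + 1) 0 (C.hi 0 (p - a + 1) (C.loop a x))
            (C'.loop b y)) =
      shuf ω.tot p (q + 1) 0 x (C'.bigB y) - cyc ω p (q + 1) (C.bge 0 x) y := by
    rw [Finset.sum_comm]
    have h : ∀ b ∈ Finset.range (q + 1), ∑ a ∈ Finset.range (p + 1), sg k (p * (a + 1)) •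
        sg k (q * (b + 1)) •
        (part ω.tot (p - a) (q - b + 1) p (q + 1) 0 (C.lo 0 (p - a + 1) (C.loop a x))
            (C'.loop b y) +
          part ω.tot (p - a + 1) (q - b + 1) p (q + 1) 0 (C.hi 0 (p - a + 1) (C.loop a x))
            (C'.loop b y)) =
        shuf ω.tot p (q + 1) 0 x (sg k (q * (b + 1)) • C'.loop b y) -
          ∑ a ∈ Finset.range p, sg k ((p - 1) * (a + 1) + ((q + 1 : ℕ) - 1) * (b + 1)) •
            part ω.tot (p - a) (q + 1 - b) p ((q + 1 : ℕ) : ℤ) 0 (C.loop a (C.bge 0 x))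
              (C'.loop b y) := by
      intro b hb
      have hb := Finset.mem_range.1 hb
      have h := congrArg (sg k (q * (b + 1)) • ·) (sum_loop_boundary hx
        (fun c => (part ω.tot c (q - b + 1) p (q + 1) 0).flip (C'.loop b y)))
      simp only [LinearMap.flip_apply, Finset.smul_sum, part_zero_left] at h
      -- Of the end terms, index 0 imposes no condition and leaves the full shuffle with the loop of
      -- y, whereas index p + 1 exceeds the number of steps and gives zero.
      rw [part_of_lt _ _ _ _ _ _ (by push_cast; omega), sub_zero, smul_sub, Finset.smul_sum] at h
      rw [map_smul, Finset.sum_congr rfl fun a _ => smul_comm _ _ _, h]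
      congr 1
      refine Finset.sum_congr rfl fun a _ => ?_
      rw [smul_smul, ← sg_add, show q - b + 1 = q + 1 - b by omega]
      push_cast
      congr 2
      ring
    rw [bigB_eq_sum hy, cyc_apply, map_sum, Finset.sum_congr rfl h, Finset.sum_sub_distrib]
    congr 1
    exact Finset.sum_comm
  have hY : ∑ a ∈ Finset.range (p + 1), ∑ b ∈ Finset.range (q + 1), sg k (p * (a + 1)) •
      sg k (q * (b + 1)) •
        (part ω.tot (p - a + 1) (q - b) (p + 1) q 0 (C.loop a x)
            (C'.lo 0 (q - b + 1) (C'.loop b y)) +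
          part ω.tot (p - a + 1) (q - b + 1) (p + 1) q 0 (C.loop a x)
            (C'.hi 0 (q - b + 1) (C'.loop b y))) =
      - shuf ω.tot (p + 1) q 0 (C.bigB x) y - cyc ω (p + 1) q x (C'.bge 0 y) := by
    have h : ∀ a ∈ Finset.range (p + 1), ∑ b ∈ Finset.range (q + 1), sg k (p * (a + 1)) •
        sg k (q * (b + 1)) •
        (part ω.tot (p - a + 1) (q - b) (p + 1) q 0 (C.loop a x)
            (C'.lo 0 (q - b + 1) (C'.loop b y)) +
          part ω.tot (p - a + 1) (q - b + 1) (p + 1) q 0 (C.loop a x)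
            (C'.hi 0 (q - b + 1) (C'.loop b y))) =
        -(sg k (p * (a + 1)) • shuf ω.tot (p + 1) q 0 (C.loop a x) y) -
          ∑ b ∈ Finset.range q, sg k (((p + 1 : ℕ) - 1) * (a + 1) + (q - 1) * (b + 1)) •
            part ω.tot (p + 1 - a) (q - b) ((p + 1 : ℕ) : ℤ) q 0 (C.loop a x)
              (C'.loop b (C'.bge 0 y)) := by
      intro a ha
      have ha := Finset.mem_range.1 ha
      have h := congrArg (sg k (p * (a + 1)) • ·) (sum_loop_boundary hy
        (fun c => (part ω.tot (p - a + 1) c (p + 1) q 0) (C.loop a x)))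
      simp only [Finset.smul_sum, part_zero_right] at h
      rw [part_eq_shuf _ _ _ _ _ _ (by push_cast; omega) (by push_cast; ring),
        LinearMap.zero_apply, LinearMap.zero_apply, zero_sub, smul_sub, smul_neg,
        Finset.smul_sum] at h
      rw [h]
      congr 1
      refine Finset.sum_congr rfl fun b _ => ?_
      rw [smul_smul, ← sg_add, show p - a + 1 = p + 1 - a by omega]
      push_cast
      congr 2
      ring
    rw [bigB_eq_sum hx, cyc_apply, map_sum, LinearMap.sum_apply, Finset.sum_congr rfl h,
      Finset.sum_sub_distrib, Finset.sum_neg_distrib]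
    simp only [map_smul, LinearMap.smul_apply]
  -- The diagonal terms of `bge_part`: the two marked steps are replaced by the common step from (p,
  -- q) to (0, 0), so these are the corners of `sum_loop_shuf` for i = 0.
  have hZ : ∑ a ∈ Finset.range (p + 1), ∑ b ∈ Finset.range (q + 1), sg k (p * (a + 1)) •
      sg k (q * (b + 1)) • sg k (q - b + (a + 1) * (q - b)) •
        shuf (shuf ω.tot a b (p - a + (q - b) + 1)) ((p - a : ℕ) : ℤ) ((q - b : ℕ) : ℤ) 0
          (C.loop a x) (C'.loop b y) = D.bigB (shuf ω.tot p q 0 x y) := by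
    rw [bigB_eq_sum (p := p + q) (shuf_isHomog ω _ _ _ _ _ (hx.cast (by push_cast; ring)))]
    have := sum_loop_shuf ω p q 0 (hx.cast (by simp)) (hy.cast (by simp))
    simp only [zero_add, Nat.Ico_zero_eq_range, Nat.cast_zero] at this
    push_cast
    rw [this]
    refine Finset.sum_congr rfl fun a _ => Finset.sum_congr rfl fun b _ => ?_
    simp only [corner, LinearMap.smul_apply, LinearMap.compl₁₂_apply, zero_add, add_zero,
      smul_smul, ← sg_add, Nat.cast_zero]
    congr 1
    refine sg_eq_of_even _ ?_
    obtain ⟨d, hd⟩ := Int.even_mul_succ_self ((p : ℤ) + q)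
    refine ⟨d - p ^ 2 - q ^ 2 - p * q + (p + q) * a + (p + q) * b + q + q * a - a * b - p * b - p - q - b +
      (p - p * q - a * q + a * b + q), ?_⟩
    linear_combination hd
  rw [cyc_apply, ← hX, ← hY, ← hZ, map_sum, Finset.smul_sum, Finset.smul_sum,
    ← Finset.sum_add_distrib, ← Finset.sum_add_distrib]
  refine Finset.sum_congr rfl fun a ha => ?_
  rw [map_sum, Finset.smul_sum, Finset.smul_sum, ← Finset.sum_add_distrib,
    ← Finset.sum_add_distrib]
  refine Finset.sum_congr rfl fun b hb => ?_
  have ha := Finset.mem_range.1 ha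
  have hb := Finset.mem_range.1 hb
  obtain ⟨c, rfl⟩ : ∃ c, p = a + c := ⟨p - a, by omega⟩
  obtain ⟨d, rfl⟩ : ∃ d, q = b + d := ⟨q - b, by omega⟩
  rw [show a + c + 1 - a = c + 1 by omega, show b + d + 1 - b = d + 1 by omega,
    show a + c - a = c by omega, show b + d - b = d by omega, map_smul]
  have h := bge_part ω c d (p := (a + c + 1 : ℕ)) (q := (b + d + 1 : ℕ)) 0 (by push_cast; omega)
    (by push_cast; omega) ((hx.loop a).cast (by push_cast; ring))
    ((hy.loop b).cast (by push_cast; ring))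
  rw [h, zero_add]
  simp only [smul_add, smul_smul, ← sg_add]
  push_cast
  rw [show (a + c + 1 - 1 : ℤ) = a + c by ring, show (b + d + 1 - 1 : ℤ) = b + d by ring,
    show (a + c + 1 - c - 1 : ℤ) = a by ring, show (b + d + 1 - d - 1 : ℤ) = b by ring,
    add_comm (a + c + 1 : ℤ) ((a + c) * (a + 1) + (b + d) * (b + 1)), show (a + c + 1 : ℤ) + ((a + c) * (a + 1) + ((b + d) * (b + 1) +
      (b + d - b + (a + 1) * (b + d - b)))) = (a + c) * (a + 1) + (b + d) * (b + 1) +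
      (a + c + 1 + d + (a + c + 1 - c) * d) by ring]

end Cyc

/-! ### Shuffles as subsets -/

section Sets

variable {C C' : CyclicModule.{u, v} k} {M : Type w} [AddCommGroup M] [Module k M]

/-- The set S consists of the positions of the steps of the first kind. The exponent of the sign
counts the pairs in which a step of the second kind comes before one of the first. -/
theorem shuf_eq_sum (κ : C.Total →ₗ[k] C'.Total →ₗ[k] M) (p q i : ℕ) (x : C.Total)
    (y : C'.Total) :
    shuf κ p q i x y = ∑ S ∈ (Finset.Ico i (i + p + q)).powersetCard p,
      sg k (∑ s ∈ S, (s : ℤ) - ∑ j ∈ Finset.range p, ((i + j : ℕ) : ℤ)) •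
        κ (C.sList (Finset.Ico i (i + p + q) \ S).sort x) (C'.sList S.sort y) := by
  have key : ∀ n p q i : ℕ, p + q = n → ∀ (x : C.Total) (y : C'.Total), shuf κ p q i x y =
      ∑ S ∈ (Finset.Ico i (i + p + q)).powersetCard p,
      sg k (∑ s ∈ S, (s : ℤ) - ∑ j ∈ Finset.range p, ((i + j : ℕ) : ℤ)) •
        κ (C.sList (Finset.Ico i (i + p + q) \ S).sort x) (C'.sList S.sort y) := by
    intro n
    induction n with
    | zero =>
      intro p q i h x y
      obtain ⟨rfl, rfl⟩ : p = 0 ∧ q = 0 := by omega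
      simp [shuf_zero, sList]
    | succ n ih =>
      intro p q i h x y
      have hI : Finset.Ico i (i + p + q) = insert i (Finset.Ico (i + 1) (i + p + q)) := by
        rw [Finset.insert_Ico_add_one_left_eq_Ico (by omega)]
      have hi : i ∉ Finset.Ico (i + 1) (i + p + q) := by simp
      rw [shuf_rec _ _ (by omega)]
      -- The subsets that do not contain i correspond to a first step of the second kind. The sign
      -- (-1)^p arises because the reference sum of the i + j now starts at i + 1 and grows by p.
      have hR : sg k (p : ℤ) • shuf κ p (q - 1) (i + 1) (C.sOp i x) y =
          ∑ S ∈ (Finset.Ico (i + 1) (i + p + q)).powersetCard p,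
          sg k (∑ s ∈ S, (s : ℤ) - ∑ j ∈ Finset.range p, ((i + j : ℕ) : ℤ)) •
          κ (C.sList (Finset.Ico i (i + p + q) \ S).sort x) (C'.sList S.sort y) := by
        rcases q with _ | q
        · rw [shuf_neg_right _ _ _ (by simp), Finset.powersetCard_eq_empty.2 (by simp; omega)]
          simp
        · rw [show ((q + 1 : ℕ) : ℤ) - 1 = q by push_cast; ring, ih p q (i + 1) (by omega),
            Finset.smul_sum, show i + 1 + p + q = i + p + (q + 1) by omega]
          refine Finset.sum_congr rfl fun S hS => ?_
          have hS := Finset.mem_powersetCard.1 hS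
          have hiS : i ∉ S := fun h => hi (hS.1 h)
          have e : Finset.Ico i (i + p + (q + 1)) \ S =
              insert i (Finset.Ico (i + 1) (i + p + (q + 1)) \ S) := by
            rw [hI, Finset.insert_sdiff_of_notMem _ hiS]
          rw [e, Finset.sort_insert, smul_smul, ← sg_add]
          · congr 1
            refine sg_eq_of_even _ ⟨0, ?_⟩
            have : ∑ j ∈ Finset.range p, ((i + 1 + j : ℕ) : ℤ) =
                ∑ j ∈ Finset.range p, ((i + j : ℕ) : ℤ) + p := by
              have h1 : ∀ j : ℕ, ((i + 1 + j : ℕ) : ℤ) = ((i + j : ℕ) : ℤ) + 1 := fun j => by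
                push_cast; ring
              simp only [h1, Finset.sum_add_distrib, Finset.sum_const, Finset.card_range,
                nsmul_eq_mul, mul_one]
            rw [this]; ring
          · intro b hb
            have := (Finset.mem_Ico.1 (Finset.mem_sdiff.1 hb).1).1
            omega
          · simp
      rw [hR]
      rcases p with _ | p
      · rw [shuf_neg_left _ _ _ (show ((0 : ℕ) : ℤ) - 1 < 0 by simp)]
        simp
      -- The remaining subsets are those containing i, that is, a first step of the first kind,
      -- which costs no sign.
      · have hd : Disjoint ((Finset.Ico (i + 1) (i + (p + 1) + q)).powersetCard (p + 1))
            (((Finset.Ico (i + 1) (i + (p + 1) + q)).powersetCard p).image (insert i)) := by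
          rw [Finset.disjoint_left]
          intro S hS hS'
          obtain ⟨S', _, rfl⟩ := Finset.mem_image.1 hS'
          exact hi ((Finset.mem_powersetCard.1 hS).1 (Finset.mem_insert_self _ _))
        rw [show (Finset.Ico i (i + (p + 1) + q)).powersetCard (p + 1) =
          (insert i (Finset.Ico (i + 1) (i + (p + 1) + q))).powersetCard (p + 1) by rw [← hI],
          Finset.powersetCard_succ_insert hi, Finset.sum_union hd, add_comm]
        congr 1
        rw [Finset.sum_image, show ((p + 1 : ℕ) : ℤ) - 1 = p by push_cast; ring,
          ih p q (i + 1) (by omega), show i + 1 + p + q = i + (p + 1) + q by omega]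
        · refine Finset.sum_congr rfl fun S hS => ?_
          have hS := Finset.mem_powersetCard.1 hS
          have hiS : i ∉ S := fun h => hi (hS.1 h)
          have e : Finset.Ico i (i + (p + 1) + q) \ insert i S =
              Finset.Ico (i + 1) (i + (p + 1) + q) \ S := by
            ext a
            simp only [Finset.mem_sdiff, Finset.mem_Ico, Finset.mem_insert]
            constructor
            · rintro ⟨h1, h2⟩
              exact ⟨⟨by omega, h1.2⟩, fun h => h2 (Or.inr h)⟩
            · rintro ⟨h1, h2⟩
              exact ⟨⟨by omega, h1.2⟩, fun h => h.elim (fun h => by omega) h2⟩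
          rw [e, Finset.sort_insert, Finset.sum_insert hiS, Finset.sum_range_succ']
          · congr 1
            refine sg_eq_of_even _ ⟨0, ?_⟩
            have : ∑ j ∈ Finset.range p, ((i + 1 + j : ℕ) : ℤ) =
                ∑ j ∈ Finset.range p, ((i + (j + 1) : ℕ) : ℤ) :=
              Finset.sum_congr rfl fun j _ => by push_cast; ring
            rw [this]; push_cast; ring
          · intro b hb
            have := (Finset.mem_Ico.1 (hS.1 hb)).1
            omega
          · exact hiS
        · intro S hS S' hS' hSS
          have h1 : i ∉ S := fun h => hi ((Finset.mem_powersetCard.1 hS).1 h)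
          have h2 : i ∉ S' := fun h => hi ((Finset.mem_powersetCard.1 hS').1 h)
          rw [← Finset.erase_insert h1, ← Finset.erase_insert h2]
          exact congrArg (fun T => Finset.erase T i) hSS
  exact key _ p q i rfl x y

end Sets

/-! ### Shuffle permutations -/

section Perm

variable {p q : ℕ} {σ : Equiv.Perm (Fin (p + q))}

theorem mem_shufL {a : ℕ} : a ∈ shufL p q σ ↔ ∃ i, (σ (Fin.castAdd q i) : ℕ) = a := by
  rw [shufL, List.mem_ofFn]

theorem mem_shufR {a : ℕ} : a ∈ shufR p q σ ↔ ∃ i, (σ (Fin.natAdd p i) : ℕ) = a := by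
  rw [shufR, List.mem_ofFn]

theorem sort_shufL (h : IsShuffle p q σ) : (shufL p q σ).toFinset.sort = shufL p q σ :=
  have hp := pairwise_ofFn _ h.1
  (List.toFinset_sort _ (hp.imp fun h => ne_of_lt h)).2 (hp.imp fun h => le_of_lt h)

theorem sort_shufR (h : IsShuffle p q σ) : (shufR p q σ).toFinset.sort = shufR p q σ :=
  have hp := pairwise_ofFn _ h.2
  (List.toFinset_sort _ (hp.imp fun h => ne_of_lt h)).2 (hp.imp fun h => le_of_lt h)

theorem shufR_toFinset :
    (shufR p q σ).toFinset = Finset.Ico 0 (p + q) \ (shufL p q σ).toFinset := by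
  ext a
  rw [List.mem_toFinset, Finset.mem_sdiff, List.mem_toFinset, mem_shufL, mem_shufR]
  constructor
  · rintro ⟨i, rfl⟩
    refine ⟨by simp, ?_⟩
    rintro ⟨j, hj⟩
    have := congrArg Fin.val (σ.injective (Fin.ext hj))
    simp at this
    omega
  · rintro ⟨ha, hn⟩
    have ha := (Finset.mem_Ico.1 ha).2
    obtain ⟨j, hj⟩ := σ.surjective ⟨a, ha⟩
    induction j using Fin.addCases with
    | left j => exact absurd ⟨j, by rw [hj]⟩ hn
    | right j => exact ⟨j, by rw [hj]⟩

theorem sum_shufL (h : IsShuffle p q σ) (f : ℕ → ℤ) :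
    ∑ s ∈ (shufL p q σ).toFinset, f s = ∑ i : Fin p, f (σ (Fin.castAdd q i)) := by
  have hp := pairwise_ofFn _ h.1
  rw [shufL, List.sum_toFinset _ (hp.imp fun h => ne_of_lt h), List.map_ofFn, List.sum_ofFn]
  rfl

/-- A shuffle has inversions only between its two blocks, and the i-th value of the first block
exceeds i by the number of values of the second block below it. -/
theorem sign_shuffle (h : IsShuffle p q σ) :
    ((Equiv.Perm.sign σ : ℤ) : k) = sg k (∑ s ∈ (shufL p q σ).toFinset, (s : ℤ) -
      ∑ j ∈ Finset.range p, ((0 + j : ℕ) : ℤ)) := by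
  have hle : ∀ i : Fin p, (i : ℕ) + (shufR p q σ).countP (· < (σ (Fin.castAdd q i) : ℕ)) =
      σ (Fin.castAdd q i) := fun i => by
    have h1 := countP_shuf p q σ (σ (Fin.castAdd q i))
    have h2 : (shufL p q σ).countP (· < (σ (Fin.castAdd q i) : ℕ)) = i :=
      countP_ofFn_strictMono _ h.1 i
    omega
  have hs : Equiv.Perm.sign σ = ∏ i : Fin p,
      (-1 : ℤˣ) ^ (shufR p q σ).countP (· < (σ (Fin.castAdd q i) : ℕ)) := by
    rw [Equiv.Perm.sign_eq_prod_prod_Ioi]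
    simp only [← Finset.prod_filter, ← Finset.filter_lt_eq_Ioi]
    simp only [Finset.prod_filter]
    rw [Fin.prod_univ_add, Finset.prod_eq_one (s := (Finset.univ : Finset (Fin q))), mul_one]
    · refine Finset.prod_congr rfl fun i _ => ?_
      rw [Fin.prod_univ_add, Finset.prod_eq_one, one_mul, shufR, countP_ofFn, ← Finset.prod_pow_eq_pow_sum]
      · refine Finset.prod_congr rfl fun j _ => ?_
        rw [if_pos (by rw [Fin.lt_def]; simp; omega)]
        have hne : σ (Fin.castAdd q i) ≠ σ (Fin.natAdd p j) := fun h => by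
          have := congrArg Fin.val (σ.injective h)
          simp at this
          omega
        rcases lt_or_gt_of_ne hne with hlt | hlt
        · rw [if_pos hlt, if_neg (by rw [Fin.lt_def] at hlt; omega), pow_zero]
        · rw [if_neg (not_lt_of_gt hlt), if_pos (Fin.lt_def.1 hlt), pow_one]
      · intro j _
        split_ifs with h1 h2
        · rfl
        · exact absurd (h.1 (Fin.lt_def.2 (by simpa using Fin.lt_def.1 h1))) h2
        · rfl
    · intro i _
      refine Finset.prod_eq_one fun j _ => ?_
      induction j using Fin.addCases with
      | left j => rw [if_neg (by rw [Fin.lt_def]; simp; omega)]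
      | right j =>
        split_ifs with h1 h2
        · rfl
        · exact absurd (h.2 (Fin.lt_def.2 (by simpa using Fin.lt_def.1 h1))) h2
        · rfl
  have hsum : ∀ (s : Finset (Fin p)) (f : Fin p → ℤ), sg k (∑ i ∈ s, f i) = ∏ i ∈ s, sg k (f i) := by
    intro s f
    induction s using Finset.induction_on with
    | empty => simp
    | insert a s ha ih => rw [Finset.sum_insert ha, Finset.prod_insert ha, sg_add, ih]
  rw [hs, sum_shufL h, Finset.sum_range fun j => ((0 + j : ℕ) : ℤ), ← Finset.sum_sub_distrib, hsum]
  push_cast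
  refine Finset.prod_congr rfl fun i _ => ?_
  rw [← sg_natCast]
  congr 1
  have := hle i
  omega

/-- The permutation lists S in increasing order and then its complement in increasing order. -/
theorem exists_shuffle {S : Finset ℕ} (hS : S ∈ (Finset.Ico 0 (p + q)).powersetCard p) :
    ∃ σ : Equiv.Perm (Fin (p + q)), IsShuffle p q σ ∧ (shufL p q σ).toFinset = S := by
  obtain ⟨hsub, hcard⟩ := Finset.mem_powersetCard.1 hS
  let S' : Finset (Fin (p + q)) := Finset.univ.filter fun i => (i : ℕ) ∈ S
  have hmap : S'.map Fin.valEmbedding = S := by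
    ext a
    simp only [S', Finset.mem_map, Finset.mem_filter, Finset.mem_univ, true_and,
      Fin.valEmbedding_apply]
    constructor
    · rintro ⟨i, hi, rfl⟩; exact hi
    · intro ha
      exact ⟨⟨a, (Finset.mem_Ico.1 (hsub ha)).2⟩, ha, rfl⟩
  have hm : S'.card = p := by
    rw [← hmap, Finset.card_map] at hcard; exact hcard
  have hn : S'ᶜ.card = q := by rw [Finset.card_compl, hm, Fintype.card_fin]; omega
  let σ : Equiv.Perm (Fin (p + q)) := finSumFinEquiv.symm.trans (finSumEquivOfFinset hm hn)
  have h1 : ∀ i, σ (Fin.castAdd q i) = S'.orderEmbOfFin hm i := fun i => by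
    simp [σ]
  have h2 : ∀ i, σ (Fin.natAdd p i) = S'ᶜ.orderEmbOfFin hn i := fun i => by
    simp [σ]
  refine ⟨σ, ⟨fun i j hij => ?_, fun i j hij => ?_⟩, ?_⟩
  · simpa only [h1] using (S'.orderEmbOfFin hm).strictMono hij
  · simpa only [h2] using (S'ᶜ.orderEmbOfFin hn).strictMono hij
  · rw [← hmap]
    ext a
    rw [List.mem_toFinset, mem_shufL, Finset.mem_map]
    constructor
    · rintro ⟨i, rfl⟩
      exact ⟨_, by rw [h1]; exact S'.orderEmbOfFin_mem hm i, rfl⟩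
    · rintro ⟨b, hb, rfl⟩
      have : b ∈ Set.range (S'.orderEmbOfFin hm) := by rw [Finset.range_orderEmbOfFin]; exact hb
      obtain ⟨i, rfl⟩ := this
      exact ⟨i, by rw [h1]; rfl⟩

theorem shufL_toFinset_mem (h : IsShuffle p q σ) :
    (shufL p q σ).toFinset ∈ (Finset.Ico 0 (p + q)).powersetCard p := by
  rw [Finset.mem_powersetCard]
  constructor
  · intro a ha
    rw [List.mem_toFinset, mem_shufL] at ha
    obtain ⟨i, rfl⟩ := ha
    simp
  · rw [shufL, List.toFinset_card_of_nodup ((pairwise_ofFn _ h.1).imp fun h => ne_of_lt h),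
      List.length_ofFn]

theorem shuffle_ext {τ : Equiv.Perm (Fin (p + q))} (h : IsShuffle p q σ) (h' : IsShuffle p q τ)
    (he : (shufL p q σ).toFinset = (shufL p q τ).toFinset) : σ = τ := by
  have hL : shufL p q σ = shufL p q τ := by rw [← sort_shufL h, ← sort_shufL h', he]
  have hR : shufR p q σ = shufR p q τ := by
    rw [← sort_shufR h, ← sort_shufR h', shufR_toFinset, shufR_toFinset, he]
  have e1 := List.ofFn_injective hL
  have e2 := List.ofFn_injective hR
  refine Equiv.ext fun i => Fin.ext ?_
  induction i using Fin.addCases with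
  | left i => exact congrFun e1 i
  | right i => exact congrFun e2 i

/-- The shuffle product is given by the recursively defined shuffles. -/
theorem sh_eq_shuf {C C' : CyclicModule.{u, v} k} {D : CyclicModule.{u, w} k}
    (ω : Pairing C C' D) (p q n : ℕ) (x : C.X p) (y : C'.X q) :
    ω.sh p q n x y =
      shuf ω.tot p q 0 (LinearMap.single k C.X p x) (LinearMap.single k C'.X q y) n := by
  rw [shuf_eq_sum, Pairing.sh, LinearMap.sum_apply, LinearMap.sum_apply, Finset.sum_apply,
    zero_add]
  -- A shuffle permutation is determined by the set of values of its first block, and every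
  -- p-element set occurs.
  refine Finset.sum_nbij (fun σ => (shufL p q σ).toFinset)
    (fun σ hσ => shufL_toFinset_mem (Finset.mem_filter.1 hσ).2)
    (fun σ hσ τ hτ h => shuffle_ext (Finset.mem_filter.1 (Finset.mem_coe.1 hσ)).2
      (Finset.mem_filter.1 (Finset.mem_coe.1 hτ)).2 h) (fun S hS => ?_) fun σ hσ => ?_
  · obtain ⟨σ, h, h'⟩ := exists_shuffle (Finset.mem_coe.1 hS)
    exact ⟨σ, Finset.mem_coe.2 (Finset.mem_filter.2 ⟨Finset.mem_univ _, h⟩), h'⟩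
  · have h := (Finset.mem_filter.1 hσ).2
    rw [← shufR_toFinset, sort_shufL h, sort_shufR h, LinearMap.smul_apply, LinearMap.smul_apply,
      sign_shuffle h]
    rfl

end Perm

/-! ### Degenerate elements, and the relations of a mixed complex -/

section Degenerate

variable (C : CyclicModule.{u, v} k)

/-- The degenerate elements of the product of all degrees. -/
def degT : Submodule k C.Total := Submodule.pi Set.univ C.degen

variable {C}

theorem mem_degT {x : C.Total} : x ∈ C.degT ↔ ∀ n, x n ∈ C.degen n := by
  simp [degT, Submodule.mem_pi]

theorem sOp_mem_degT (i : ℕ) (x : C.Total) : C.sOp i x ∈ C.degT := by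
  rw [mem_degT]
  rintro (_ | n)
  · exact Submodule.zero_mem _
  · rw [sOp_apply_succ]
    split
    · next h => exact s_mem_degen h _
    · exact Submodule.zero_mem _

/-- A linear map has values in `W` on the degenerate elements if it has on degeneracies. -/
theorem IsHomog.degT_induction {M : Type w} [AddCommGroup M] [Module k M] {n : ℕ} {x : C.Total}
    (hx : C.IsHomog n x) (hd : x n ∈ C.degen n) (f : C.Total →ₗ[k] M) (W : Submodule k M)
    (h : ∀ p, n = p + 1 → ∀ i ≤ p, ∀ x' : C.Total, C.IsHomog p x' → f (C.sOp i x') ∈ W) :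
    f x ∈ W := by
  rw [hx.eq_single]
  rcases n with _ | n
  · have : x 0 = 0 := hd
    rw [this]; simp
  · have hle : C.degen (n + 1) ≤ W.comap (f ∘ₗ LinearMap.single k C.X (n + 1)) := by
      refine degen_succ_le fun i hi z => ?_
      rw [Submodule.mem_comap, LinearMap.comp_apply, C.sOp_single i n hi]
      exact h n rfl i hi _ (isHomog_single n z)
    exact hle hd

/-- The cyclic operator preserves the span of the degenerate elements and the image of the extra
degeneracy, and a second extra degeneracy maps this span to degenerate elements. -/
theorem extra_norm_mem {n : ℕ} {x : C.X (n + 1)} (hx : x ∈ C.degenPlus n) :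
    C.extra (n + 1) (C.norm (n + 1) x) ∈ C.degen (n + 2) := by
  refine extra_degenPlus C n ?_
  rw [norm, LinearMap.sum_apply]
  refine Submodule.sum_mem _ fun i hi => ?_
  clear hi
  induction i with
  | zero => simpa using hx
  | succ i ih =>
    rw [pow_succ', Module.End.mul_apply]
    exact Submodule.smul_mem _ _ (t_degenPlus C n ih)

theorem bigB_loop_mem_degT (x : C.Total) : C.bigB (C.loop 0 x) ∈ C.degT := by
  rw [mem_degT]
  rintro (_ | _ | n)
  · exact Submodule.zero_mem _
  · rw [bigB_apply_succ]
    have : C.loop 0 x 0 = 0 := by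
      rw [loop_apply, rOp_apply, sOp_apply_zero, map_zero]
    rw [this, map_zero, map_zero]
    exact Submodule.zero_mem _
  · rw [bigB_apply_succ, loop_apply_succ]
    exact extra_norm_mem (Submodule.mem_sup_right ⟨_, rfl⟩)

/-- A loop based at a is a loop based at 0 of the rotated element, so all summands of Bx are loops
with the same base point. -/
theorem exists_bigB_eq_loop {p : ℕ} {x : C.Total} (hx : C.IsHomog p x) :
    ∃ y, C.IsHomog p y ∧ C.bigB x = C.loop 0 y := by
  refine ⟨∑ a ∈ Finset.range (p + 1), sg k (p * (a + 1)) • (C.rOp ^ a) x,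
    IsHomog.sum fun a _ => (hx.rOp_pow a).smul _, ?_⟩
  rw [bigB_eq_sum hx, map_sum]
  exact Finset.sum_congr rfl fun a _ => by rw [map_smul, ← loop_eq]

theorem bge_bge (x : C.Total) : C.bge 0 (C.bge 0 x) = 0 := by
  have hcomm : ∀ i (x : C.Total), C.dOp i (C.bge (i + 1) x) = C.bge i (C.dOp i x) := by
    intro i x
    funext n
    rw [dOp_apply, bge_apply]
    split
    · next h =>
      rw [bge_apply, map_sum, show n + 1 + 2 - (i + 1) = n + 2 - i by omega]
      refine Finset.sum_congr rfl fun e he => ?_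
      have he := Finset.mem_range.1 he
      rw [map_smul, dOp_apply, if_pos (by omega), show i + 1 + e = i + e + 1 by omega,
        C.d_d n i (i + e) (by omega) (by omega)]
    · next h => rw [bge_apply, show n + 2 - i = 0 by omega]; simp
  -- Expanding one face on each side, the mixed terms cancel by `hcomm`; so the square does not
  -- depend on the starting index i.
  have hstep : ∀ i (x : C.Total), C.bge i (C.bge i x) = C.bge (i + 1) (C.bge (i + 1) x) := by
    intro i x
    have h1 := hcomm i x
    have h2 := bge_eq i (C.bge i x)
    have h3 := bge_eq i x
    have h4 := bge_eq i (C.dOp i x)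
    rw [h2, h3, map_sub, map_sub, h1, h4]
    abel
  funext n
  have : ∀ i, C.bge 0 (C.bge 0 x) = C.bge i (C.bge i x) := by
    intro i
    induction i with
    | zero => rfl
    | succ i ih => rw [ih, hstep]
  -- For i = n + 2 no faces are left in degree n.
  rw [this (n + 2), bge_apply, show n + 2 - (n + 2) = 0 by omega]
  simp

/-- With a constant functional V the end terms in `sum_loop_boundary` cancel, since both are x. -/
theorem bge_bigB {p : ℕ} {x : C.Total} (hx : C.IsHomog p x) :
    C.bge 0 (C.bigB x) = -C.bigB (C.bge 0 x) := by
  have h := sum_loop_boundary hx (fun _ => LinearMap.id)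
  simp only [LinearMap.id_apply, sub_self, zero_sub] at h
  rw [bigB_eq_sum hx, map_sum]
  have e : ∀ a, C.bge 0 (sg k (p * ((a : ℕ) + 1)) • C.loop a x) = sg k (p * ((a : ℕ) + 1)) •
      (C.lo 0 (p - a + 1) (C.loop a x) + C.hi 0 (p - a + 1) (C.loop a x)) := fun a => by
    rw [CyclicModule.hi, LinearMap.sub_apply, map_smul]; congr 1; abel
  rw [Finset.sum_congr rfl fun a _ => e a, h]
  congr 1
  rcases p with _ | p
  · rw [(hx.bge 0).eq_zero (by simp)]; simp
  · rw [bigB_eq_sum (p := p) ((hx.bge 0).cast (by push_cast; ring))]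
    refine Finset.sum_congr rfl fun a _ => ?_
    congr 2; push_cast; ring

end Degenerate

/-! ### Degenerate values of shuffles and cyclic shuffles -/

section DegeneratePairing

variable {C C' : CyclicModule.{u, v} k} {D : CyclicModule.{u, w} k} (ω : Pairing C C' D)

/-- The doubled vertex lies among the p steps of the first kind. When the shuffle takes the step
between its two copies, y receives the same degeneracy, and a degeneracy common to both factors can
be pulled out. -/
theorem shuf_sOp_mem_left (p q : ℤ) (i e : ℕ) (he : (e : ℤ) < p) (x : C.Total) (y : C'.Total) :
    shuf ω.tot p q i (C.sOp (i + e) x) y ∈ D.degT := by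
  induction p, q using int_pair_induction generalizing i e x y with
  | negL p q hlt => omega
  | negR p q hlt => rw [shuf_neg_right _ _ _ hlt]; exact Submodule.zero_mem _
  | zero => omega
  | step p q hp hq hpq ih1 ih2 =>
    rw [shuf_rec _ _ hpq]
    refine Submodule.add_mem _ ?_ (Submodule.smul_mem _ _ ?_)
    · rcases e with _ | e
      · rw [add_zero, sOp_shuf ω _ _ _ le_rfl]
        exact sOp_mem_degT _ _
      · rw [show i + (e + 1) = i + 1 + e by omega]
        exact ih1 _ _ (by push_cast at he; omega) _ _
    · rw [C.sOp_sOp (by omega), show i + e + 1 = i + 1 + e by omega]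
      exact ih2 _ _ he _ _

theorem shuf_sOp_mem_right (p q : ℤ) (i e : ℕ) (he : (e : ℤ) < q) (x : C.Total) (y : C'.Total) :
    shuf ω.tot p q i x (C'.sOp (i + e) y) ∈ D.degT := by
  induction p, q using int_pair_induction generalizing i e x y with
  | negL p q hlt => rw [shuf_neg_left _ _ _ hlt]; exact Submodule.zero_mem _
  | negR p q hlt => omega
  | zero => omega
  | step p q hp hq hpq ih1 ih2 =>
    rw [shuf_rec _ _ hpq]
    refine Submodule.add_mem _ ?_ (Submodule.smul_mem _ _ ?_)
    · rw [C'.sOp_sOp (by omega), show i + e + 1 = i + 1 + e by omega]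
      exact ih1 _ _ he _ _
    · rcases e with _ | e
      · rw [add_zero, sOp_shuf ω _ _ _ le_rfl]
        exact sOp_mem_degT _ _
      · rw [show i + (e + 1) = i + 1 + e by omega]
        exact ih2 _ _ (by push_cast at he; omega) _ _

theorem part_sOp_mem_left (r s : ℕ) (p q : ℤ) (i e : ℕ) (he : (e : ℤ) < p) (x : C.Total)
    (y : C'.Total) : part ω.tot r s p q i (C.sOp (i + e) x) y ∈ D.degT := by
  fun_induction part ω.tot r s p q i generalizing e x y with
  | case1 s p q i => exact shuf_sOp_mem_left ω _ _ _ _ he _ _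
  | case2 => exact Submodule.zero_mem _
  | case3 r s p q i ih1 ih2 =>
    refine Submodule.add_mem _ ?_ (Submodule.smul_mem _ _ ?_)
    · change part ω.tot r (s + 1) (p - 1) q (i + 1) (C.sOp (i + e) x) (C'.sOp i y) ∈ _
      rcases e with _ | e
      · rw [add_zero, sOp_part ω _ _ _ _ _ le_rfl]
        exact sOp_mem_degT _ _
      · rw [show i + (e + 1) = i + 1 + e by omega]
        exact ih1 _ (by push_cast at he; omega) _ _
    · change part ω.tot (r + 1) s p (q - 1) (i + 1) (C.sOp i (C.sOp (i + e) x)) y ∈ _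
      rw [C.sOp_sOp (by omega), show i + e + 1 = i + 1 + e by omega]
      exact ih2 _ he _ _

theorem part_sOp_mem_right (r s : ℕ) (p q : ℤ) (i e : ℕ) (he : (e : ℤ) < q) (x : C.Total)
    (y : C'.Total) : part ω.tot r s p q i x (C'.sOp (i + e) y) ∈ D.degT := by
  fun_induction part ω.tot r s p q i generalizing e x y with
  | case1 s p q i => exact shuf_sOp_mem_right ω _ _ _ _ he _ _
  | case2 => exact Submodule.zero_mem _
  | case3 r s p q i ih1 ih2 =>
    refine Submodule.add_mem _ ?_ (Submodule.smul_mem _ _ ?_)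
    · change part ω.tot r (s + 1) (p - 1) q (i + 1) x (C'.sOp i (C'.sOp (i + e) y)) ∈ _
      rw [C'.sOp_sOp (by omega), show i + e + 1 = i + 1 + e by omega]
      exact ih1 _ he _ _
    · change part ω.tot (r + 1) s p (q - 1) (i + 1) (C.sOp i x) (C'.sOp (i + e) y) ∈ _
      rcases e with _ | e
      · rw [add_zero, sOp_part ω _ _ _ _ _ le_rfl]
        exact sOp_mem_degT _ _
      · rw [show i + (e + 1) = i + 1 + e by omega]
        exact ih2 _ (by push_cast at he; omega) _ _

/-- The loop of x has p + 1 steps; the bound e ≤ p puts the degeneracy within reach of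
`part_sOp_mem_left`. -/
theorem cyc_mem_left_of (p q : ℕ) (x : C.Total) (y : C'.Total)
    (h : ∀ a ≤ p, ∃ e ≤ p, ∃ z, C.loop a x = C.sOp e z) : cyc ω (p + 1) q x y ∈ D.degT := by
  rw [cyc_apply]
  refine Submodule.sum_mem _ fun a ha => Submodule.sum_mem _ fun b _ => Submodule.smul_mem _ _ ?_
  obtain ⟨e, he, z, hz⟩ := h a (by have := Finset.mem_range.1 ha; omega)
  rw [hz, ← zero_add e]
  exact part_sOp_mem_left ω _ _ _ _ _ _ (by push_cast; omega) _ _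

theorem cyc_mem_right_of (p q : ℕ) (x : C.Total) (y : C'.Total)
    (h : ∀ a ≤ q, ∃ e ≤ q, ∃ z, C'.loop a y = C'.sOp e z) : cyc ω p (q + 1) x y ∈ D.degT := by
  rw [cyc_apply]
  refine Submodule.sum_mem _ fun a _ => Submodule.sum_mem _ fun b hb => Submodule.smul_mem _ _ ?_
  obtain ⟨e, he, z, hz⟩ := h b (by have := Finset.mem_range.1 hb; omega)
  rw [hz, ← zero_add e]
  exact part_sOp_mem_right ω _ _ _ _ _ _ (by push_cast; omega) _ _

theorem cyc_degT_left {p : ℕ} (q : ℕ) {x : C.Total} (hx : C.IsHomog p x) (hd : x p ∈ C.degen p)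
    (y : C'.Total) : cyc ω (p + 1) q x y ∈ D.degT := by
  refine hx.degT_induction hd ((cyc ω (p + 1) q).flip y) _ fun m hm i hi x' hx' => ?_
  subst hm
  refine cyc_mem_left_of ω _ _ _ _ fun a ha => ?_
  obtain ⟨e, he, c, hc⟩ := exists_loop_sOp hx' a i hi ha
  exact ⟨e, he, _, hc⟩

theorem cyc_degT_right (p : ℕ) {q : ℕ} (x : C.Total) {y : C'.Total} (hy : C'.IsHomog q y)
    (hd : y q ∈ C'.degen q) : cyc ω p (q + 1) x y ∈ D.degT := by
  refine hy.degT_induction hd (cyc ω p (q + 1) x) _ fun m hm i hi x' hx' => ?_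
  subst hm
  refine cyc_mem_right_of ω _ _ _ _ fun a ha => ?_
  obtain ⟨e, he, c, hc⟩ := exists_loop_sOp hx' a i hi ha
  exact ⟨e, he, _, hc⟩

/-- Since Bx is a closed path, closing it up once more repeats a vertex. Hence only the ordinary
shuffle product with Bx survives in the normalized complex. -/
theorem cyc_bigB_left {p : ℕ} (q : ℕ) {x : C.Total} (hx : C.IsHomog p x) (y : C'.Total) :
    cyc ω (p + 2) q (C.bigB x) y ∈ D.degT := by
  obtain ⟨x', hx', h⟩ := exists_bigB_eq_loop hx
  refine cyc_mem_left_of ω _ _ _ _ fun a ha => ?_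
  obtain ⟨e, he, c, hc⟩ := loop_loop_zero hx' a ha
  exact ⟨e, he, _, by rw [h, hc]⟩

theorem cyc_bigB_right (p : ℕ) {q : ℕ} (x : C.Total) {y : C'.Total} (hy : C'.IsHomog q y) :
    cyc ω p (q + 2) x (C'.bigB y) ∈ D.degT := by
  obtain ⟨x', hx', h⟩ := exists_bigB_eq_loop hy
  refine cyc_mem_right_of ω _ _ _ _ fun a ha => ?_
  obtain ⟨e, he, c, hc⟩ := loop_loop_zero hx' a ha
  exact ⟨e, he, _, by rw [h, hc]⟩

theorem tot_loop (x : C.Total) (y : C'.Total) :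
    ω.tot (C.loop 0 x) (C'.loop 0 y) = D.loop 0 (ω.tot x y) := by
  simp only [loop_apply, pow_zero, Module.End.one_apply, sOp_tot, rOp_tot]

/-- Degeneracies turn loops based at 0 into loops based at 0, and the pairing of two such loops is
again one. -/
theorem shuf_loop_mem {m n : ℤ} (p q : ℤ) (i : ℕ) {x : C.Total} {y : C'.Total}
    (hx : C.IsHomog m x) (hy : C'.IsHomog n y) :
    shuf ω.tot p q i (C.loop 0 x) (C'.loop 0 y) ∈ LinearMap.range (D.loop 0) := by
  induction p, q using int_pair_induction generalizing i m n x y with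
  | negL p q hlt => rw [shuf_neg_left _ _ _ hlt]; exact Submodule.zero_mem _
  | negR p q hlt => rw [shuf_neg_right _ _ _ hlt]; exact Submodule.zero_mem _
  | zero => rw [shuf_zero, tot_loop]; exact ⟨_, rfl⟩
  | step p q hp hq hpq ih1 ih2 =>
    rw [shuf_rec _ _ hpq]
    refine Submodule.add_mem _ ?_ (Submodule.smul_mem _ _ ?_)
    · obtain ⟨y', hy', h⟩ := exists_sOp_loop hy i
      rw [h]; exact ih1 _ hx hy'
    · obtain ⟨x', hx', h⟩ := exists_sOp_loop hx i
      rw [h]; exact ih2 _ hx' hy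

theorem part_loop_mem {m n : ℤ} (r s : ℕ) (p q : ℤ) (i : ℕ) {x : C.Total} {y : C'.Total}
    (hx : C.IsHomog m x) (hy : C'.IsHomog n y) :
    part ω.tot r s p q i (C.loop 0 x) (C'.loop 0 y) ∈ LinearMap.range (D.loop 0) := by
  fun_induction part ω.tot r s p q i generalizing m n x y with
  | case1 s p q i => exact shuf_loop_mem ω _ _ _ hx hy
  | case2 => exact Submodule.zero_mem _
  | case3 r s p q i ih1 ih2 =>
    refine Submodule.add_mem _ ?_ (Submodule.smul_mem _ _ ?_)
    · obtain ⟨y', hy', h⟩ := exists_sOp_loop hy i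
      change part ω.tot r (s + 1) (p - 1) q (i + 1) (C.loop 0 x) (C'.sOp i (C'.loop 0 y)) ∈ _
      rw [h]; exact ih1 hx hy'
    · obtain ⟨x', hx', h⟩ := exists_sOp_loop hx i
      change part ω.tot (r + 1) s p (q - 1) (i + 1) (C.sOp i (C.loop 0 x)) (C'.loop 0 y) ∈ _
      rw [h]; exact ih2 hx' hy

/-- Every summand of the cyclic shuffle product is a closed path based at its first vertex, and B of
a closed path is degenerate. -/
theorem bigB_cyc_mem {m n : ℤ} (p q : ℕ) {x : C.Total} {y : C'.Total} (hx : C.IsHomog m x)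
    (hy : C'.IsHomog n y) : D.bigB (cyc ω p q x y) ∈ D.degT := by
  rw [cyc_apply, map_sum]
  refine Submodule.sum_mem _ fun a _ => ?_
  rw [map_sum]
  refine Submodule.sum_mem _ fun b _ => ?_
  rw [map_smul]
  refine Submodule.smul_mem _ _ ?_
  rw [loop_eq a, loop_eq b]
  obtain ⟨z, hz⟩ := part_loop_mem ω (p - a) (q - b) p q 0 (hx.rOp_pow a) (hy.rOp_pow b)
  rw [← hz]
  exact bigB_loop_mem_degT z

end DegeneratePairing

/-! ### Associativity and commutativity of shuffles -/

section Assoc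

variable {C C' C'' E E' : CyclicModule.{u, v} k}
  {D D' : CyclicModule.{u, w} k}

/-- A morphism of cyclic modules on the product of all degrees. -/
def Hom.fTotal (φ : Hom D D') : D.Total →ₗ[k] D'.Total :=
  LinearMap.pi fun m => φ.f m ∘ₗ LinearMap.proj m

/-- Associativity of shuffles. -/
theorem shuf_assoc (ω₁ : Pairing C C' E) (ω₂ : Pairing E C'' D) (ω₃ : Pairing C' C'' E')
    (ω₄ : Pairing C E' D') (φ : Hom D D')
    (h : ∀ n x y z, φ.f n (ω₂.f n (ω₁.f n x y) z) = ω₄.f n x (ω₃.f n y z))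
    (p q r : ℤ) (i : ℕ) (x : C.Total) (y : C'.Total) (z : C''.Total) :
    φ.fTotal (shuf ω₂.tot (p + q) r i (shuf ω₁.tot p q i x y) z) =
      shuf ω₄.tot p (q + r) i x (shuf ω₃.tot q r i y z) := by
  have key : ∀ n : ℕ, ∀ (p q r : ℤ) (i : ℕ) (x : C.Total) (y : C'.Total) (z : C''.Total),
      p + q + r < n → φ.fTotal (shuf ω₂.tot (p + q) r i (shuf ω₁.tot p q i x y) z) =
      shuf ω₄.tot p (q + r) i x (shuf ω₃.tot q r i y z) := by
    intro n
    induction n with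
    | zero =>
      intro p q r i x y z hn
      by_cases hp : p < 0
      · simp [shuf_neg_left _ _ _ hp]
      by_cases hq : q < 0
      · simp [shuf_neg_left _ _ _ hq, shuf_neg_right _ _ _ hq]
      · have hr : r < 0 := by push_cast at hn; omega
        simp [shuf_neg_right _ _ _ hr]
    | succ n ih =>
      intro p q r i x y z hn
      by_cases hp : p < 0
      · simp [shuf_neg_left _ _ _ hp]
      by_cases hq : q < 0
      · simp [shuf_neg_left _ _ _ hq, shuf_neg_right _ _ _ hq]
      by_cases hr : r < 0
      · simp [shuf_neg_right _ _ _ hr]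
      by_cases h0 : p + q + r = 0
      · obtain ⟨rfl, rfl, rfl⟩ : p = 0 ∧ q = 0 ∧ r = 0 := by omega
        rw [add_zero, shuf_zero, shuf_zero, shuf_zero, shuf_zero]
        funext n
        exact h n _ _ _
      -- A triple shuffle is determined by its first step, which belongs to one of the three
      -- factors; the other two factors receive s_i.
      have e1 := ih (p - 1) q r (i + 1) x (C'.sOp i y) (C''.sOp i z) (by push_cast at hn; omega)
      have e2 := ih p (q - 1) r (i + 1) (C.sOp i x) y (C''.sOp i z) (by push_cast at hn; omega)
      have e3 := ih p q (r - 1) (i + 1) (C.sOp i x) (C'.sOp i y) z (by push_cast at hn; omega)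
      -- The inner shuffle may have type (0, 0), where `shuf_rec` is not available; but then the
      -- outer one is zero because p + q - 1 is negative.
      have hL : shuf ω₂.tot (p + q - 1) r (i + 1) (shuf ω₁.tot p q i x y) (C''.sOp i z) =
          shuf ω₂.tot (p + q - 1) r (i + 1) (shuf ω₁.tot (p - 1) q (i + 1) x (C'.sOp i y) +
            sg k p • shuf ω₁.tot p (q - 1) (i + 1) (C.sOp i x) y) (C''.sOp i z) := by
        by_cases hpq : p = 0 ∧ q = 0
        · rw [shuf_neg_left _ _ _ (show p + q - 1 < 0 by omega)]; rfl
        · rw [shuf_rec _ _ hpq]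
      have hR : shuf ω₄.tot p (q + r - 1) (i + 1) (C.sOp i x) (shuf ω₃.tot q r i y z) =
          shuf ω₄.tot p (q + r - 1) (i + 1) (C.sOp i x)
            (shuf ω₃.tot (q - 1) r (i + 1) y (C''.sOp i z) +
            sg k q • shuf ω₃.tot q (r - 1) (i + 1) (C'.sOp i y) z) := by
        by_cases hqr : q = 0 ∧ r = 0
        · rw [shuf_neg_right _ _ _ (show q + r - 1 < 0 by omega)]; rfl
        · rw [shuf_rec _ _ hqr]
      rw [shuf_rec ω₂.tot _ (by omega), shuf_rec ω₄.tot _ (by omega), hL, hR,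
        ← sOp_shuf ω₁ _ _ _ le_rfl, ← sOp_shuf ω₃ _ _ _ le_rfl]
      rw [show p - 1 + q = p + q - 1 by ring] at e1
      rw [show p + (q - 1) = p + q - 1 by ring, show q - 1 + r = q + r - 1 by ring] at e2
      rw [show q + (r - 1) = q + r - 1 by ring] at e3
      simp only [map_add, map_smul, LinearMap.add_apply, LinearMap.smul_apply, e1, e2, e3, sg_add,
        smul_add, smul_smul]
      abel
  exact key (p + q + r + 1).toNat p q r i x y z (by omega)

/-- Commutativity of shuffles. -/
theorem shuf_comm (ω : Pairing C C' D') (ω' : Pairing C' C D) (φ : Hom D D')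
    (h : ∀ n x y, φ.f n (ω'.f n y x) = ω.f n x y) (p q : ℤ) (i : ℕ) (x : C.Total)
    (y : C'.Total) :
    φ.fTotal (shuf ω'.tot q p i y x) = sg k (p * q) • shuf ω.tot p q i x y := by
  induction p, q using int_pair_induction generalizing i x y with
  | negL p q hlt => simp [shuf_neg_right _ _ _ hlt, shuf_neg_left _ _ _ hlt]
  | negR p q hlt => simp [shuf_neg_right _ _ _ hlt, shuf_neg_left _ _ _ hlt]
  | zero =>
    rw [shuf_zero, shuf_zero, mul_zero, sg_zero, one_smul]
    funext n
    exact h n _ _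
  | step p q hp hq hpq ih1 ih2 =>
    rw [shuf_rec _ _ hpq, shuf_rec _ _ (fun h => hpq h.symm), map_add, map_smul, ih1, ih2,
      smul_add, smul_smul, smul_smul, ← sg_add, ← sg_add, add_comm]
    congr 2
    · congr 1; ring
    · exact sg_eq_of_even _ ⟨-p, by ring⟩

end Assoc

/-! ### The untruncated operator b + B on normalized complexes -/

section Normalized

variable (C : CyclicModule.{u, v} k)

/-- The product of all terms of the normalized complex. -/
abbrev NTotal : Type v := ∀ m, C.NX m

/-- The projection to the normalized complex. -/
def toN : C.Total →ₗ[k] C.NTotal := LinearMap.pi fun m => (C.degen m).mkQ ∘ₗ LinearMap.proj m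

/-- The operator `b + B` on the product of all degrees. -/
def dN : C.NTotal →ₗ[k] C.NTotal := LinearMap.pi C.bB

variable {C}

theorem toN_apply (x : C.Total) (m : ℕ) : C.toN x m = Submodule.Quotient.mk (x m) := rfl

theorem toN_eq_zero {x : C.Total} : C.toN x = 0 ↔ x ∈ C.degT := by
  rw [mem_degT, funext_iff]
  exact forall_congr' fun m => Submodule.Quotient.mk_eq_zero _

theorem toN_single (p : ℕ) (x : C.X p) :
    C.toN (LinearMap.single k C.X p x) =
      LinearMap.single k C.NX p (Submodule.Quotient.mk x) := by
  funext m
  rw [toN_apply, LinearMap.single_apply, LinearMap.single_apply]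
  by_cases h : m = p
  · subst h; rw [Pi.single_eq_same, Pi.single_eq_same]
  · rw [Pi.single_eq_of_ne h, Pi.single_eq_of_ne h]; rfl

theorem exists_toN_eq_single (p : ℕ) (ξ : C.NX p) :
    ∃ x : C.Total, C.IsHomog p x ∧ C.toN x = LinearMap.single k C.NX p ξ := by
  induction ξ using Submodule.Quotient.induction_on with
  | H ξ => exact ⟨_, isHomog_single p ξ, toN_single p ξ⟩

/-- The difference is λ applied to an extra degeneracy, and t t s_n = s_0 t. -/
theorem mk_connes (n : ℕ) (x : C.X n) :
    (Submodule.Quotient.mk (C.connes n x) : C.NX (n + 1)) =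
      Submodule.Quotient.mk (C.extra n (C.norm n x)) := by
  rw [Submodule.Quotient.eq, connes, LinearMap.comp_apply, LinearMap.comp_apply,
    LinearMap.sub_apply, LinearMap.id_apply, sub_sub_cancel_left, lam, LinearMap.smul_apply,
    extra, LinearMap.comp_apply, ← C.s_t_zero]
  exact Submodule.neg_mem _ (Submodule.smul_mem _ _ (s_mem_degen (Nat.zero_le _) _))

theorem dN_toN (x : C.Total) : C.dN (C.toN x) = C.toN (C.bge 0 x + C.bigB x) := by
  funext m
  rw [toN_apply, Pi.add_apply, Submodule.Quotient.mk_add, bge_zero_apply]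
  cases m with
  | zero => rw [bigB_apply_zero, Submodule.Quotient.mk_zero, add_zero]; rfl
  | succ m =>
    rw [bigB_apply_succ, ← mk_connes]
    rfl

theorem bigB_bigB_mem_degT {p : ℕ} {x : C.Total} (hx : C.IsHomog p x) :
    C.bigB (C.bigB x) ∈ C.degT := by
  obtain ⟨y, _, h⟩ := exists_bigB_eq_loop hx
  rw [h]
  exact bigB_loop_mem_degT y

theorem dN_dN_toN {p : ℕ} {x : C.Total} (hx : C.IsHomog p x) : C.dN (C.dN (C.toN x)) = 0 := by
  rw [dN_toN, dN_toN, toN_eq_zero, map_add, map_add, bge_bge, bge_bigB hx, zero_add,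
    neg_add_cancel_left]
  exact bigB_bigB_mem_degT hx

theorem eq_sum_single {p : ℕ} {x : C.NTotal} (hx : x ∈ C.Tot p) :
    x = ∑ j ∈ Finset.range (p + 1), LinearMap.single k C.NX j (x j) := by
  funext m
  rw [Finset.sum_apply]
  by_cases h : m ≤ p
  · rw [Finset.sum_eq_single_of_mem m (by simpa using h), LinearMap.single_apply,
      Pi.single_eq_same]
    intro j _ hj
    rw [LinearMap.single_apply, Pi.single_eq_of_ne hj.symm]
  · rw [hx m (by omega)]
    refine (Finset.sum_eq_zero fun j hj => ?_).symm
    have := Finset.mem_range.1 hj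
    rw [LinearMap.single_apply, Pi.single_eq_of_ne (by omega)]

/-- Linear statements on the total complex may be checked on homogeneous elements. -/
theorem tot_induction {p : ℕ} {x : C.NTotal} (hx : x ∈ C.Tot p) {V : Type*} [AddCommGroup V]
    [Module k V] (f g : C.NTotal →ₗ[k] V)
    (h : ∀ j ≤ p, Even (p - j) → ∀ z : C.Total, C.IsHomog j z → f (C.toN z) = g (C.toN z)) :
    f x = g x := by
  rw [eq_sum_single hx, map_sum, map_sum]
  refine Finset.sum_congr rfl fun j hj => ?_
  have hj := Finset.mem_range.1 hj
  by_cases he : Even (p - j)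
  · obtain ⟨z, hz, e⟩ := exists_toN_eq_single j (x j)
    rw [← e]
    exact h j (by omega) he z hz
  · rw [hx j (fun h => he h.2), map_zero, map_zero, map_zero]

theorem dN_dN {p : ℕ} {x : C.NTotal} (hx : x ∈ C.Tot p) : C.dN (C.dN x) = 0 :=
  tot_induction hx (C.dN ∘ₗ C.dN) 0 fun _ _ _ _ hz => dN_dN_toN hz

theorem dTot_apply (n : ℕ) (x : C.NTotal) (m : ℕ) :
    C.dTot n x m = if m < n then C.dN x m else 0 := by
  rw [dTot, LinearMap.pi_apply]
  split <;> rfl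

/-- The differential of Tot_p is cut off at degree p, where it forgets B x_p. Keeping this term is
what makes ⋆ visible: for a cycle it is all that is left of (b + B) x. -/
theorem dN_eq {p : ℕ} {x : C.NTotal} (hx : x ∈ C.Tot p) :
    C.dN x = C.dTot p x + LinearMap.single k C.NX (p + 1) (C.BN p (x p)) := by
  funext m
  rw [Pi.add_apply, dTot_apply, LinearMap.single_apply]
  by_cases h : m < p
  · rw [if_pos h, Pi.single_eq_of_ne (by omega), add_zero]
  rw [if_neg h, zero_add]
  have hb : C.bN m (x (m + 1)) = 0 := by rw [hx (m + 1) (by omega), map_zero]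
  cases m with
  | zero =>
    rw [Pi.single_eq_of_ne (by omega)]
    exact hb
  | succ m =>
    change C.bN (m + 1) (x (m + 2)) + C.BN m (x m) = _
    rw [hb, zero_add]
    by_cases h' : m = p
    · subst h'; rw [Pi.single_eq_same]
    · rw [Pi.single_eq_of_ne (by omega), hx m, map_zero]
      rintro ⟨h1, a, h2⟩
      omega

theorem dN_eq_of_mem_cycles {p : ℕ} {x : C.NTotal} (hx : x ∈ C.cycles p) :
    C.dN x = LinearMap.single k C.NX (p + 1) (C.BN p (x p)) := by
  rw [dN_eq hx.1, LinearMap.mem_ker.1 hx.2, zero_add]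

theorem single_mem_Tot {p n : ℕ} (h : p ≤ n) (h' : Even (n - p)) (ξ : C.NX p) :
    LinearMap.single k C.NX p ξ ∈ C.Tot n := by
  intro m hm
  rw [LinearMap.single_apply, Pi.single_eq_of_ne]
  rintro rfl
  exact hm ⟨h, h'⟩

end Normalized

/-! ### The Eilenberg-Zilber formula for b + B -/

section NormalizedPairing

variable {C C' : CyclicModule.{u, v} k} {D : CyclicModule.{u, w} k} (ω : Pairing C C' D)

theorem toN_shuf_eq_zero_left {p q : ℕ} {x : C.Total} (hx : C.IsHomog p x)
    (hd : x p ∈ C.degen p) {y : C'.Total} (hy : C'.IsHomog q y) :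
    shuf ω.tot p q 0 x y ∈ D.degT := by
  rw [mem_degT, hx.eq_single, hy.eq_single]
  intro m
  rw [← sh_eq_shuf]
  exact ω.sh_degen_left p q m _ hd _

theorem toN_shuf_eq_zero_right {p q : ℕ} {x : C.Total} (hx : C.IsHomog p x)
    {y : C'.Total} (hy : C'.IsHomog q y) (hd : y q ∈ C'.degen q) :
    shuf ω.tot p q 0 x y ∈ D.degT := by
  rw [mem_degT, hx.eq_single, hy.eq_single]
  intro m
  rw [← sh_eq_shuf]
  exact ω.sh_degen_right p q m _ _ hd

/-- The sum of the shuffle and the cyclic shuffle products. -/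
def eilenberg (p q : ℕ) : C.Total →ₗ[k] C'.Total →ₗ[k] D.Total :=
  shuf ω.tot (p - 1) (q - 1) 0 + sg k (p - 1) • cyc ω p q

theorem eilenberg_apply (p q : ℕ) (x : C.Total) (y : C'.Total) :
    eilenberg ω p q x y = shuf ω.tot (p - 1) (q - 1) 0 x y + sg k (p - 1) • cyc ω p q x y := rfl

theorem eilenberg_degT_left {p q : ℕ} {x : C.Total} (hx : C.IsHomog p x)
    (hd : x p ∈ C.degen p) {y : C'.Total} (hy : C'.IsHomog q y) :
    eilenberg ω (p + 1) (q + 1) x y ∈ D.degT := by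
  rw [eilenberg_apply]
  refine Submodule.add_mem _ ?_ (Submodule.smul_mem _ _ (cyc_degT_left ω _ hx hd y))
  have := toN_shuf_eq_zero_left ω hx hd hy
  rwa [show ((p + 1 : ℕ) : ℤ) - 1 = p by push_cast; ring,
    show ((q + 1 : ℕ) : ℤ) - 1 = q by push_cast; ring]

theorem eilenberg_degT_right {p q : ℕ} {x : C.Total} (hx : C.IsHomog p x)
    {y : C'.Total} (hy : C'.IsHomog q y) (hd : y q ∈ C'.degen q) :
    eilenberg ω (p + 1) (q + 1) x y ∈ D.degT := by
  rw [eilenberg_apply]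
  refine Submodule.add_mem _ ?_ (Submodule.smul_mem _ _ (cyc_degT_right ω _ x hy hd))
  have := toN_shuf_eq_zero_right ω hx hy hd
  rwa [show ((p + 1 : ℕ) : ℤ) - 1 = p by push_cast; ring,
    show ((q + 1 : ℕ) : ℤ) - 1 = q by push_cast; ring]

/-- The components of the sum of the shuffle and cyclic shuffle products on normalized
complexes. -/
def eilenbergN (p q n : ℕ) : C.NX p →ₗ[k] C'.NX q →ₗ[k] D.NX n :=
  let e : C.X p →ₗ[k] C'.X q →ₗ[k] D.NX n :=
    ((eilenberg ω (p + 1) (q + 1)).compl₁₂ (LinearMap.single k C.X p)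
      (LinearMap.single k C'.X q)).compr₂ ((D.degen n).mkQ ∘ₗ LinearMap.proj n)
  (C.degen p).liftQ
    (LinearMap.flip <| (C'.degen q).liftQ e.flip fun y hy => by
        ext x
        exact (Submodule.Quotient.mk_eq_zero _).2 (mem_degT.1 (eilenberg_degT_right ω
          (isHomog_single p x) (isHomog_single q y) (by simpa using hy)) n))
    fun x hx => by
      ext y
      exact (Submodule.Quotient.mk_eq_zero _).2 (mem_degT.1 (eilenberg_degT_left ω
        (isHomog_single p x) (by simpa using hx) (isHomog_single q y)) n)

theorem eilenbergN_mk (p q n : ℕ) (x : C.X p) (y : C'.X q) :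
    eilenbergN ω p q n (Submodule.Quotient.mk x) (Submodule.Quotient.mk y) =
      Submodule.Quotient.mk (eilenberg ω (p + 1) (q + 1) (LinearMap.single k C.X p x)
        (LinearMap.single k C'.X q y) n) := rfl

theorem cross_of_ne {p q n : ℕ} (h : n ≠ p + q) (x : C.NX p) (y : C'.NX q) :
    ω.cross p q n x y = 0 := by
  induction x using Submodule.Quotient.induction_on with
  | H x =>
    induction y using Submodule.Quotient.induction_on with
    | H y =>
      rw [ω.cross_mk, sh_eq_shuf, shuf_isHomog ω (n := p + q) p q 0 _ _
        ((isHomog_single p x).cast (by ring)) n (by omega), Submodule.Quotient.mk_zero]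

/-- The two parts live in degrees p + q and p + q + 2. In particular only i, j ≤ m contribute in
degree m, so the finite sums in `eilT` lose nothing. -/
theorem eilenbergN_of_ne {p q n : ℕ} (h : n ≠ p + q) (h' : n ≠ p + q + 2) (x : C.NX p)
    (y : C'.NX q) : eilenbergN ω p q n x y = 0 := by
  induction x using Submodule.Quotient.induction_on with
  | H x =>
    induction y using Submodule.Quotient.induction_on with
    | H y =>
      rw [eilenbergN_mk, eilenberg_apply, Pi.add_apply, Pi.smul_apply,
        shuf_isHomog ω (n := p + q) _ _ 0 _ _
        ((isHomog_single p x).cast (by push_cast; ring)) n (by omega),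
        cyc_isHomog ω (n := p + q + 2) (p + 1) (q + 1) _ _
        ((isHomog_single p x).cast (by push_cast; ring)) n (by omega), smul_zero, add_zero,
        Submodule.Quotient.mk_zero]

/-- The cyclic part is degenerate by `cyc_bigB_left`. -/
theorem eilenbergN_BN_left (p q n : ℕ) (x : C.NX p) (y : C'.NX q) :
    eilenbergN ω (p + 1) q n (C.BN p x) y = ω.cross (p + 1) q n (C.BN p x) y := by
  induction x using Submodule.Quotient.induction_on with
  | H x =>
    induction y using Submodule.Quotient.induction_on with
    | H y =>
      have hB : C.BN p (Submodule.Quotient.mk x) = Submodule.Quotient.mk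
          (C.bigB (LinearMap.single k C.X p x) (p + 1)) := by
        rw [bigB_apply_succ, ← mk_connes, LinearMap.single_apply, Pi.single_eq_same]; rfl
      have hh := (isHomog_single p x).bigB
      have hc := cyc_bigB_left ω (q + 1) (isHomog_single p x) (LinearMap.single k C'.X q y)
      rw [hB, eilenbergN_mk, ω.cross_mk, sh_eq_shuf,
        ← IsHomog.eq_single (hh.cast (by push_cast; ring)), eilenberg_apply, Pi.add_apply, Submodule.Quotient.mk_add, Pi.smul_apply,
        (Submodule.Quotient.mk_eq_zero (p := D.degen n)).2
          (Submodule.smul_mem _ _ (mem_degT.1 hc n)), add_zero]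
      rw [show ((p + 1 + 1 : ℕ) : ℤ) - 1 = ((p + 1 : ℕ) : ℤ) by push_cast; ring,
        show ((q + 1 : ℕ) : ℤ) - 1 = q by push_cast; ring]

theorem eilenbergN_BN_right (p q n : ℕ) (x : C.NX p) (y : C'.NX q) :
    eilenbergN ω p (q + 1) n x (C'.BN q y) = ω.cross p (q + 1) n x (C'.BN q y) := by
  induction x using Submodule.Quotient.induction_on with
  | H x =>
    induction y using Submodule.Quotient.induction_on with
    | H y =>
      have hB : C'.BN q (Submodule.Quotient.mk y) = Submodule.Quotient.mk
          (C'.bigB (LinearMap.single k C'.X q y) (q + 1)) := by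
        rw [bigB_apply_succ, ← mk_connes, LinearMap.single_apply, Pi.single_eq_same]; rfl
      have hh := (isHomog_single q y).bigB
      have hc := cyc_bigB_right ω (p + 1) (LinearMap.single k C.X p x) (isHomog_single q y)
      rw [hB, eilenbergN_mk, ω.cross_mk, sh_eq_shuf,
        ← IsHomog.eq_single (hh.cast (by push_cast; ring)), eilenberg_apply, Pi.add_apply, Submodule.Quotient.mk_add, Pi.smul_apply,
        (Submodule.Quotient.mk_eq_zero (p := D.degen n)).2
          (Submodule.smul_mem _ _ (mem_degT.1 hc n)), add_zero]
      rw [show ((p + 1 : ℕ) : ℤ) - 1 = p by push_cast; ring,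
        show ((q + 1 + 1 : ℕ) : ℤ) - 1 = ((q + 1 : ℕ) : ℤ) by push_cast; ring]

/-- The sum of the shuffle and cyclic shuffle products on the product of all degrees of the
normalized complexes. -/
def eilT : C.NTotal →ₗ[k] C'.NTotal →ₗ[k] D.NTotal :=
  LinearMap.mk₂ k
    (fun x y m => ∑ i ∈ Finset.range (m + 1), ∑ j ∈ Finset.range (m + 1),
      eilenbergN ω i j m (x i) (y j))
    (fun x x' y => by funext m; simp [Finset.sum_add_distrib])
    (fun c x y => by funext m; simp [Finset.smul_sum])
    (fun x y y' => by funext m; simp [Finset.sum_add_distrib])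
    (fun c x y => by funext m; simp [Finset.smul_sum])

theorem eilT_apply (x : C.NTotal) (y : C'.NTotal) (m : ℕ) :
    eilT ω x y m = ∑ i ∈ Finset.range (m + 1), ∑ j ∈ Finset.range (m + 1),
      eilenbergN ω i j m (x i) (y j) := rfl

theorem eilT_single_left {p : ℕ} (x : C.NX p) (y : C'.NTotal) (m : ℕ) :
    eilT ω (LinearMap.single k C.NX p x) y m =
      ∑ j ∈ Finset.range (m + 1), eilenbergN ω p j m x (y j) := by
  rw [eilT_apply]
  by_cases h : p ≤ m
  · rw [Finset.sum_eq_single_of_mem p (by simpa [Nat.lt_succ_iff] using h)]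
    · simp
    · intro i _ hi
      simp [Pi.single_eq_of_ne hi]
  · rw [Finset.sum_eq_zero, Finset.sum_eq_zero]
    · intro j _
      exact eilenbergN_of_ne ω (by omega) (by omega) _ _
    · intro i hi
      have := Finset.mem_range.1 hi
      simp [Pi.single_eq_of_ne (show i ≠ p by omega)]

theorem eilT_single_right {q : ℕ} (x : C.NTotal) (y : C'.NX q) (m : ℕ) :
    eilT ω x (LinearMap.single k C'.NX q y) m =
      ∑ i ∈ Finset.range (m + 1), eilenbergN ω i q m (x i) y := by
  rw [eilT_apply, Finset.sum_comm]
  by_cases h : q ≤ m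
  · rw [Finset.sum_eq_single_of_mem q (by simpa [Nat.lt_succ_iff] using h)]
    · simp
    · intro i _ hi
      simp [Pi.single_eq_of_ne hi]
  · rw [Finset.sum_eq_zero, Finset.sum_eq_zero]
    · intro j _
      exact eilenbergN_of_ne ω (by omega) (by omega) _ _
    · intro i hi
      have := Finset.mem_range.1 hi
      simp [Pi.single_eq_of_ne (show i ≠ q by omega)]

theorem eilT_single_single {p q : ℕ} (x : C.NX p) (y : C'.NX q) (m : ℕ) :
    eilT ω (LinearMap.single k C.NX p x) (LinearMap.single k C'.NX q y) m =
      eilenbergN ω p q m x y := by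
  rw [eilT_single_left]
  by_cases h : q ≤ m
  · rw [Finset.sum_eq_single_of_mem q (by simpa [Nat.lt_succ_iff] using h)]
    · simp
    · intro i _ hi
      simp [Pi.single_eq_of_ne hi]
  · rw [Finset.sum_eq_zero, eilenbergN_of_ne ω (by omega) (by omega)]
    intro i hi
    have := Finset.mem_range.1 hi
    simp [Pi.single_eq_of_ne (show i ≠ q by omega)]

/-- Since p and q count vertices, the value 0 is allowed and stands for degree -1, where elements
vanish; this covers b of an element of degree zero without a separate case. -/
theorem eilT_toN {p q : ℕ} {x : C.Total} {y : C'.Total} (hx : C.IsHomog ((p : ℤ) - 1) x)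
    (hy : C'.IsHomog ((q : ℤ) - 1) y) :
    eilT ω (C.toN x) (C'.toN y) = D.toN (eilenberg ω p q x y) := by
  rcases p with _ | p
  · rw [hx.eq_zero (by simp), map_zero, map_zero, map_zero]
    simp
  rcases q with _ | q
  · rw [hy.eq_zero (by simp), map_zero, map_zero, map_zero, map_zero]
  have hx := (hx.cast (n := p) (by push_cast; ring)).eq_single
  have hy := (hy.cast (n := q) (by push_cast; ring)).eq_single
  rw [hx, hy, toN_single, toN_single]
  funext m
  rw [eilT_single_single]
  rfl

/-- The type (0, 0), which `bge_shuf` excludes, is harmless for i = 0: all terms are zero for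
reasons of degree. -/
theorem bge_shuf_zero {p q : ℕ} {x : C.Total} {y : C'.Total} (hx : C.IsHomog p x)
    (hy : C'.IsHomog q y) :
    D.bge 0 (shuf ω.tot p q 0 x y) = shuf ω.tot (p - 1) q 0 (C.bge 0 x) y +
      sg k p • shuf ω.tot p (q - 1) 0 x (C'.bge 0 y) := by
  by_cases h : (p : ℤ) = 0 ∧ (q : ℤ) = 0
  · rw [shuf_neg_left _ _ _ (show (p : ℤ) - 1 < 0 by omega),
      shuf_neg_right _ _ _ (show (q : ℤ) - 1 < 0 by omega),
      ((shuf_isHomog ω (n := p + q) p q 0 x y (hx.cast (by ring))).bge 0).eq_zero (by omega)]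
    simp
  · exact bge_shuf ω 0 h (hx.cast (by simp)) (hy.cast (by simp))

/-- The derivation property of the shuffle product and the boundary formula of the cyclic one
account for every term except three, which are degenerate. -/
theorem dN_eilT_toN {p q : ℕ} {x : C.Total} {y : C'.Total} (hx : C.IsHomog p x)
    (hy : C'.IsHomog q y) :
    D.dN (eilT ω (C.toN x) (C'.toN y)) =
      eilT ω (C.dN (C.toN x)) (C'.toN y) + sg k p • eilT ω (C.toN x) (C'.dN (C'.toN y)) := by
  have hx1 : C.IsHomog (((p + 1 : ℕ) : ℤ) - 1) x := hx.cast (by push_cast; ring)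
  have hy1 : C'.IsHomog (((q + 1 : ℕ) : ℤ) - 1) y := hy.cast (by push_cast; ring)
  have hx2 : C.IsHomog (((p + 2 : ℕ) : ℤ) - 1) (C.bigB x) := hx.bigB.cast (by push_cast; ring)
  have hy2 : C'.IsHomog (((q + 2 : ℕ) : ℤ) - 1) (C'.bigB y) := hy.bigB.cast (by push_cast; ring)
  rw [dN_toN x, dN_toN y, (C.toN).map_add, (C'.toN).map_add, map_add, map_add,
    LinearMap.add_apply, eilT_toN ω hx1 hy1,
    eilT_toN ω (hx.bge 0) hy1, eilT_toN ω hx1 (hy.bge 0), eilT_toN ω hx2 hy1, eilT_toN ω hx1 hy2,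
    dN_toN, ← map_add, ← map_add, ← map_smul, ← map_add, ← sub_eq_zero, ← map_sub, toN_eq_zero]
  have h1 := bge_shuf_zero ω hx hy
  have h2 := bge_cyc ω hx hy
  have m1 := cyc_bigB_left ω (q + 1) hx y
  have m2 := cyc_bigB_right ω (p + 1) x hy
  have m3 := bigB_cyc_mem ω (p + 1) (q + 1) hx hy
  -- This combination of B(x ×' y), Bx ×' y and x ×' By is exactly the difference of the two sides
  -- of the formula once `h1` and `h2` have been inserted.
  have m := Submodule.sub_mem _ (Submodule.add_mem _ (Submodule.smul_mem _ (sg k p) m3)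
    (Submodule.smul_mem _ (sg k p) m1)) m2
  have c1 : ((p + 1 : ℕ) : ℤ) - 1 = p := by push_cast; ring
  have c2 : ((q + 1 : ℕ) : ℤ) - 1 = q := by push_cast; ring
  have c3 : ((p + 2 : ℕ) : ℤ) - 1 = p + 1 := by push_cast; ring
  have c4 : ((q + 2 : ℕ) : ℤ) - 1 = q + 1 := by push_cast; ring
  have hs := sg_mul_self (k := k) p
  simp only [eilenberg_apply, c1, c2, c3, c4]
  simp only [map_add, map_smul, h1, h2, sg_succ, sg_pred]
  convert m using 1
  match_scalars <;> first | ring1 | linear_combination hs | linear_combination -hs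

/-- The sum of the shuffle and cyclic shuffle products is compatible with the differentials. -/
theorem dN_eilT {p q : ℕ} {x : C.NTotal} {y : C'.NTotal} (hx : x ∈ C.Tot p)
    (hy : y ∈ C'.Tot q) :
    D.dN (eilT ω x y) = eilT ω (C.dN x) y + sg k p • eilT ω x (C'.dN y) := by
  refine tot_induction hx (D.dN ∘ₗ (eilT ω).flip y)
    ((eilT ω).flip y ∘ₗ C.dN + sg k p • (eilT ω).flip (C'.dN y)) fun i hi he z hz => ?_
  refine tot_induction hy (D.dN ∘ₗ eilT ω (C.toN z))
    (eilT ω (C.dN (C.toN z)) + sg k p • eilT ω (C.toN z) ∘ₗ C'.dN) fun j _ _ w hw => ?_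
  -- All components of an element of Tot_p have degrees of the same parity, so one sign serves for
  -- all of them.
  have hs : sg k (p : ℤ) = sg k (i : ℤ) :=
    sg_eq_of_even _ (by rw [← Nat.cast_sub hi, Int.even_coe_nat]; exact he)
  rw [hs]
  exact dN_eilT_toN ω hz hw

theorem eilT_mem_Tot {p q : ℕ} {x : C.NTotal} {y : C'.NTotal} (hx : x ∈ C.Tot p)
    (hy : y ∈ C'.Tot q) : eilT ω x y ∈ D.Tot (p + q + 2) := by
  intro m hm
  rw [eilT_apply]
  refine Finset.sum_eq_zero fun i _ => Finset.sum_eq_zero fun j _ => ?_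
  by_cases hi : i ≤ p ∧ Even (p - i)
  · by_cases hj : j ≤ q ∧ Even (q - j)
    · obtain ⟨a, ha⟩ := hi.2
      obtain ⟨b, hb⟩ := hj.2
      refine eilenbergN_of_ne ω ?_ ?_ _ _
      · rintro rfl; exact hm ⟨by omega, a + b + 1, by omega⟩
      · rintro rfl; exact hm ⟨by omega, a + b, by omega⟩
    · rw [hy j hj, map_zero]
  · rw [hx i hi, map_zero, LinearMap.zero_apply]

end NormalizedPairing

/-! ### The map ⋆ on cyclic homology -/

section Star

variable {C C' : CyclicModule.{u, v} k} {D : CyclicModule.{u, w} k} (ω : Pairing C C' D)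

theorem starTot_apply (p q : ℕ) (x : C.NTotal) (y : C'.NTotal) (m : ℕ) :
    ω.starTot p q x y m =
      ∑ j ∈ Finset.range (q + 1), ω.cross (p + 1) j m (C.BN p (x p)) (y j) := rfl

theorem starTot_eq_sum (p : ℕ) {q : ℕ} (x : C.NTotal) {y : C'.NTotal} (hy : y ∈ C'.Tot q)
    (m : ℕ) : ω.starTot p q x y m =
      ∑ j ∈ Finset.range (m + 1), ω.cross (p + 1) j m (C.BN p (x p)) (y j) := by
  rw [starTot_apply]
  rcases le_total q m with h | h
  · refine Finset.sum_subset (Finset.range_mono (by omega)) fun j _ hj => ?_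
    rw [Finset.mem_range] at hj
    rw [hy j (by omega), map_zero]
  · refine (Finset.sum_subset (Finset.range_mono (by omega)) fun j _ hj => ?_).symm
    rw [Finset.mem_range] at hj
    exact cross_of_ne ω (by omega) _ _

/-- The cyclic part vanishes on Bx_p. For a cycle x this says x ⋆ y = E(Dx, y), in the notation E
for `eilT` and D for b + B. -/
theorem starTot_eq_eilT (p : ℕ) {q : ℕ} (x : C.NTotal) {y : C'.NTotal} (hy : y ∈ C'.Tot q) :
    ω.starTot p q x y = eilT ω (LinearMap.single k C.NX (p + 1) (C.BN p (x p))) y := by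
  funext m
  rw [starTot_eq_sum ω p x hy, eilT_single_left]
  exact Finset.sum_congr rfl fun j _ => (eilenbergN_BN_left ω _ _ _ _ _).symm

theorem starTot_mem_Tot (p : ℕ) {q : ℕ} (x : C.NTotal) {y : C'.NTotal} (hy : y ∈ C'.Tot q) :
    ω.starTot p q x y ∈ D.Tot (p + q + 1) := by
  intro m hm
  rw [starTot_apply]
  refine Finset.sum_eq_zero fun j _ => ?_
  by_cases hj : j ≤ q ∧ Even (q - j)
  · obtain ⟨b, hb⟩ := hj.2
    refine cross_of_ne ω ?_ _ _
    rintro rfl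
    exact hm ⟨by omega, b, by omega⟩
  · rw [hy j hj, map_zero]

theorem eilT_BN_single_of_ne {p j m : ℕ} (h : m ≠ p + 1 + j) (x : C.NX p) (y : C'.NX j) :
    eilT ω (LinearMap.single k C.NX (p + 1) (C.BN p x)) (LinearMap.single k C'.NX j y) m = 0 := by
  rw [eilT_single_single, eilenbergN_BN_left, cross_of_ne ω h]

theorem single_BN_mem (p : ℕ) (x : C.NX p) :
    LinearMap.single k C.NX (p + 1) (C.BN p x) ∈ C.Tot (p + 1) :=
  single_mem_Tot le_rfl (by simp) _

/-- For a cycle x the element Bx_p in degree p + 1 is D x, hence is killed by D, and only the term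
with D y remains. -/
theorem dN_starTot {p q : ℕ} {x : C.NTotal} {y : C'.NTotal} (hx : x ∈ C.cycles p)
    (hy : y ∈ C'.Tot q) :
    D.dN (ω.starTot p q x y) = sg k (p + 1) •
      eilT ω (LinearMap.single k C.NX (p + 1) (C.BN p (x p))) (C'.dN y) := by
  have := dN_eilT ω (single_BN_mem p (x p)) hy
  rw [starTot_eq_eilT ω p x hy, this, ← dN_eq_of_mem_cycles hx, dN_dN hx.1, map_zero,
    LinearMap.zero_apply, zero_add]
  push_cast
  rfl

theorem starTot_mem_cycles {p q : ℕ} {x : C.NTotal} {y : C'.NTotal} (hx : x ∈ C.cycles p)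
    (hy : y ∈ C'.cycles q) : ω.starTot p q x y ∈ D.cycles (p + q + 1) := by
  refine ⟨starTot_mem_Tot ω p x hy.1, LinearMap.mem_ker.2 ?_⟩
  funext m
  rw [dTot_apply, Pi.zero_apply]
  split
  -- Both arguments are concentrated in one degree, and the product lies in degree p + q + 2, beyond
  -- what the truncated differential sees.
  · rw [dN_starTot ω hx hy.1, dN_eq_of_mem_cycles hy, Pi.smul_apply,
      eilT_BN_single_of_ne ω (by omega), smul_zero]
  · rfl

theorem dTot_eq {n : ℕ} {w z : D.NTotal} (h : ∀ m < n, D.dN w m = z m)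
    (hz : ∀ m, n ≤ m → z m = 0) : D.dTot n w = z := by
  funext m
  rw [dTot_apply]
  split
  · next hm => exact h m hm
  · next hm => exact (hz m (by omega)).symm

theorem starTot_boundary_right {p q : ℕ} {x : C.NTotal} {y : C'.NTotal} (hx : x ∈ C.cycles p)
    (hy : y ∈ C'.boundaries q) (hy' : y ∈ C'.cycles q) :
    ω.starTot p q x y ∈ D.boundaries (p + q + 1) := by
  obtain ⟨w, hw, rfl⟩ := hy
  -- With y = dTot w one has D w = y + B w_{q+1}. The extra term contributes only in degree p + q +
  -- 3, so D(x ⋆ w) is ±(x ⋆ y) in the range of the truncated differential.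
  refine ⟨sg k (p + 1) • ω.starTot p (q + 1) x w,
    Submodule.smul_mem _ _ (starTot_mem_Tot ω p x hw), dTot_eq ?_ ?_⟩
  · intro m hm
    rw [map_smul, dN_starTot ω hx hw, smul_smul, sg_mul_self, one_smul, dN_eq hw, map_add,
      Pi.add_apply, eilT_BN_single_of_ne ω (by omega), add_zero, starTot_eq_eilT ω p x hy'.1]
  · intro m hm
    exact starTot_mem_Tot ω p x hy'.1 m (by omega)

theorem starTot_boundary_left {p q : ℕ} {x : C.NTotal} {y : C'.NTotal}
    (hx : x ∈ C.boundaries p) (hx' : x ∈ C.cycles p) (hy : y ∈ C'.cycles q) :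
    ω.starTot p q x y ∈ D.boundaries (p + q + 1) := by
  obtain ⟨w, hw, rfl⟩ := hx
  have hw2 := dN_eq hw
  -- From D D w = 0 and D w = x + B w_{p+1} one gets D(B w_{p+1}) = -D x = -B x_p. This is why -(w ⋆
  -- y) has boundary x ⋆ y.
  have hd : C.dN (LinearMap.single k C.NX (p + 1 + 1) (C.BN (p + 1) (w (p + 1)))) =
      -LinearMap.single k C.NX (p + 1) (C.BN p (C.dTot (p + 1) w p)) := by
    rw [← dN_eq_of_mem_cycles hx', eq_neg_iff_add_eq_zero, add_comm, ← map_add, ← hw2, dN_dN hw]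
  refine ⟨-ω.starTot (p + 1) q w y, Submodule.neg_mem _ ?_, dTot_eq ?_ ?_⟩
  · have := starTot_mem_Tot ω (p + 1) w hy.1
    rwa [show p + q + 1 + 1 = p + 1 + q + 1 by omega]
  · intro m hm
    rw [map_neg, starTot_eq_eilT ω _ w hy.1, dN_eilT ω (single_BN_mem _ _) hy.1, hd,
      dN_eq_of_mem_cycles hy, Pi.neg_apply, Pi.add_apply, Pi.smul_apply,
      eilT_BN_single_of_ne ω (by omega), smul_zero, add_zero, map_neg, LinearMap.neg_apply,
      Pi.neg_apply, neg_neg, starTot_eq_eilT ω p _ hy.1]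
  · intro m hm
    exact starTot_mem_Tot ω p _ hy.1 m (by omega)

/-- The map on cycles induced by `⋆`. -/
def starCycles (p q : ℕ) : C.cycles p →ₗ[k] C'.cycles q →ₗ[k] D.HC (p + q + 1) :=
  LinearMap.mk₂ k (fun x y => HC.cls ⟨ω.starTot p q x y, starTot_mem_cycles ω x.2 y.2⟩)
    (fun x x' y => congrArg HC.cls (Subtype.ext (LinearMap.map_add₂ _ _ _ _)))
    (fun c x y => congrArg HC.cls (Subtype.ext (LinearMap.map_smul₂ _ _ _ _)))
    (fun x y y' => congrArg HC.cls (Subtype.ext (map_add _ _ _)))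
    (fun c x y => congrArg HC.cls (Subtype.ext (map_smul _ _ _)))

/-- The map on cyclic homology induced by `⋆`. -/
def starHC (p q : ℕ) : C.HC p →ₗ[k] C'.HC q →ₗ[k] D.HC (p + q + 1) :=
  Submodule.liftQ _
    (LinearMap.flip <| Submodule.liftQ _ (starCycles ω p q).flip fun y hy => by
      ext x
      exact (Submodule.Quotient.mk_eq_zero _).2 (starTot_boundary_right ω x.2 hy y.2))
    fun x hx => by
      ext y
      exact (Submodule.Quotient.mk_eq_zero _).2 (starTot_boundary_left ω hx x.2 y.2)

/-- The map `star` is a choice of an induced map, if there is one; `starHC` shows that there is. -/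
theorem isInducedByStar_star {p q n : ℕ} (h : p + q + 1 = n) :
    ω.IsInducedByStar (ω.star p q n) := by
  subst h
  have : ∃ F : C.HC p →ₗ[k] C'.HC q →ₗ[k] D.HC (p + q + 1), ω.IsInducedByStar F :=
    ⟨starHC ω p q, fun x y => ⟨starTot_mem_cycles ω x.2 y.2, rfl⟩⟩
  rw [Pairing.star, dif_pos this]
  exact this.choose_spec

theorem HC.exists_cls {n : ℕ} (x : C.HC n) : ∃ z : C.cycles n, HC.cls z = x :=
  Submodule.Quotient.mk_surjective _ x

end Star

/-! ### Associativity and commutativity on cyclic homology -/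

section Symmetry

variable {C C' C'' E E' : CyclicModule.{u, v} k} {D D' : CyclicModule.{u, w} k}

theorem mk_sh_eq {ω : Pairing C C' E} {p q s : ℕ} (hs : s = p + q) (x : C.X p) (y : C'.X q) :
    LinearMap.single k E.X s (ω.sh p q s x y) =
      shuf ω.tot p q 0 (LinearMap.single k C.X p x) (LinearMap.single k C'.X q y) := by
  rw [sh_eq_shuf]
  exact (shuf_isHomog ω (n := s) p q 0 _ _
    ((isHomog_single p x).cast (by subst hs; push_cast; ring))).eq_single.symm

theorem cross_assoc {ω₁ : Pairing C C' E} {ω₂ : Pairing E C'' D} {ω₃ : Pairing C' C'' E'}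
    {ω₄ : Pairing C E' D'} {φ : Hom D D'}
    (h : ∀ n x y z, φ.f n (ω₂.f n (ω₁.f n x y) z) = ω₄.f n x (ω₃.f n y z))
    {p q r s t : ℕ} (hs : s = p + q) (ht : t = q + r) (n : ℕ)
    (x : C.NX p) (y : C'.NX q) (z : C''.NX r) :
    φ.fN n (ω₂.cross s r n (ω₁.cross p q s x y) z) =
      ω₄.cross p t n x (ω₃.cross q r t y z) := by
  induction x using Submodule.Quotient.induction_on with
  | H x =>
    induction y using Submodule.Quotient.induction_on with
    | H y =>
      induction z using Submodule.Quotient.induction_on with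
      | H z =>
        rw [ω₁.cross_mk, ω₂.cross_mk, ω₃.cross_mk, ω₄.cross_mk, sh_eq_shuf, mk_sh_eq hs,
          sh_eq_shuf, mk_sh_eq ht, hs, ht, Nat.cast_add, Nat.cast_add, ← shuf_assoc ω₁ ω₂ ω₃ ω₄ φ h]
        rfl

theorem cross_comm {ω : Pairing C C' D'} {ω' : Pairing C' C D} {φ : Hom D D'}
    (h : ∀ n x y, φ.f n (ω'.f n y x) = ω.f n x y) {p q : ℕ} (n : ℕ) (x : C.NX p) (y : C'.NX q) :
    φ.fN n (ω'.cross q p n y x) = sg k (p * q) • ω.cross p q n x y := by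
  induction x using Submodule.Quotient.induction_on with
  | H x =>
    induction y using Submodule.Quotient.induction_on with
    | H y =>
      rw [ω.cross_mk, ω'.cross_mk, sh_eq_shuf, sh_eq_shuf]
      exact congrArg Submodule.Quotient.mk (congrFun (shuf_comm ω ω' φ h p q 0
        (LinearMap.single k C.X p x) (LinearMap.single k C'.X q y)) n)

/-- Since x ⋆ y is a cycle, D(x ⋆ y) is B of its leading term; by `dN_starTot` it is also ±Bx_p ×
By_q. -/
theorem BN_starTot {ω : Pairing C C' D} {p q : ℕ} {x : C.NTotal} {y : C'.NTotal}
    (hx : x ∈ C.cycles p) (hy : y ∈ C'.cycles q) :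
    D.BN (p + q + 1) (ω.starTot p q x y (p + q + 1)) =
      sg k (p + 1) • ω.cross (p + 1) (q + 1) (p + q + 1 + 1) (C.BN p (x p)) (C'.BN q (y q)) := by
  have h1 := congrFun (dN_eq_of_mem_cycles (starTot_mem_cycles ω hx hy)) (p + q + 1 + 1)
  rw [dN_starTot ω hx hy.1, dN_eq_of_mem_cycles hy, Pi.smul_apply, eilT_single_single,
    eilenbergN_BN_left, LinearMap.single_apply, Pi.single_eq_same] at h1
  exact h1.symm

/-- By `BN_starTot` both sides are sums of Bx_p × By_q × z_l, so they agree as chains and not merely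
up to homotopy; the sign is the one of `BN_starTot`. -/
theorem starTot_assoc {ω₁ : Pairing C C' E} {ω₂ : Pairing E C'' D} {ω₃ : Pairing C' C'' E'}
    {ω₄ : Pairing C E' D'} {φ : Hom D D'}
    (h : ∀ n x y z, φ.f n (ω₂.f n (ω₁.f n x y) z) = ω₄.f n x (ω₃.f n y z))
    {p q : ℕ} (r : ℕ) {x : C.NTotal} {y : C'.NTotal} (z : C''.NTotal)
    (hx : x ∈ C.cycles p) (hy : y ∈ C'.cycles q) :
    φ.fTot (ω₂.starTot (p + q + 1) r (ω₁.starTot p q x y) z) =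
      sg k (p + 1) • ω₄.starTot p (q + r + 1) x (ω₃.starTot q r y z) := by
  funext m
  change φ.fN m (ω₂.starTot (p + q + 1) r (ω₁.starTot p q x y) z m) = _
  rw [Pi.smul_apply, starTot_apply ω₂, starTot_apply ω₄, BN_starTot hx hy, map_sum]
  have e : ∀ j, ω₃.starTot q r y z j =
    ∑ l ∈ Finset.range (r + 1), ω₃.cross (q + 1) l j (C'.BN q (y q)) (z l) := fun j => rfl
  simp only [e, map_sum]
  rw [Finset.sum_comm, Finset.smul_sum]
  refine Finset.sum_congr rfl fun l hl => ?_
  have hl := Finset.mem_range.1 hl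
  rw [map_smul, LinearMap.smul_apply, map_smul,
    -- On the right-hand side the inner shuffle By_q × z_l lives only in degree q + 1 + l, so the
    -- sum over the degree j of the intermediate element collapses.
    cross_assoc h (show p + q + 1 + 1 = p + 1 + (q + 1) by omega) (rfl : q + 1 + l = q + 1 + l),
    Finset.sum_eq_single_of_mem (q + 1 + l) (Finset.mem_range.2 (by omega))]
  intro j _ hj
  rw [cross_of_ne ω₃ hj, map_zero]

/-- The cyclic part vanishes again, and the shuffle product is commutative up to the sign
(-1)^{i(q+1)}, which is the same for all degrees i occurring in x. -/
theorem eilT_BN_right {ω : Pairing C C' D'} {ω' : Pairing C' C D} {φ : Hom D D'}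
    (h : ∀ n x y, φ.f n (ω'.f n y x) = ω.f n x y) {p : ℕ} (q : ℕ) {x : C.NTotal} (y : C'.NTotal)
    (hx : x ∈ C.Tot p) :
    eilT ω x (LinearMap.single k C'.NX (q + 1) (C'.BN q (y q))) =
      sg k (p * (q + 1)) • φ.fTot (ω'.starTot q p y x) := by
  funext m
  change _ = sg k (p * (q + 1)) • φ.fN m (ω'.starTot q p y x m)
  rw [eilT_single_right, starTot_eq_sum ω' q y hx, map_sum, Finset.smul_sum]
  refine Finset.sum_congr rfl fun i _ => ?_
  rw [cross_comm h, eilenbergN_BN_right, smul_smul, ← sg_add]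
  by_cases hi : i ≤ p ∧ Even (p - i)
  · obtain ⟨a, ha⟩ := hi.2
    have hp : p = i + (a + a) := by omega
    rw [sg_eq_of_even k (n := 0), sg_zero, one_smul]
    subst hp
    exact ⟨(i + a) * (q + 1), by push_cast; ring⟩
  · rw [hx i hi, map_zero, LinearMap.zero_apply, smul_zero]

/-- The bounding chain is E(x, y): for cycles, D E(x, y) = E(Dx, y) ± E(x, Dy), and the two terms
are the two products. -/
theorem starTot_comm {ω : Pairing C C' D'} {ω' : Pairing C' C D} {φ : Hom D D'}
    (h : ∀ n x y, φ.f n (ω'.f n y x) = ω.f n x y) {p q : ℕ} {x : C.NTotal} {y : C'.NTotal}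
    (hx : x ∈ C.cycles p) (hy : y ∈ C'.cycles q) :
    ω.starTot p q x y + sg k (p * q) • φ.fTot (ω'.starTot q p y x) ∈
      D'.boundaries (p + q + 1) := by
  have hsum : D'.dN (eilT ω x y) =
      ω.starTot p q x y + sg k (p * q) • φ.fTot (ω'.starTot q p y x) := by
    rw [dN_eilT ω hx.1 hy.1, dN_eq_of_mem_cycles hx, dN_eq_of_mem_cycles hy,
      eilT_BN_right h q y hx.1, starTot_eq_eilT ω p x hy.1, smul_smul, ← sg_add]
    congr 2
    exact sg_eq_of_even k ⟨p, by ring⟩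
  refine ⟨eilT ω x y, eilT_mem_Tot ω hx.1 hy.1, dTot_eq (fun m _ => congrFun hsum m) ?_⟩
  intro m hm
  rw [Pi.add_apply, Pi.smul_apply, starTot_mem_Tot ω p x hy.1 m (by omega),
    φ.fTot_mem (starTot_mem_Tot ω' q y hx.1) m (by omega), smul_zero, add_zero]

theorem star_assoc {ω₁ : Pairing C C' E} {ω₂ : Pairing E C'' D} {ω₃ : Pairing C' C'' E'}
    {ω₄ : Pairing C E' D'} {φ : Hom D D'}
    (h : ∀ n x y z, φ.f n (ω₂.f n (ω₁.f n x y) z) = ω₄.f n x (ω₃.f n y z))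
    {p q r i j n : ℕ} (hi : p + q + 1 = i) (hin : i + r + 1 = n) (hj : q + r + 1 = j)
    (hjn : p + j + 1 = n) (x : C.HC p) (y : C'.HC q) (z : C''.HC r) :
    φ.mapHC n (ω₂.star i r n (ω₁.star p q i x y) z) =
      sg k (p + 1) • ω₄.star p j n x (ω₃.star q r j y z) := by
  obtain ⟨x, rfl⟩ := HC.exists_cls x
  obtain ⟨y, rfl⟩ := HC.exists_cls y
  obtain ⟨z, rfl⟩ := HC.exists_cls z
  obtain ⟨h1, e1⟩ := isInducedByStar_star ω₁ hi x y
  obtain ⟨h3, e3⟩ := isInducedByStar_star ω₃ hj y z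
  obtain ⟨h2, e2⟩ := isInducedByStar_star ω₂ hin ⟨_, h1⟩ z
  obtain ⟨h4, e4⟩ := isInducedByStar_star ω₄ hjn x ⟨_, h3⟩
  rw [e1, e2, e3, e4]
  subst hi hj
  exact congrArg HC.cls (Subtype.ext (starTot_assoc h r z.1 x.2 y.2))

theorem star_comm {ω : Pairing C C' D'} {ω' : Pairing C' C D} {φ : Hom D D'}
    (h : ∀ n x y, φ.f n (ω'.f n y x) = ω.f n x y) {p q n : ℕ} (hpq : p + q + 1 = n)
    (hqp : q + p + 1 = n) (x : C.HC p) (y : C'.HC q) :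
    ω.star p q n x y = -(sg k (p * q) • φ.mapHC n (ω'.star q p n y x)) := by
  obtain ⟨x, rfl⟩ := HC.exists_cls x
  obtain ⟨y, rfl⟩ := HC.exists_cls y
  obtain ⟨h1, e1⟩ := isInducedByStar_star ω hpq x y
  obtain ⟨h2, e2⟩ := isInducedByStar_star ω' hqp y x
  rw [e1, e2, eq_neg_iff_add_eq_zero]
  subst hpq
  exact (Submodule.Quotient.mk_eq_zero _).2 (starTot_comm h x.2 y.2)

/-- The composition of a pairing with a morphism. -/
def Pairing.comp (ω : Pairing C C' D) (φ : Hom D D') : Pairing C C' D' where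
  f n := (ω.f n).compr₂ (φ.f n)
  f_d n i hi x y := by
    simp only [LinearMap.compr₂_apply]
    rw [ω.f_d n i hi, φ.f_d n i hi]
  f_s n i hi x y := by
    simp only [LinearMap.compr₂_apply]
    rw [ω.f_s n i hi, φ.f_s n i hi]
  f_t n x y := by
    simp only [LinearMap.compr₂_apply]
    rw [ω.f_t, φ.f_t]

theorem cross_comp (ω : Pairing C C' D) (φ : Hom D D') (p q n : ℕ) (x : C.NX p) (y : C'.NX q) :
    φ.fN n (ω.cross p q n x y) = (ω.comp φ).cross p q n x y := by
  induction x using Submodule.Quotient.induction_on with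
  | H x =>
    induction y using Submodule.Quotient.induction_on with
    | H y =>
      refine congrArg Submodule.Quotient.mk ?_
      simp only [Pairing.sh, LinearMap.sum_apply, LinearMap.smul_apply, map_sum, map_smul,
        LinearMap.compl₁₂_apply]
      rfl

theorem star_comp (ω : Pairing C C' D) (φ : Hom D D') {p q n : ℕ} (h : p + q + 1 = n)
    (x : C.HC p) (y : C'.HC q) :
    φ.mapHC n (ω.star p q n x y) = (ω.comp φ).star p q n x y := by
  obtain ⟨x, rfl⟩ := HC.exists_cls x
  obtain ⟨y, rfl⟩ := HC.exists_cls y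
  obtain ⟨h1, e1⟩ := isInducedByStar_star ω h x y
  obtain ⟨h2, e2⟩ := isInducedByStar_star (ω.comp φ) h x y
  rw [e1, e2]
  refine congrArg HC.cls (Subtype.ext ?_)
  funext m
  change φ.fN m (ω.starTot p q x.1 y.1 m) = (ω.comp φ).starTot p q x.1 y.1 m
  rw [starTot_apply, starTot_apply, map_sum]
  exact Finset.sum_congr rfl fun j _ => cross_comp ω φ _ _ _ _ _

/-- The identity morphism. -/
def Hom.id (C : CyclicModule.{u, v} k) : Hom C C where
  f _ := LinearMap.id
  f_d _ _ _ _ := rfl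
  f_s _ _ _ _ := rfl
  f_t _ _ := rfl

theorem Hom.mapHC_id (n : ℕ) (x : C.HC n) : (Hom.id C).mapHC n x = x := by
  obtain ⟨x, rfl⟩ := HC.exists_cls x
  refine congrArg HC.cls (Subtype.ext ?_)
  funext m
  change (Hom.id C).fN m (x.1 m) = x.1 m
  induction x.1 m using Submodule.Quotient.induction_on with
  | H x => rfl

/-- The product `x • y = (-1)^{p+1} x ⋆ y`. -/
def Pairing.bullet (ω : Pairing C C' D) (p q n : ℕ) : C.HC p →ₗ[k] C'.HC q →ₗ[k] D.HC n :=
  (-1 : k) ^ (p + 1) • ω.star p q n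

theorem bullet_apply (ω : Pairing C C' D) (p q n : ℕ) (x : C.HC p) (y : C'.HC q) :
    ω.bullet p q n x y = sg k (p + 1) • ω.star p q n x y := by
  rw [show ((p : ℤ) + 1) = ((p + 1 : ℕ) : ℤ) by push_cast; ring, sg_natCast]
  rfl

/-- The outer factor (-1)^{p+q+2} on the left contains the degree of x ⋆ y; together with the sign
of `star_assoc` all signs balance, which is the purpose of the sign in •. -/
theorem bullet_assoc {ω₁ : Pairing C C' E} {ω₂ : Pairing E C'' D} {ω₃ : Pairing C' C'' E'}
    {ω₄ : Pairing C E' D'} {φ : Hom D D'}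
    (h : ∀ n x y z, φ.f n (ω₂.f n (ω₁.f n x y) z) = ω₄.f n x (ω₃.f n y z))
    {p q r i j n : ℕ} (hi : p + q + 1 = i) (hin : i + r + 1 = n) (hj : q + r + 1 = j)
    (hjn : p + j + 1 = n) (x : C.HC p) (y : C'.HC q) (z : C''.HC r) :
    φ.mapHC n (ω₂.bullet i r n (ω₁.bullet p q i x y) z) =
      ω₄.bullet p j n x (ω₃.bullet q r j y z) := by
  rw [bullet_apply, bullet_apply, bullet_apply, bullet_apply, map_smul, map_smul, map_smul,
    LinearMap.smul_apply, map_smul, star_assoc h hi hin hj hjn, smul_smul, smul_smul,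
    smul_smul, ← sg_add, ← sg_add, ← sg_add]
  congr 1
  subst hi
  exact sg_eq_of_even k ⟨p + 1, by push_cast; ring⟩

/-- The minus sign of `star_comm` comes from the homotopy; combined with the factors (-1)^{p+1} and
(-1)^{q+1} it turns (-1)^{pq} into the Koszul sign for degrees p + 1 and q + 1. -/
theorem bullet_comm {ω : Pairing C C' D'} {ω' : Pairing C' C D} {φ : Hom D D'}
    (h : ∀ n x y, φ.f n (ω'.f n y x) = ω.f n x y) {p q n : ℕ} (hpq : p + q + 1 = n)
    (hqp : q + p + 1 = n) (x : C.HC p) (y : C'.HC q) :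
    ω.bullet p q n x y =
      (-1 : k) ^ ((p + 1) * (q + 1)) • φ.mapHC n (ω'.bullet q p n y x) := by
  rw [bullet_apply, bullet_apply, map_smul, star_comm h hpq hqp, ← sg_natCast, smul_neg,
    ← neg_smul, smul_smul, ← sg_succ, smul_smul, ← sg_add, ← sg_add]
  congr 1
  exact sg_eq_of_even k ⟨-q, by push_cast; ring⟩

theorem bullet_comp (ω : Pairing C C' D) (φ : Hom D D') {p q n : ℕ} (h : p + q + 1 = n)
    (x : C.HC p) (y : C'.HC q) :
    φ.mapHC n (ω.bullet p q n x y) = (ω.comp φ).bullet p q n x y := by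
  rw [bullet_apply, bullet_apply, map_smul, star_comp ω φ h]

end Symmetry

end CyclicModule

/-! ### Symmetry and associativity of the pairing of tensor powers -/

section TenSymmetry

variable {k H K L V W U : Type u} [Field k] [Ring H] [Algebra k H] [Ring K] [Algebra k K]
  [Ring L] [Algebra k L] [AddCommGroup V] [Module k V] [AddCommGroup W] [Module k W]
  [AddCommGroup U] [Module k U]

theorem pairT_comm (n : ℕ) (x : Ten k H V n) (y : Ten k K W n) :
    tmap (TensorProduct.comm k H K).toLinearMap n (TensorProduct.comm k V W).toLinearMap
      (pairT n x y) = pairT n y x := by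
  induction n with
  | zero => rfl
  | succ n ih =>
    induction x, y using ten_induction₂ with
    | zl y => simp only [map_zero, LinearMap.zero_apply]
    | zr x => simp only [map_zero, LinearMap.zero_apply]
    | al x x' y hx hx' => simp only [map_add, LinearMap.add_apply, hx, hx']
    | ar x y y' hy hy' => simp only [map_add, LinearMap.add_apply, hy, hy']
    | cons h x g y => simp [ih]

theorem pairT_assoc (n : ℕ) (x : Ten k H V n) (y : Ten k K W n) (z : Ten k L U n) :
    tmap (TensorProduct.assoc k H K L).toLinearMap n (TensorProduct.assoc k V W U).toLinearMap
      (pairT n (pairT n x y) z) = pairT n x (pairT n y z) := by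
  induction n with
  | zero => rfl
  | succ n ih =>
    induction x, y using ten_induction₂ with
    | zl y => simp only [map_zero, LinearMap.zero_apply]
    | zr x => simp only [map_zero, LinearMap.zero_apply]
    | al x x' y hx hx' => simp only [map_add, LinearMap.add_apply, hx, hx']
    | ar x y y' hy hy' => simp only [map_add, LinearMap.add_apply, hy, hy']
    | cons h x g y =>
      induction z using ten_induction with
      | zero => simp only [map_zero]
      | add z z' hz hz' => simp only [map_add, hz, hz']
      | cons l z => simp [ih]

end TenSymmetry

open CyclicModule

/-! ### Products for Hopf algebras and the internal product -/

section HopfSymmetry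

variable {k H K L M N P A : Type u} [Field k]
  [Ring H] [HopfAlgebra k H] [HasBijectiveAntipode k H]
  [Ring K] [HopfAlgebra k K] [HasBijectiveAntipode k K]
  [Ring L] [HopfAlgebra k L] [HasBijectiveAntipode k L]
  [AddCommGroup M] [Module k M] [AddCommGroup N] [Module k N] [AddCommGroup P] [Module k P]
  (𝓜 : SAYD k H M) (𝓝 : SAYD k K N) (𝓟 : SAYD k L P)
  [CommRing A] [HopfAlgebra k A]

theorem hopfPairing_assoc (n : ℕ) (x : (hopfCyclic 𝓜).X n) (y : (hopfCyclic 𝓝).X n)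
    (z : (hopfCyclic 𝓟).X n) :
    (SAYD.assocHom 𝓜 𝓝 𝓟).toCyclic.f n
        ((hopfPairing (𝓜.tensor 𝓝) 𝓟).f n ((hopfPairing 𝓜 𝓝).f n x y) z) =
      (hopfPairing 𝓜 (𝓝.tensor 𝓟)).f n x ((hopfPairing 𝓝 𝓟).f n y z) :=
  Subtype.ext (pairT_assoc (n + 1) x.1 y.1 z.1)

theorem hopfPairing_comm (n : ℕ) (x : (hopfCyclic 𝓜).X n) (y : (hopfCyclic 𝓝).X n) :
    (SAYD.commHom 𝓝 𝓜).toCyclic.f n ((hopfPairing 𝓝 𝓜).f n y x) = (hopfPairing 𝓜 𝓝).f n x y :=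
  Subtype.ext (pairT_comm (n + 1) y.1 x.1)

variable (k A) in
/-- The pairing of the cyclic module of a commutative Hopf algebra with itself given by the
multiplication. -/
def mulPairing : Pairing (hopfCyclic (SAYD.trivialComm k A)) (hopfCyclic (SAYD.trivialComm k A))
    (hopfCyclic (SAYD.trivialComm k A)) :=
  (hopfPairing (SAYD.trivialComm k A) (SAYD.trivialComm k A)).comp (SAYD.mulHom k A).toCyclic

theorem mulPairing_comm (n : ℕ) (x y : (hopfCyclic (SAYD.trivialComm k A)).X n) :
    (Hom.id _).f n ((mulPairing k A).f n y x) = (mulPairing k A).f n x y := by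
  refine Subtype.ext ?_
  change tmap (LinearMap.mul' k A) (n + 1) (TensorProduct.lid k k).toLinearMap
      (pairT (n + 1) y.1 x.1) =
    tmap (LinearMap.mul' k A) (n + 1) (TensorProduct.lid k k).toLinearMap (pairT (n + 1) x.1 y.1)
  have h1 : LinearMap.mul' k A ∘ₗ (TensorProduct.comm k A A).toLinearMap = LinearMap.mul' k A :=
    TensorProduct.ext' fun a b => mul_comm b a
  have h2 : (TensorProduct.lid k k).toLinearMap ∘ₗ (TensorProduct.comm k k k).toLinearMap =
      (TensorProduct.lid k k).toLinearMap := TensorProduct.ext' fun a b => mul_comm b a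
  rw [← pairT_comm (n + 1) x.1 y.1, tmap_tmap, h1, h2]

theorem mulPairing_assoc (n : ℕ) (x y z : (hopfCyclic (SAYD.trivialComm k A)).X n) :
    (Hom.id _).f n ((mulPairing k A).f n ((mulPairing k A).f n x y) z) =
      (mulPairing k A).f n x ((mulPairing k A).f n y z) := by
  refine Subtype.ext ?_
  change tmap (LinearMap.mul' k A) (n + 1) (TensorProduct.lid k k).toLinearMap
      (pairT (n + 1) (tmap (LinearMap.mul' k A) (n + 1) (TensorProduct.lid k k).toLinearMap
        (pairT (n + 1) x.1 y.1)) z.1) =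
    tmap (LinearMap.mul' k A) (n + 1) (TensorProduct.lid k k).toLinearMap
      (pairT (n + 1) x.1 (tmap (LinearMap.mul' k A) (n + 1) (TensorProduct.lid k k).toLinearMap
        (pairT (n + 1) y.1 z.1)))
  have h1 : LinearMap.mul' k A ∘ₗ TensorProduct.map (LinearMap.mul' k A) LinearMap.id =
      (LinearMap.mul' k A ∘ₗ TensorProduct.map LinearMap.id (LinearMap.mul' k A)) ∘ₗ
        (TensorProduct.assoc k A A A).toLinearMap :=
    TensorProduct.ext_threefold fun a b c => mul_assoc a b c
  have h2 : (TensorProduct.lid k k).toLinearMap ∘ₗ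
        TensorProduct.map (TensorProduct.lid k k).toLinearMap LinearMap.id =
      ((TensorProduct.lid k k).toLinearMap ∘ₗ
        TensorProduct.map LinearMap.id (TensorProduct.lid k k).toLinearMap) ∘ₗ
        (TensorProduct.assoc k k k k).toLinearMap :=
    TensorProduct.ext_threefold fun a b c => mul_assoc a b c
  -- The untouched factors are written as images under the identity so that `pairT_tmap` moves both
  -- inner multiplications outside; what remains is associativity of the multiplication of A and of
  -- k.
  rw [← tmap_id (n + 1) z.1, ← tmap_id (n + 1) x.1, pairT_tmap, pairT_tmap, tmap_id, tmap_id,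
    ← pairT_assoc, tmap_tmap, tmap_tmap, tmap_tmap, h1, h2]

/-- The internal product is the product for a pairing of the cyclic module of A with itself, so the
general associativity and commutativity apply with the identity as comparison morphism. -/
theorem HopfHC.mul_eq {p q n : ℕ} (h : p + q + 1 = n) (x : HopfHC (SAYD.trivialComm k A) p)
    (y : HopfHC (SAYD.trivialComm k A) q) :
    HopfHC.mul h x y = (mulPairing k A).bullet p q n x y :=
  bullet_comp (hopfPairing (SAYD.trivialComm k A) (SAYD.trivialComm k A))
    (SAYD.mulHom k A).toCyclic h x y

theorem HopfHC.prod_eq {p q n : ℕ} (h : p + q + 1 = n) (x : HopfHC 𝓜 p) (y : HopfHC 𝓝 q) :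
    HopfHC.prod 𝓜 𝓝 h x y = (hopfPairing 𝓜 𝓝).bullet p q n x y := rfl

theorem HopfHC.prod_comm {p q n : ℕ} (hpq : p + q + 1 = n) (hqp : q + p + 1 = n)
    (x : HopfHC 𝓜 p) (y : HopfHC 𝓝 q) :
    HopfHC.prod 𝓜 𝓝 hpq x y =
      (-1 : k) ^ ((p + 1) * (q + 1)) •
        HopfHC.map (SAYD.commHom 𝓝 𝓜) n (HopfHC.prod 𝓝 𝓜 hqp y x) := by
  have e := bullet_comm (ω := hopfPairing 𝓜 𝓝) (ω' := hopfPairing 𝓝 𝓜)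
      (φ := (SAYD.commHom 𝓝 𝓜).toCyclic) (hopfPairing_comm 𝓜 𝓝) hpq hqp x y
  rw [HopfHC.prod_eq, HopfHC.prod_eq, HopfHC.map]
  exact e

theorem HopfHC.prod_assoc {p q r i j n : ℕ} (hpq : p + q + 1 = i) (hir : i + r + 1 = n)
    (hqr : q + r + 1 = j) (hpj : p + j + 1 = n) (x : HopfHC 𝓜 p) (y : HopfHC 𝓝 q)
    (z : HopfHC 𝓟 r) :
    HopfHC.map (SAYD.assocHom 𝓜 𝓝 𝓟) n
        (HopfHC.prod (𝓜.tensor 𝓝) 𝓟 hir (HopfHC.prod 𝓜 𝓝 hpq x y) z) =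
      HopfHC.prod 𝓜 (𝓝.tensor 𝓟) hpj x (HopfHC.prod 𝓝 𝓟 hqr y z) :=
  bullet_assoc (φ := (SAYD.assocHom 𝓜 𝓝 𝓟).toCyclic) (hopfPairing_assoc 𝓜 𝓝 𝓟)
    hpq hir hqr hpj x y z

theorem HopfHC.mul_assoc {p q r i j n : ℕ} (hpq : p + q + 1 = i) (hir : i + r + 1 = n)
    (hqr : q + r + 1 = j) (hpj : p + j + 1 = n) (x : HopfHC (SAYD.trivialComm k A) p)
    (y : HopfHC (SAYD.trivialComm k A) q) (z : HopfHC (SAYD.trivialComm k A) r) :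
    HopfHC.mul hir (HopfHC.mul hpq x y) z = HopfHC.mul hpj x (HopfHC.mul hqr y z) := by
  have e := bullet_assoc (mulPairing_assoc (k := k) (A := A)) hpq hir hqr hpj x y z
  rw [Hom.mapHC_id] at e
  rwa [HopfHC.mul_eq, HopfHC.mul_eq, HopfHC.mul_eq, HopfHC.mul_eq]

theorem HopfHC.mul_comm {p q n : ℕ} (hpq : p + q + 1 = n) (hqp : q + p + 1 = n)
    (x : HopfHC (SAYD.trivialComm k A) p) (y : HopfHC (SAYD.trivialComm k A) q) :
    HopfHC.mul hpq x y = (-1 : k) ^ ((p + 1) * (q + 1)) • HopfHC.mul hqp y x := by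
  have e := bullet_comm (mulPairing_comm (k := k) (A := A)) hpq hqp x y
  rw [Hom.mapHC_id] at e
  rw [HopfHC.mul_eq, HopfHC.mul_eq]
  exact e

end HopfSymmetry

end

theorem mainTheorem10 {k H K L M N P A : Type u} [Field k] [CharZero k]
    [Ring H] [HopfAlgebra k H] [HasBijectiveAntipode k H]
    [Ring K] [HopfAlgebra k K] [HasBijectiveAntipode k K]
    [Ring L] [HopfAlgebra k L] [HasBijectiveAntipode k L]
    [AddCommGroup M] [Module k M] [AddCommGroup N] [Module k N] [AddCommGroup P] [Module k P]
    (𝓜 : SAYD k H M) (𝓝 : SAYD k K N) (𝓟 : SAYD k L P)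
    [CommRing A] [HopfAlgebra k A] :
    -- the map `⋆` of total complexes induces a map on cyclic homology
    (∀ {p q n : ℕ} (h : p + q + 1 = n),
      (hopfPairing 𝓜 𝓝).IsInducedByStar (HopfHC.star 𝓜 𝓝 h)) ∧
    -- the exterior product is associative
    (∀ {p q r i j n : ℕ} (hpq : p + q + 1 = i) (hir : i + r + 1 = n) (hqr : q + r + 1 = j)
      (hpj : p + j + 1 = n) (x : HopfHC 𝓜 p) (y : HopfHC 𝓝 q) (z : HopfHC 𝓟 r),
      HopfHC.map (SAYD.assocHom 𝓜 𝓝 𝓟) n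
          (HopfHC.prod (𝓜.tensor 𝓝) 𝓟 hir (HopfHC.prod 𝓜 𝓝 hpq x y) z) =
        HopfHC.prod 𝓜 (𝓝.tensor 𝓟) hpj x (HopfHC.prod 𝓝 𝓟 hqr y z)) ∧
    -- the exterior product is graded commutative
    (∀ {p q n : ℕ} (hpq : p + q + 1 = n) (hqp : q + p + 1 = n) (x : HopfHC 𝓜 p)
      (y : HopfHC 𝓝 q),
      HopfHC.prod 𝓜 𝓝 hpq x y =
        (-1 : k) ^ ((p + 1) * (q + 1)) •
          HopfHC.map (SAYD.commHom 𝓝 𝓜) n (HopfHC.prod 𝓝 𝓜 hqp y x)) ∧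
    -- the internal product of a commutative Hopf algebra is associative
    (∀ {p q r i j n : ℕ} (hpq : p + q + 1 = i) (hir : i + r + 1 = n) (hqr : q + r + 1 = j)
      (hpj : p + j + 1 = n) (x : HopfHC (SAYD.trivialComm k A) p)
      (y : HopfHC (SAYD.trivialComm k A) q) (z : HopfHC (SAYD.trivialComm k A) r),
      HopfHC.mul hir (HopfHC.mul hpq x y) z = HopfHC.mul hpj x (HopfHC.mul hqr y z)) ∧
    -- the internal product of a commutative Hopf algebra is graded commutative
    (∀ {p q n : ℕ} (hpq : p + q + 1 = n) (hqp : q + p + 1 = n)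
      (x : HopfHC (SAYD.trivialComm k A) p) (y : HopfHC (SAYD.trivialComm k A) q),
      HopfHC.mul hpq x y = (-1 : k) ^ ((p + 1) * (q + 1)) • HopfHC.mul hqp y x) := by
  exact ⟨fun h => CyclicModule.isInducedByStar_star _ h, HopfHC.prod_assoc 𝓜 𝓝 𝓟,
    HopfHC.prod_comm 𝓜 𝓝, HopfHC.mul_assoc, HopfHC.mul_comm⟩
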